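/- Let $(\mathcal M,g)$ be a smooth 4-dimensional Lorentzian manifold of signature $(+,-,-,-)$ with a spin structure; let $\nabla$ be the Levi-Civita connection and its spinor extension, with $\nabla_a\nabla_bv^c-\nabla_b\nabla_av^c=R_{ab}{}^c{}_dv^d$ and $R_{bd}=R_{ab}{}^a{}_d$. Spinor indices are moved by $\xi^A=\epsilon^{AB}\xi_B$, $\xi_B=\xi^A\epsilon_{AB}$, $g_{ab}$ corresponds to $\epsilon_{AB}\epsilon_{A'B'}$, and $\square=\nabla_{AA'}\nabla^{AA'}$. Let $\Lambda=R/24$, let $\Phi_{ABA'B'}$ be the spinorial counterpart of $-\tfrac12(R_{ab}-\tfrac14Rg_{ab})$, let $L_{ab}=\tfrac12R_{ab}-\tfrac1{12}Rg_{ab}$ be the Schouten tensor, let the Weyl tensor $C_{abcd}$ be defined by $R_{abcd}=g_{bd}L_{ac}-g_{ad}L_{bc}+L_{bd}g_{ac}-L_{ad}g_{bc}+C_{abcd}$, and let $\Psi_{ABCD}$ be the Weyl spinor, $C_{AA'BB'CC'DD'}=\bar\Psi_{A'B'C'D'}\epsilon_{AB}\epsilon_{CD}+\Psi_{ABCD}\epsilon_{A'B'}\epsilon_{C'D'}$.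 Let $\Xi$ and $s$ be smooth real functions and $Y_{ABCC'}=Y_{(ABC)C'}$ a smooth spinor field, and put $Y_{AA'BB'CC'}=\bar Y_{A'B'C'C}\epsilon_{AB}+Y_{ABCC'}\epsilon_{A'B'}$. Assume the conformal Einstein field equations $$\nabla_{BB'}\nabla_{AA'}\Xi-\Xi\Phi_{ABA'B'}+\Xi\Lambda\epsilon_{AB}\epsilon_{A'B'}-s\,\epsilon_{AB}\epsilon_{A'B'}=0,$$ $$\nabla_{AA'}s-\Phi_{AA'}{}^{BB'}\nabla_{BB'}\Xi+\Lambda\nabla_{AA'}\Xi=0,$$ $$-Y_{ABCC'}+\nabla_{AA'}\Phi_{BCC'}{}^{A'}+\epsilon_{BC}\nabla_{AC'}\Lambda+\nabla_{BA'}\Phi_{ACC'}{}^{A'}+\epsilon_{AC}\nabla_{BC'}\Lambda=0,$$ $$-2\Phi^{CD}{}_{A'B'}\Psi_{ABCD}-2\Phi_{AB}{}^{C'D'}\bar\Psi_{A'B'C'D'}+\nabla_{CC'}Y_{AA'}{}^{CC'}{}_{BB'}=0,$$ $$-\tfrac12Y_{BCFC'}+\nabla_{AC'}\Psi_{BCF}{}^A=0,$$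 and let $\kappa_{AB}=\kappa_{(AB)}$ be a Killing spinor, that is, a smooth spinor field with $H_{A'ABC}=3\nabla_{A'(A}\kappa_{BC)}=0$. Let $\xi_{AA'}=\nabla^B{}_{A'}\kappa_{AB}$. Then $$\nabla_{CC'}\xi_{DD'}+\nabla_{DD'}\xi_{CC'}+6\kappa_{(D}{}^A\Phi_{C)AC'D'}=0,\qquad \kappa_{(D}{}^F\Psi_{ABC)F}=0 .$$ Moreover, $X_{AA'}=\Xi\,\xi_{AA'}-3\kappa_{AQ}\nabla_{A'}{}^Q\Xi$ is the spinorial counterpart of a (complex) conformal Killing vector $X_a$ that satisfies the unphysical Killing equations $$\nabla_aX_b+\nabla_bX_a=\tfrac12(\nabla_cX^c)g_{ab},\qquad X^a\nabla_a\Xi=\tfrac14\,\Xi\,\nabla_aX^a .$$ In addition, $\kappa_{AB}$ and $\xi_{AA'}$ satisfy the wave equations $$\square\kappa_{BC}=-4\Lambda\kappa_{BC}+\kappa^{AD}\Psi_{BCAD},$$ $$\square\xi_{AA'}=-6\Lambda\xi_{AA'}-2\xi^{BB'}\Phi_{ABA'B'}-\tfrac32\kappa^{BC}Y_{ABCA'}-12\kappa_{AB}\nabla^B{}_{A'}\Lambda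 .$$ -/

import Mathlib

open scoped Manifold ContDiff

noncomputable section

namespace SpinorCFE

/-- The model space of a four-dimensional manifold. -/
abbrev E4 : Type := EuclideanSpace ℝ (Fin 4)

/-- The Minkowski matrix `diag (1, -1, -1, -1)`. -/
def eta (a b : Fin 4) : ℝ := if a = b then (if a = 0 then 1 else -1) else 0

/-- The antisymmetric symbol: `ε₀₁ = ε⁰¹ = 1`. Indices are moved by `ξ^A = ε^{AB} ξ_B` and
`ξ_B = ξ^A ε_{AB}`. The same symbol serves for primed indices. -/
def eps (A B : Fin 2) : ℂ := !![0, 1; -1, 0] A B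

/-- The Infeld–van der Waerden symbols `σ^a_{AA'}`: the Pauli matrices divided by `√2`. If `e_a` is
an orthonormal tetrad then `e_{AA'} = ∑ a, σ^a_{AA'} e_a` is a null tetrad with
`g (e_{AA'}, e_{BB'}) = ε_{AB} ε_{A'B'}`, and conversely
`e_a = ∑ A A', conj (σ^a_{AA'}) e_{AA'}`. -/
def sigma (a : Fin 4) (A A' : Fin 2) : ℂ :=
  ((Real.sqrt 2 : ℝ) : ℂ)⁻¹ *
    (![!![1, 0; 0, 1], !![0, 1; 1, 0], !![0, -Complex.I; Complex.I, 0], !![1, 0; 0, -1]] a :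
      Matrix (Fin 2) (Fin 2) ℂ) A A'

/-- The entry `L_b{}^a` of the Lorentz matrix covered by `P ∈ SL(2, ℂ)`, that is, the matrix such
that `e'_b = ∑ a, L_b{}^a e_a` whenever
`e'_{AA'} = ∑ B B', P_A{}^B conj (P_{A'}{}^{B'}) e_{BB'}`. -/
def lorentzOf (P : Matrix.SpecialLinearGroup (Fin 2) ℂ) (b a : Fin 4) : ℝ :=
  (∑ A, ∑ A', ∑ B, ∑ B',
    star (sigma b A A') * P.1 A B * star (P.1 A' B') * sigma a B B').re

section Geometry

variable (M : Type*) [TopologicalSpace M] [ChartedSpace E4 M] [IsManifold (𝓡 4) ∞ M]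

/-- A smooth Lorentzian metric of signature `(+, -, -, -)` on a four-dimensional manifold. -/
structure LorentzianMetric where
  inner : ∀ x : M, TangentSpace (𝓡 4) x →L[ℝ] TangentSpace (𝓡 4) x →L[ℝ] ℝ
  symm : ∀ (x : M) (v w : TangentSpace (𝓡 4) x), inner x v w = inner x w v
  signature : ∀ x : M, ∃ b : Module.Basis (Fin 4) ℝ (TangentSpace (𝓡 4) x),
    ∀ a c, inner x (b a) (b c) = eta a c
  contMDiff : ContMDiff (𝓡 4) ((𝓡 4).prod 𝓘(ℝ, E4 →L[ℝ] E4 →L[ℝ] ℝ)) ∞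
    (fun x : M => (Bundle.TotalSpace.mk' (E4 →L[ℝ] E4 →L[ℝ] ℝ) x (inner x) :
      Bundle.TotalSpace (E4 →L[ℝ] E4 →L[ℝ] ℝ)
        (fun x : M => TangentSpace (𝓡 4) x →L[ℝ] TangentSpace (𝓡 4) x →L[ℝ] ℝ)))

variable {M}

/-- A spin structure on `(M, g)`, given by an atlas of local spin frames. Over the open set
`dom i` there is a spin dyad; it induces the smooth orthonormal tetrad `frame i`. On an overlap the
dyads are related by the smooth `SL(2, ℂ)`-valued function `trans i j`,
`ε^{(j)}_A = ∑ B, (trans i j)_A{}^B ε^{(i)}_B`, which satisfies the cocycle condition and covers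
the change of tetrad. -/
structure SpinStructure (g : LorentzianMetric M) (ι : Type*) where
  dom : ι → Set M
  isOpen_dom : ∀ i, IsOpen (dom i)
  exists_mem_dom : ∀ x : M, ∃ i, x ∈ dom i
  frame : ι → Fin 4 → ∀ x : M, TangentSpace (𝓡 4) x
  frame_smooth : ∀ i a, ContMDiffOn (𝓡 4) (𝓡 4).tangent ∞
    (fun x : M => (⟨x, frame i a x⟩ : TangentBundle (𝓡 4) M)) (dom i)
  frame_orthonormal : ∀ i, ∀ x ∈ dom i, ∀ a b,
    g.inner x (frame i a x) (frame i b x) = eta a b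
  trans : ι → ι → M → Matrix.SpecialLinearGroup (Fin 2) ℂ
  trans_smooth : ∀ i j A B, ContMDiffOn (𝓡 4) 𝓘(ℝ, ℂ) ∞
    (fun x => (trans i j x).1 A B) (dom i ∩ dom j)
  trans_cocycle : ∀ i j k, ∀ x ∈ dom i ∩ dom j ∩ dom k,
    trans j k x * trans i j x = trans i k x
  trans_frame : ∀ i j, ∀ x ∈ dom i ∩ dom j, ∀ b,
    frame j b x = ∑ a, lorentzOf (trans i j x) b a • frame i a x

namespace SpinStructure

variable {g : LorentzianMetric M} {ι : Type*} (S : SpinStructure g ι)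

/-! ### Tensor calculus in the orthonormal tetrads

In the tetrad number `i`, tensor indices run over `Fin 4`. -/

/-- The derivative `e_a (f)` of a function along a vector of the tetrad. -/
def frameDeriv {F : Type*} [NormedAddCommGroup F] [NormedSpace ℝ F]
    (i : ι) (a : Fin 4) (f : M → F) (x : M) : F :=
  (mfderiv (𝓡 4) 𝓘(ℝ, F) f x : TangentSpace (𝓡 4) x →L[ℝ] F) (S.frame i a x)

/-- `c_{abd} = g ([e_a, e_b], e_d)`. -/
def bracketCoeff (i : ι) (a b d : Fin 4) (x : M) : ℝ :=
  g.inner x (VectorField.mlieBracket (𝓡 4) (S.frame i a) (S.frame i b) x) (S.frame i d x)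

/-- The Levi-Civita connection `Γ_a{}^c{}_b`, where `∇_{e_a} e_b = ∑ c, Γ_a{}^c{}_b e_c`, as given by
the Koszul formula in an orthonormal tetrad. -/
def conn (i : ι) (a c b : Fin 4) (x : M) : ℝ :=
  eta c c * ((1 / 2) *
    (S.bracketCoeff i a b c x - S.bracketCoeff i b c a x + S.bracketCoeff i c a b x))

/-- The Riemann tensor `R_{ab}{}^c{}_d`, with
`∇_a ∇_b v^c - ∇_b ∇_a v^c = R_{ab}{}^c{}_d v^d`. -/
def riemann (i : ι) (a b c d : Fin 4) (x : M) : ℝ :=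
  S.frameDeriv i a (S.conn i b c d) x - S.frameDeriv i b (S.conn i a c d) x
    + ∑ f, (S.conn i a c f x * S.conn i b f d x - S.conn i b c f x * S.conn i a f d x)
    - ∑ f, eta f f * S.bracketCoeff i a b f x * S.conn i f c d x

/-- The Ricci tensor `R_{bd} = R_{ab}{}^a{}_d`. -/
def ricci (i : ι) (b d : Fin 4) (x : M) : ℝ := ∑ a, S.riemann i a b a d x

/-- The Ricci scalar. -/
def scalarCurv (i : ι) (x : M) : ℝ := ∑ a, eta a a * S.ricci i a a x

/-- The Schouten tensor `L_{ab} = R_{ab} / 2 - R g_{ab} / 12`. -/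
def schouten (i : ι) (a b : Fin 4) (x : M) : ℝ :=
  (1 / 2) * S.ricci i a b x - (1 / 12) * S.scalarCurv i x * eta a b

/-- The Weyl tensor `C_{abcd}`, defined by
`R_{abcd} = g_{bd} L_{ac} - g_{ad} L_{bc} + L_{bd} g_{ac} - L_{ad} g_{bc} + C_{abcd}`. -/
def weyl (i : ι) (a b c d : Fin 4) (x : M) : ℝ :=
  eta c c * S.riemann i a b c d x
    - (eta b d * S.schouten i a c x - eta a d * S.schouten i b c x
      + S.schouten i b d x * eta a c - S.schouten i a d x * eta b c)

/-- The covariant derivative `∇_a X_b` of a complex covector field with components `X_b` in the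
tetrad number `i`. -/
def covDerivCovector (X : ι → M → Fin 4 → ℂ) (i : ι) (x : M) (a b : Fin 4) : ℂ :=
  S.frameDeriv i a (fun y => X i y b) x - ∑ c, (S.conn i a c b x : ℂ) * X i x c

/-- The divergence `∇_a X^a`. -/
def divergence (X : ι → M → Fin 4 → ℂ) (i : ι) (x : M) : ℂ :=
  ∑ a, (eta a a : ℂ) * S.covDerivCovector X i x a a

/-! ### Spinor calculus -/

/-- A family, indexed by the spin frames, of component functions `T_{B…B'…}` with `p` unprimed and
`q` primed lower indices; the components in the spin frame number `i` matter on `dom i` only. -/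
abbrev Field (_S : SpinStructure g ι) (p q : ℕ) : Type _ :=
  ι → M → (Fin p → Fin 2) → (Fin q → Fin 2) → ℂ

/-- `T` is a smooth spinor field: the components are smooth and transform correctly under a change
of spin frame. -/
structure IsSpinorField {p q : ℕ} (T : S.Field p q) : Prop where
  smooth : ∀ i B B', ContMDiffOn (𝓡 4) 𝓘(ℝ, ℂ) ∞ (fun x => T i x B B') (S.dom i)
  compat : ∀ i j, ∀ x ∈ S.dom i ∩ S.dom j, ∀ B B',
    T j x B B' = ∑ C : Fin p → Fin 2, ∑ C' : Fin q → Fin 2,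
      (∏ k, (S.trans i j x).1 (B k) (C k)) * (∏ k, star ((S.trans i j x).1 (B' k) (C' k)))
        * T i x C C'

/-- `T = 0` on `M`. -/
def Vanishes {p q : ℕ} (T : S.Field p q) : Prop :=
  ∀ i, ∀ x ∈ S.dom i, ∀ B B', T i x B B' = 0

/-- A real function as a spinor field without indices. -/
def ofFun (f : M → ℝ) : S.Field 0 0 := fun _ x _ _ => (f x : ℂ)

/-- The spin connection `γ_a{}^C{}_B`, where `∇_{e_a} ε_B = ∑ C, γ_a{}^C{}_B ε_C`. It is the
trace-free lift of the Levi-Civita connection: `γ_a{}^C{}_B = ½ Γ_a{}^{CQ'}{}_{BQ'}`. -/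
def spinConn (i : ι) (a : Fin 4) (C B : Fin 2) (x : M) : ℂ :=
  (1 / 2) * ∑ Q', ∑ b, ∑ c, star (sigma c C Q') * sigma b B Q' * (S.conn i a c b x : ℂ)

/-- The spinor covariant derivative. The new indices come first:
`covDeriv T ![A, B, …] ![A', B', …] = ∇_{AA'} T_{B…B'…}`. -/
def covDeriv {p q : ℕ} (T : S.Field p q) : S.Field (p + 1) (q + 1) := fun i x B B' =>
  ∑ a, sigma a (B 0) (B' 0) *
    (S.frameDeriv i a (fun y => T i y (Fin.tail B) (Fin.tail B')) x
      - ∑ k, ∑ C, S.spinConn i a C (Fin.tail B k) x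
          * T i x (Function.update (Fin.tail B) k C) (Fin.tail B')
      - ∑ k, ∑ C', star (S.spinConn i a C' (Fin.tail B' k) x)
          * T i x (Fin.tail B) (Function.update (Fin.tail B') k C'))

/-- The wave operator `□ T = ∇_{AA'} ∇^{AA'} T`. -/
def box {p q : ℕ} (T : S.Field p q) : S.Field p q := fun i x B B' =>
  ∑ A, ∑ C, ∑ A', ∑ C', eps A C * eps A' C' *
    S.covDeriv (S.covDeriv T) i x (Matrix.vecCons A (Matrix.vecCons C B))
      (Matrix.vecCons A' (Matrix.vecCons C' B'))

/-- Total symmetrisation over the unprimed indices. -/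
def symmetrize {p q : ℕ} (T : S.Field p q) : S.Field p q := fun i x B B' =>
  ((p.factorial : ℂ))⁻¹ * ∑ τ : Equiv.Perm (Fin p), T i x (fun k => B (τ k)) B'

/-- The components `X_a` of the covector whose spinorial counterpart is `X_{AA'}`. -/
def toCovector (X : S.Field 1 1) : ι → M → Fin 4 → ℂ := fun i x a =>
  ∑ A, ∑ A', star (sigma a A A') * X i x ![A] ![A']

/-! ### Curvature spinors -/

/-- `Λ = R / 24`. -/
def Lam : S.Field 0 0 := fun i x _ _ => ((S.scalarCurv i x / 24 : ℝ) : ℂ)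

/-- The trace-free Ricci spinor `Φ_{ABA'B'} = Φ_{AA'BB'}`, the spinorial counterpart of
`-(R_{ab} - R g_{ab} / 4) / 2`. It satisfies
`L_{AA'BB'} = -Φ_{ABA'B'} + Λ ε_{AB} ε_{A'B'}`. -/
def Phi : S.Field 2 2 := fun i x B B' =>
  ∑ a, ∑ b, sigma a (B 0) (B' 0) * sigma b (B 1) (B' 1) *
    ((-(1 / 2) * (S.ricci i a b x - (1 / 4) * S.scalarCurv i x * eta a b) : ℝ) : ℂ)

/-- The Weyl spinor `Ψ_{ABCD} = ¼ C_{AQ'B}{}^{Q'}{}_{CP'D}{}^{P'}`. -/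
def Psi : S.Field 4 0 := fun i x B _ =>
  (1 / 4) * ∑ Q', ∑ U', ∑ P', ∑ V', eps Q' U' * eps P' V' *
    ∑ a, ∑ b, ∑ c, ∑ d,
      sigma a (B 0) Q' * sigma b (B 1) U' * sigma c (B 2) P' * sigma d (B 3) V'
        * (S.weyl i a b c d x : ℂ)

/-! ### The conformal Einstein field equations -/

/-- `Z_{AA'BB'} = ∇_{BB'} ∇_{AA'} Ξ - Ξ Φ_{ABA'B'} + Ξ Λ ε_{AB} ε_{A'B'} - s ε_{AB} ε_{A'B'}`. -/
def Z₂ (Ξ s : M → ℝ) : S.Field 2 2 := fun i x B B' =>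
  S.covDeriv (S.covDeriv (S.ofFun Ξ)) i x ![B 1, B 0] ![B' 1, B' 0]
    - (Ξ x : ℂ) * S.Phi i x B B'
    + (Ξ x : ℂ) * S.Lam i x ![] ![] * eps (B 0) (B 1) * eps (B' 0) (B' 1)
    - (s x : ℂ) * eps (B 0) (B 1) * eps (B' 0) (B' 1)

/-- `Z_{AA'} = ∇_{AA'} s - Φ_{AA'}{}^{BB'} ∇_{BB'} Ξ + Λ ∇_{AA'} Ξ`. -/
def Z₁ (Ξ s : M → ℝ) : S.Field 1 1 := fun i x A A' =>
  S.covDeriv (S.ofFun s) i x A A'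
    - ∑ B, ∑ C, ∑ B', ∑ C', eps B C * eps B' C' *
        S.Phi i x ![A 0, C] ![A' 0, C'] * S.covDeriv (S.ofFun Ξ) i x ![B] ![B']
    + S.Lam i x ![] ![] * S.covDeriv (S.ofFun Ξ) i x A A'

/-- `Δ_{ABCC'} = -Y_{ABCC'} + ∇_{AA'} Φ_{BCC'}{}^{A'} + ε_{BC} ∇_{AC'} Λ
  + ∇_{BA'} Φ_{ACC'}{}^{A'} + ε_{AC} ∇_{BC'} Λ`. -/
def Δ₃ (Y : S.Field 3 1) : S.Field 3 1 := fun i x B C' =>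
  - Y i x B C'
    + (∑ A', ∑ D', eps A' D' * S.covDeriv S.Phi i x ![B 0, B 1, B 2] ![A', C' 0, D'])
    + eps (B 1) (B 2) * S.covDeriv S.Lam i x ![B 0] C'
    + (∑ A', ∑ D', eps A' D' * S.covDeriv S.Phi i x ![B 1, B 0, B 2] ![A', C' 0, D'])
    + eps (B 0) (B 2) * S.covDeriv S.Lam i x ![B 1] C'

/-- The spinorial counterpart
`Y_{AA'BB'CC'} = conj Y_{A'B'C'C} ε_{AB} + Y_{ABCC'} ε_{A'B'}` of the Cotton tensor. -/
def fullCotton (Y : S.Field 3 1) : S.Field 3 3 := fun i x B B' =>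
  star (Y i x B' ![B 2]) * eps (B 0) (B 1) + Y i x B ![B' 2] * eps (B' 0) (B' 1)

/-- `Π_{AA'BB'} = -2 Φ^{CD}{}_{A'B'} Ψ_{ABCD} - 2 Φ_{AB}{}^{C'D'} conj Ψ_{A'B'C'D'}
  + ∇_{CC'} Y_{AA'}{}^{CC'}{}_{BB'}`. -/
def Pi₂ (Y : S.Field 3 1) : S.Field 2 2 := fun i x B B' =>
  - 2 * (∑ C, ∑ E, ∑ D, ∑ F, eps C E * eps D F *
      S.Phi i x ![E, F] B' * S.Psi i x ![B 0, B 1, C, D] ![])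
    - 2 * (∑ C', ∑ E', ∑ D', ∑ F', eps C' E' * eps D' F' *
      S.Phi i x B ![E', F'] * star (S.Psi i x ![B' 0, B' 1, C', D'] ![]))
    + ∑ C, ∑ D, ∑ C', ∑ D', eps C D * eps C' D' *
      S.covDeriv (S.fullCotton Y) i x ![C, B 0, D, B 1] ![C', B' 0, D', B' 1]

/-- `Λ_{C'BCF} = -½ Y_{BCFC'} + ∇_{AC'} Ψ_{BCF}{}^A`. -/
def Lam₃ (Y : S.Field 3 1) : S.Field 3 1 := fun i x B C' =>
  - (1 / 2) * Y i x B C'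
    + ∑ A, ∑ D, eps A D * S.covDeriv S.Psi i x ![A, B 0, B 1, B 2, D] C'

/-- `(M, g)` with the conformal factor `Ξ`, the Friedrich scalar `s` and the (reduced, totally
symmetric) Cotton spinor `Y_{ABCC'}` is a smooth solution of the conformal Einstein field
equations. -/
structure IsCFESolution (Ξ s : M → ℝ) (Y : S.Field 3 1) : Prop where
  smooth_Ξ : ContMDiff (𝓡 4) 𝓘(ℝ, ℝ) ∞ Ξ
  smooth_s : ContMDiff (𝓡 4) 𝓘(ℝ, ℝ) ∞ s
  cotton_isSpinorField : S.IsSpinorField Y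
  cotton_symm : ∀ i, ∀ x ∈ S.dom i, ∀ (τ : Equiv.Perm (Fin 3)) B B',
    Y i x (fun k => B (τ k)) B' = Y i x B B'
  Z₂_eq : S.Vanishes (S.Z₂ Ξ s)
  Z₁_eq : S.Vanishes (S.Z₁ Ξ s)
  Δ_eq : S.Vanishes (S.Δ₃ Y)
  Pi_eq : S.Vanishes (S.Pi₂ Y)
  Lam_eq : S.Vanishes (S.Lam₃ Y)

/-! ### Killing spinors -/

/-- `H_{A'ABC} = 3 ∇_{A'(A} κ_{BC)}`. -/
def H (κ : S.Field 2 0) : S.Field 3 1 := fun i x B A' =>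
  3 * S.symmetrize (S.covDeriv κ) i x B A'

/-- `κ_{AB}` is a Killing spinor: a smooth symmetric spinor field with `H_{A'ABC} = 0`. -/
structure IsKillingSpinor (κ : S.Field 2 0) : Prop where
  isSpinorField : S.IsSpinorField κ
  symm : ∀ i, ∀ x ∈ S.dom i, ∀ A B, κ i x ![A, B] ![] = κ i x ![B, A] ![]
  H_eq : S.Vanishes (S.H κ)

/-- The auxiliary vector `ξ_{AA'} = ∇^B{}_{A'} κ_{AB}`. -/
def aux (κ : S.Field 2 0) : S.Field 1 1 := fun i x A A' =>
  ∑ B, ∑ C, eps B C * S.covDeriv κ i x ![C, A 0, B] A'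

/-- `X_{AA'} = Ξ ξ_{AA'} - 3 κ_{AQ} ∇_{A'}{}^Q Ξ`. -/
def confKilling (Ξ : M → ℝ) (κ : S.Field 2 0) : S.Field 1 1 := fun i x A A' =>
  (Ξ x : ℂ) * S.aux κ i x A A'
    - 3 * ∑ Q, ∑ C, eps Q C * κ i x ![A 0, Q] ![] * S.covDeriv (S.ofFun Ξ) i x ![C] A'

/-- `κ_D{}^F Ψ_{ABCF}`, with indices in the order `D, A, B, C`. -/
def kappaPsi (κ : S.Field 2 0) : S.Field 4 0 := fun i x B _ =>
  ∑ F, ∑ G, eps F G * κ i x ![B 0, G] ![] * S.Psi i x ![B 1, B 2, B 3, F] ![]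

/-- `κ_D{}^A Φ_{CAC'D'}`, with indices in the order `D, C; C', D'`. -/
def kappaPhi (κ : S.Field 2 0) : S.Field 2 2 := fun i x B B' =>
  ∑ A, ∑ E, eps A E * κ i x ![B 0, E] ![] * S.Phi i x ![B 1, A] B'

end SpinStructure

end Geometry

end SpinorCFE

end

/-! Since `κ` is symmetric, `∇_{AA'} κ_{BC}` splits into its totally symmetric part, a multiple of
`H`, and its trace, which is `ξ`. The Killing spinor equation therefore says exactly `∇_{AA'} κ_{BC}
= -⅓ (ε_{AB} ξ_{CA'} + ε_{AC} ξ_{BA'})` (`IsKillingSpinor.covDeriv_eq`). Differentiating once more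
expresses `∇∇κ` through `∇ξ`, so the Ricci identity for `κ` becomes an algebraic relation between
`∇ξ`, `κ` and the curvature spinors `Ψ`, `Φ`, `Λ` (`IsKillingSpinor.isKillingData`). Its irreducible
parts are the first results. The totally symmetric part is free of `∇ξ` and gives the condition on
`κΨ`; the part symmetric in the primed indices gives the equation for the symmetrised `∇ξ`; the full
trace gives `∇^a ξ_a = 0`; the remaining trace is the self-dual curl of `ξ`, which is `□κ` up to a
factor.

The wave equation of `ξ` follows the pattern of Killing vectors: differentiate the equation for the
symmetrised `∇ξ`, contract, and commute derivatives. The derivatives of `Φ` that appear are traded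
for `Y` and `∇Λ` by the equation that expresses the Cotton spinor through `∇Φ`
(`SpinorCFE.box_aux_eq`).

For `X = Ξ ξ - 3 κ ∇Ξ`, the terms `Ξ κ Φ` in the symmetrised `∇X`, one from `∇ξ` and one from `∇∇Ξ`
by the field equation, cancel. The terms in `Λ` and `s` are multiples of `κ_{AB} ε_{A'B'}`, which is
antisymmetric under exchange of the index pairs, and what is bilinear in `ξ` and `∇Ξ` is pure trace.
Moreover `X^a ∇_a Ξ = Ξ ξ^a ∇_a Ξ` by the symmetry of `κ`, and `∇_a X^a = 4 ξ^a ∇_a Ξ`.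

The geometry is given by components in a tetrad, so the Ricci identity itself needs proof. The
Jacobi identity of the tetrad gives the symmetries of the Riemann tensor; the spin connection is the
image of the Levi-Civita connection under the Lie algebra map from Lorentz to spin transformations,
so its curvature is the image of the Riemann tensor (`spinCurv_eq`); and a component computation
decomposes that image into `Ψ`, `Φ`, `Λ`. -/

noncomputable section

namespace SpinorCFE

namespace SpinStructure

variable {M : Type*} [TopologicalSpace M] [ChartedSpace E4 M] [IsManifold (𝓡 4) ∞ M]
  {g : LorentzianMetric M} {ι : Type*} (S : SpinStructure g ι)

/-! ### Smooth functions on the domain of a spin frame -/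

/-- Smoothness of a function on the domain of the spin frame number `i`. -/
abbrev SmoothOn {F : Type*} [NormedAddCommGroup F] [NormedSpace ℝ F] (i : ι) (f : M → F) : Prop :=
  ContMDiffOn (𝓡 4) 𝓘(ℝ, F) ∞ f (S.dom i)

section calculus

variable {S} {F : Type*} [NormedAddCommGroup F] [NormedSpace ℝ F] {i : ι} {x : M}

lemma dom_mem_nhds (hx : x ∈ S.dom i) : S.dom i ∈ nhds x := (S.isOpen_dom i).mem_nhds hx

lemma SmoothOn.mdifferentiableAt {f : M → F} (hf : S.SmoothOn i f) (hx : x ∈ S.dom i) :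
    MDifferentiableAt (𝓡 4) 𝓘(ℝ, F) f x :=
  (hf.contMDiffAt (dom_mem_nhds hx)).mdifferentiableAt (by simp)

lemma frameDeriv_congr {f h : M → F} (hx : x ∈ S.dom i) (hfh : ∀ y ∈ S.dom i, f y = h y)
    (a : Fin 4) : S.frameDeriv i a f x = S.frameDeriv i a h x := by
  have : f =ᶠ[nhds x] h := Filter.mem_of_superset (dom_mem_nhds hx) hfh
  simp only [frameDeriv]
  rw [this.mfderiv_eq]
  rfl

lemma frameDeriv_const (c : F) (a : Fin 4) : S.frameDeriv i a (fun _ => c) x = 0 := by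
  simp only [frameDeriv, mfderiv_const]
  rfl

lemma frameDeriv_add {f h : M → F} (hf : S.SmoothOn i f) (hh : S.SmoothOn i h)
    (hx : x ∈ S.dom i) (a : Fin 4) :
    S.frameDeriv i a (fun y => f y + h y) x = S.frameDeriv i a f x + S.frameDeriv i a h x := by
  have := ((hf.mdifferentiableAt hx).hasMFDerivAt.add (hh.mdifferentiableAt hx).hasMFDerivAt).mfderiv
  simp only [frameDeriv]
  erw [this]
  rfl

lemma frameDeriv_sub {f h : M → F} (hf : S.SmoothOn i f) (hh : S.SmoothOn i h)
    (hx : x ∈ S.dom i) (a : Fin 4) :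
    S.frameDeriv i a (fun y => f y - h y) x = S.frameDeriv i a f x - S.frameDeriv i a h x := by
  have := ((hf.mdifferentiableAt hx).hasMFDerivAt.sub (hh.mdifferentiableAt hx).hasMFDerivAt).mfderiv
  simp only [frameDeriv]
  erw [this]
  rfl

lemma frameDeriv_neg (f : M → F) (a : Fin 4) :
    S.frameDeriv i a (fun y => - f y) x = - S.frameDeriv i a f x := by
  have := mfderiv_neg (I := 𝓡 4) (E' := F) (f := f) (x := x)
  simp only [frameDeriv]
  erw [this]
  rfl

lemma frameDeriv_sum {κ : Type*} (s : Finset κ) {f : κ → M → F} (hf : ∀ k, S.SmoothOn i (f k))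
    (hx : x ∈ S.dom i) (a : Fin 4) :
    S.frameDeriv i a (fun y => ∑ k ∈ s, f k y) x = ∑ k ∈ s, S.frameDeriv i a (f k) x := by
  classical
  induction s using Finset.induction_on with
  | empty => simpa using frameDeriv_const (S := S) (0 : F) a
  | insert k s hk ih =>
    simp only [Finset.sum_insert hk]
    rw [frameDeriv_add (hf k) _ hx, ih]
    exact contMDiffOn_finsetSum fun k _ => hf k

lemma frameDeriv_mul {f h : M → ℂ} (hf : S.SmoothOn i f) (hh : S.SmoothOn i h)
    (hx : x ∈ S.dom i) (a : Fin 4) :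
    S.frameDeriv i a (fun y => f y * h y) x
      = S.frameDeriv i a f x * h x + f x * S.frameDeriv i a h x := by
  have := ((hf.mdifferentiableAt hx).hasMFDerivAt.mul (hh.mdifferentiableAt hx).hasMFDerivAt).mfderiv
  simp only [frameDeriv]
  erw [this]
  change f x * _ + h x * _ = _
  rw [mul_comm (h x), add_comm]
  rfl

lemma frameDeriv_clm {G : Type*} [NormedAddCommGroup G] [NormedSpace ℝ G] (L : F →L[ℝ] G)
    {f : M → F} (hf : S.SmoothOn i f) (hx : x ∈ S.dom i) (a : Fin 4) :
    S.frameDeriv i a (fun y => L (f y)) x = L (S.frameDeriv i a f x) := by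
  have := (L.hasMFDerivAt (x := f x)).comp x (hf.mdifferentiableAt hx).hasMFDerivAt
  simp only [frameDeriv]
  erw [this.mfderiv]
  rfl

lemma SmoothOn.const (c : F) : S.SmoothOn i (fun _ => c) := contMDiffOn_const

lemma SmoothOn.congr {f h : M → F} (hf : S.SmoothOn i f) (hfh : ∀ y ∈ S.dom i, h y = f y) :
    S.SmoothOn i h := ContMDiffOn.congr hf hfh

lemma SmoothOn.add {f h : M → F} (hf : S.SmoothOn i f) (hh : S.SmoothOn i h) :
    S.SmoothOn i (fun y => f y + h y) := ContMDiffOn.add hf hh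

lemma SmoothOn.sub {f h : M → F} (hf : S.SmoothOn i f) (hh : S.SmoothOn i h) :
    S.SmoothOn i (fun y => f y - h y) := ContMDiffOn.sub hf hh

lemma SmoothOn.sum {κ : Type*} {s : Finset κ} {f : κ → M → F} (hf : ∀ k, S.SmoothOn i (f k)) :
    S.SmoothOn i (fun y => ∑ k ∈ s, f k y) := contMDiffOn_finsetSum fun k _ => hf k

lemma SmoothOn.clm {G : Type*} [NormedAddCommGroup G] [NormedSpace ℝ G] (L : F →L[ℝ] G)
    {f : M → F} (hf : S.SmoothOn i f) : S.SmoothOn i (fun y => L (f y)) :=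
  L.contMDiff.comp_contMDiffOn hf

lemma SmoothOn.mul {f h : M → ℂ} (hf : S.SmoothOn i f) (hh : S.SmoothOn i h) :
    S.SmoothOn i (fun y => f y * h y) := by
  have h2 : ContDiff ℝ ∞ (fun p : ℂ × ℂ => p.1 * p.2) := contDiff_fst.mul contDiff_snd
  exact h2.contMDiff.comp_contMDiffOn (hf.prodMk_space hh)

lemma SmoothOn.mul_real {f h : M → ℝ} (hf : S.SmoothOn i f) (hh : S.SmoothOn i h) :
    S.SmoothOn i (fun y => f y * h y) := by
  have h2 : ContDiff ℝ ∞ (fun p : ℝ × ℝ => p.1 * p.2) := contDiff_fst.mul contDiff_snd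
  exact h2.contMDiff.comp_contMDiffOn (hf.prodMk_space hh)

lemma SmoothOn.ofReal {f : M → ℝ} (hf : S.SmoothOn i f) : S.SmoothOn i (fun y => (f y : ℂ)) :=
  hf.clm Complex.ofRealCLM

lemma SmoothOn.star {f : M → ℂ} (hf : S.SmoothOn i f) : S.SmoothOn i (fun y => star (f y)) :=
  hf.clm (Complex.conjCLE : ℂ →L[ℝ] ℂ)

lemma frameDeriv_ofReal {f : M → ℝ} (hf : S.SmoothOn i f) (hx : x ∈ S.dom i) (a : Fin 4) :
    S.frameDeriv i a (fun y => (f y : ℂ)) x = ((S.frameDeriv i a f x : ℝ) : ℂ) :=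
  frameDeriv_clm Complex.ofRealCLM hf hx a

lemma frameDeriv_star {f : M → ℂ} (hf : S.SmoothOn i f) (hx : x ∈ S.dom i) (a : Fin 4) :
    S.frameDeriv i a (fun y => star (f y)) x = star (S.frameDeriv i a f x) :=
  frameDeriv_clm (Complex.conjCLE : ℂ →L[ℝ] ℂ) hf hx a

lemma frameDeriv_const_mul (c : ℂ) {f : M → ℂ} (hf : S.SmoothOn i f) (hx : x ∈ S.dom i)
    (a : Fin 4) : S.frameDeriv i a (fun y => c * f y) x = c * S.frameDeriv i a f x := by
  rw [frameDeriv_mul (SmoothOn.const c) hf hx, frameDeriv_const]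
  ring

lemma frameDeriv_const_mul_real (c : ℝ) {f : M → ℝ} (hf : S.SmoothOn i f) (hx : x ∈ S.dom i)
    (a : Fin 4) : S.frameDeriv i a (fun y => c * f y) x = c * S.frameDeriv i a f x :=
  frameDeriv_clm (ContinuousLinearMap.mul ℝ ℝ c) hf hx a

/-- The derivative is the fibre component of the tangent map of `f` composed with the smooth section
`e_a`. -/
lemma SmoothOn.frameDeriv {f : M → F} (hf : S.SmoothOn i f) (a : Fin 4) :
    S.SmoothOn i (S.frameDeriv i a f) := by
  have h1 := hf.contMDiffOn_tangentMapWithin (m := ∞) (by simp) (S.isOpen_dom i).uniqueMDiffOn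
  have h2 := h1.comp (S.frame_smooth i a) (fun y hy => hy)
  have h3 := (contMDiff_snd_tangentBundle_modelSpace F 𝓘(ℝ, F) (n := ∞)).comp_contMDiffOn h2
  refine ContMDiffOn.congr h3 fun y hy => ?_
  simp only [Function.comp, tangentMapWithin, SpinStructure.frameDeriv,
    mfderivWithin_of_isOpen (S.isOpen_dom i) hy]
  rfl

end calculus

end SpinStructure

lemma eta_self_mul_self (a : Fin 4) : eta a a * eta a a = 1 := by
  simp only [eta]; split_ifs <;> norm_num

lemma eta_of_ne {a b : Fin 4} (h : a ≠ b) : eta a b = 0 := by simp [eta, h]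

lemma minSmoothness_le_infty (n : ℕ) : minSmoothness ℝ n ≤ (∞ : WithTop ℕ∞) := by
  rw [minSmoothness_of_isRCLikeNormedField]
  exact_mod_cast (le_top : (n : ℕ∞) ≤ ⊤)

namespace SpinStructure

variable {M : Type*} [TopologicalSpace M] [ChartedSpace E4 M] [IsManifold (𝓡 4) ∞ M]
  {g : LorentzianMetric M} {ι : Type*} (S : SpinStructure g ι)

/-! ### Commutators of the tetrad -/

section bracket

variable {S} {i : ι} {x : M}

lemma inner_sum_frame (hx : x ∈ S.dom i) (c : Fin 4 → ℝ) (b : Fin 4) :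
    g.inner x (∑ a, c a • S.frame i a x) (S.frame i b x) = eta b b * c b := by
  simp only [map_sum, map_smul, _root_.sum_apply, _root_.smul_apply,
    S.frame_orthonormal i x hx, smul_eq_mul]
  rw [Finset.sum_eq_single b]
  · ring
  · intro a _ hab
    rw [eta_of_ne hab, mul_zero]
  · simp

lemma linearIndependent_frame (hx : x ∈ S.dom i) :
    LinearIndependent ℝ (fun a => S.frame i a x) := by
  rw [Fintype.linearIndependent_iff]
  intro c hc b
  have h := inner_sum_frame hx c b
  rw [hc] at h
  have h2 := congrArg (fun t => eta b b * t) h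
  simp only [map_zero, _root_.zero_apply, mul_zero, ← mul_assoc,
    eta_self_mul_self, one_mul] at h2
  exact h2.symm

lemma frame_ne_zero (hx : x ∈ S.dom i) (a : Fin 4) : S.frame i a x ≠ 0 :=
  (linearIndependent_frame hx).ne_zero a

/-- Four linearly independent vectors span a four-dimensional space; orthonormality then identifies
the coefficients. -/
lemma eq_sum_frame (hx : x ∈ S.dom i) (v : TangentSpace (𝓡 4) x) :
    v = ∑ a, (eta a a * g.inner x v (S.frame i a x)) • S.frame i a x := by
  have hfin : Module.finrank ℝ (TangentSpace (𝓡 4) x) = 4 := by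
    change Module.finrank ℝ E4 = 4
    simp [E4]
  have hspan : Submodule.span ℝ (Set.range fun a => S.frame i a x) = ⊤ :=
    haveI : FiniteDimensional ℝ (TangentSpace (𝓡 4) x) :=
      inferInstanceAs (FiniteDimensional ℝ E4)
    (linearIndependent_frame hx).span_eq_top_of_card_eq_finrank' (by rw [hfin]; simp)
  have hv : v ∈ Submodule.span ℝ (Set.range fun a => S.frame i a x) := by
    rw [hspan]; trivial
  obtain ⟨c, rfl⟩ := (Submodule.mem_span_range_iff_exists_fun ℝ).1 hv
  refine Finset.sum_congr rfl fun b _ => ?_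
  rw [inner_sum_frame hx, ← mul_assoc, eta_self_mul_self, one_mul]

lemma bracketCoeff_swap (i : ι) (a b d : Fin 4) (x : M) :
    S.bracketCoeff i b a d x = - S.bracketCoeff i a b d x := by
  simp only [bracketCoeff]
  rw [VectorField.mlieBracket_swap_apply]
  simp

lemma mlieBracket_frame (hx : x ∈ S.dom i) (a b : Fin 4) :
    VectorField.mlieBracket (𝓡 4) (S.frame i a) (S.frame i b) x
      = ∑ f, (eta f f * S.bracketCoeff i a b f x) • S.frame i f x :=
  eq_sum_frame hx _

/-- Smoothness of a vector field at a point. -/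
abbrev SmoothVectorAt (V : ∀ x : M, TangentSpace (𝓡 4) x) (x : M) : Prop :=
  ContMDiffAt (𝓡 4) (𝓡 4).tangent ∞ (fun y : M => (⟨y, V y⟩ : TangentBundle (𝓡 4) M)) x

lemma smoothVectorAt_frame (hx : x ∈ S.dom i) (a : Fin 4) : SmoothVectorAt (S.frame i a) x :=
  (S.frame_smooth i a).contMDiffAt (dom_mem_nhds hx)

lemma SmoothVectorAt.mlieBracket {V W : ∀ x : M, TangentSpace (𝓡 4) x}
    (hV : SmoothVectorAt V x) (hW : SmoothVectorAt W x) :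
    SmoothVectorAt (VectorField.mlieBracket (𝓡 4) V W) x := by
  have : IsManifold (𝓡 4) (minSmoothness ℝ 2) M := IsManifold.of_le (n := ∞) (minSmoothness_le_infty _)
  have : IsManifold (𝓡 4) ((⊤ : ℕ∞) + 1 : WithTop ℕ∞) M := by
    exact_mod_cast (inferInstance : IsManifold (𝓡 4) ∞ M)
  exact ContMDiffAt.mlieBracket_vectorField (m := ⊤) (n := ⊤) hV hW (by simp)

lemma SmoothOn.bracketCoeff (S : SpinStructure g ι) (i : ι) (a b d : Fin 4) :
    S.SmoothOn i (S.bracketCoeff i a b d) := by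
  intro x hx
  have h1 := SmoothVectorAt.mlieBracket (smoothVectorAt_frame hx a) (smoothVectorAt_frame hx b)
  have h := (g.contMDiff x).clm_bundle_apply₂ (F₁ := E4) (F₂ := E4) (F₃ := ℝ)
    (E₃ := Bundle.Trivial M ℝ) h1 (smoothVectorAt_frame hx d)
  have h2 := (Bundle.contMDiffAt_section _).1 h
  exact ContMDiffAt.contMDiffWithinAt h2

/-- The differential of a real function. -/
def differential (f : M → ℝ) (x : M) : TangentSpace (𝓡 4) x →L[ℝ] ℝ := mfderiv (𝓡 4) 𝓘(ℝ, ℝ) f x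

lemma mlieBracket_smul {f : M → ℝ} (hf : S.SmoothOn i f) {V W : ∀ x : M, TangentSpace (𝓡 4) x}
    (hW : SmoothVectorAt W x) (hx : x ∈ S.dom i) :
    VectorField.mlieBracket (𝓡 4) V (f • W) x
      = differential f x (V x) • W x + f x • VectorField.mlieBracket (𝓡 4) V W x :=
  VectorField.mlieBracket_smul_right (hf.mdifferentiableAt hx)
    (hW.mdifferentiableAt (by simp))

lemma SmoothVectorAt.smul {f : M → ℝ} (hf : S.SmoothOn i f) {W : ∀ x : M, TangentSpace (𝓡 4) x}
    (hW : SmoothVectorAt W x) (hx : x ∈ S.dom i) : SmoothVectorAt (f • W) x :=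
  ContMDiffAt.smul_section (hf.contMDiffAt (dom_mem_nhds hx)) hW

lemma SmoothVectorAt.add {V W : ∀ x : M, TangentSpace (𝓡 4) x}
    (hV : SmoothVectorAt V x) (hW : SmoothVectorAt W x) : SmoothVectorAt (V + W) x :=
  ContMDiffAt.add_section hV hW

lemma mlieBracket_add {V W W' : ∀ x : M, TangentSpace (𝓡 4) x}
    (hW : SmoothVectorAt W x) (hW' : SmoothVectorAt W' x) :
    VectorField.mlieBracket (𝓡 4) V (W + W') x
      = VectorField.mlieBracket (𝓡 4) V W x + VectorField.mlieBracket (𝓡 4) V W' x :=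
  VectorField.mlieBracket_add_right
    (hW.mdifferentiableAt (by simp)) (hW'.mdifferentiableAt (by simp))

lemma mlieBracket_congr_right {V W W' : ∀ x : M, TangentSpace (𝓡 4) x} (hx : x ∈ S.dom i)
    (h : ∀ y ∈ S.dom i, W y = W' y) :
    VectorField.mlieBracket (𝓡 4) V W x = VectorField.mlieBracket (𝓡 4) V W' x :=
  Filter.EventuallyEq.mlieBracket_vectorField_eq (Filter.EventuallyEq.refl _ _)
    (Filter.mem_of_superset (dom_mem_nhds hx) h)

lemma mlieBracket_leibniz {U V W : ∀ x : M, TangentSpace (𝓡 4) x}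
    (hU : SmoothVectorAt U x) (hV : SmoothVectorAt V x) (hW : SmoothVectorAt W x) :
    VectorField.mlieBracket (𝓡 4) U (VectorField.mlieBracket (𝓡 4) V W) x
      = VectorField.mlieBracket (𝓡 4) (VectorField.mlieBracket (𝓡 4) U V) W x
        + VectorField.mlieBracket (𝓡 4) V (VectorField.mlieBracket (𝓡 4) U W) x := by
  have : IsManifold (𝓡 4) (minSmoothness ℝ 3) M := IsManifold.of_le (n := ∞) (minSmoothness_le_infty _)
  have h2 : minSmoothness ℝ 2 ≤ (∞ : WithTop ℕ∞) := minSmoothness_le_infty 2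
  exact VectorField.leibniz_identity_mlieBracket_apply
    (hU.of_le h2) (hV.of_le h2) (hW.of_le h2)

/-- Two uses of the Leibniz rule exhibit the second derivative `e_a e_b f` as the coefficient of `W`
in an iterated bracket. This lets the Jacobi identity for vector fields yield the commutator of
derivatives of functions. -/
lemma mlieBracket_frame_smul {f : M → ℝ} (hf : S.SmoothOn i f)
    {W : ∀ x : M, TangentSpace (𝓡 4) x} (hW : ∀ y ∈ S.dom i, SmoothVectorAt W y)
    (hx : x ∈ S.dom i) (a b : Fin 4) :
    VectorField.mlieBracket (𝓡 4) (S.frame i a)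
        (VectorField.mlieBracket (𝓡 4) (S.frame i b) (f • W)) x
      = S.frameDeriv i a (S.frameDeriv i b f) x • W x
        + S.frameDeriv i b f x • VectorField.mlieBracket (𝓡 4) (S.frame i a) W x
        + S.frameDeriv i a f x • VectorField.mlieBracket (𝓡 4) (S.frame i b) W x
        + f x • VectorField.mlieBracket (𝓡 4) (S.frame i a)
            (VectorField.mlieBracket (𝓡 4) (S.frame i b) W) x := by
  have h1 : ∀ y ∈ S.dom i, VectorField.mlieBracket (𝓡 4) (S.frame i b) (f • W) y
      = (S.frameDeriv i b f • W + f • VectorField.mlieBracket (𝓡 4) (S.frame i b) W) y :=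
    fun y hy => mlieBracket_smul hf (hW y hy) hy
  have h2 := SmoothVectorAt.mlieBracket (smoothVectorAt_frame hx b) (hW x hx)
  rw [mlieBracket_congr_right hx h1,
    mlieBracket_add (SmoothVectorAt.smul (hf.frameDeriv b) (hW x hx) hx)
      (SmoothVectorAt.smul hf h2 hx),
    mlieBracket_smul (hf.frameDeriv b) (hW x hx) hx, mlieBracket_smul hf h2 hx]
  change S.frameDeriv i a (S.frameDeriv i b f) x • W x + _ + (S.frameDeriv i a f x • _ + _) = _
  abel

/-- The commutator of two derivatives along the tetrad, on real functions. -/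
lemma frameDeriv_comm_real {f : M → ℝ} (hf : S.SmoothOn i f) (hx : x ∈ S.dom i) (a b : Fin 4) :
    S.frameDeriv i a (S.frameDeriv i b f) x - S.frameDeriv i b (S.frameDeriv i a f) x
      = ∑ d, eta d d * S.bracketCoeff i a b d x * S.frameDeriv i d f x := by
  -- The Jacobi identity is applied to `e_a`, `e_b` and `f e_0`. After subtracting the Jacobi
  -- identity for `e_0` itself, only a multiple of `e_0` is left; any nowhere vanishing vector field
  -- would serve.
  have hW : ∀ y ∈ S.dom i, SmoothVectorAt (S.frame i 0) y := fun y hy => smoothVectorAt_frame hy 0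
  have ha := smoothVectorAt_frame hx a
  have hb := smoothVectorAt_frame hx b
  have h1 := mlieBracket_leibniz ha hb (SmoothVectorAt.smul hf (hW x hx) hx)
  rw [mlieBracket_frame_smul hf hW hx, mlieBracket_frame_smul hf hW hx,
    mlieBracket_smul hf (hW x hx) hx, mlieBracket_leibniz ha hb (hW x hx)] at h1
  have h2 : differential f x
      (VectorField.mlieBracket (𝓡 4) (S.frame i a) (S.frame i b) x)
      = ∑ d, eta d d * S.bracketCoeff i a b d x * S.frameDeriv i d f x := by
    rw [mlieBracket_frame hx, map_sum]
    refine Finset.sum_congr rfl fun d _ => ?_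
    rw [map_smul]
    rfl
  rw [h2] at h1
  have h3 : (S.frameDeriv i a (S.frameDeriv i b f) x - S.frameDeriv i b (S.frameDeriv i a f) x
      - ∑ d, eta d d * S.bracketCoeff i a b d x * S.frameDeriv i d f x) • S.frame i 0 x = 0 := by
    rw [sub_smul, sub_smul]
    rw [smul_add] at h1
    rw [← sub_eq_zero] at h1
    rw [← h1]
    abel
  exact sub_eq_zero.1 ((smul_eq_zero.1 h3).resolve_right (frame_ne_zero hx 0))

/-- The commutator of two derivatives along the tetrad, on complex functions. -/
lemma frameDeriv_comm {f : M → ℂ} (hf : S.SmoothOn i f) (hx : x ∈ S.dom i) (a b : Fin 4) :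
    S.frameDeriv i a (S.frameDeriv i b f) x - S.frameDeriv i b (S.frameDeriv i a f) x
      = ∑ d, ((eta d d * S.bracketCoeff i a b d x : ℝ) : ℂ) * S.frameDeriv i d f x := by
  -- A real-linear functional commutes with `e_a`, so the real and imaginary parts reduce to the
  -- real case.
  have key : ∀ L : ℂ →L[ℝ] ℝ, L (S.frameDeriv i a (S.frameDeriv i b f) x
      - S.frameDeriv i b (S.frameDeriv i a f) x)
      = ∑ d, eta d d * S.bracketCoeff i a b d x * L (S.frameDeriv i d f x) := by
    intro L
    have h := frameDeriv_comm_real (hf.clm L) hx a b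
    have h1 : ∀ c, ∀ y ∈ S.dom i, S.frameDeriv i c (fun y => L (f y)) y
        = L (S.frameDeriv i c f y) := fun c y hy => frameDeriv_clm L hf hy c
    rw [frameDeriv_congr hx (h1 b), frameDeriv_congr hx (h1 a),
      frameDeriv_clm L (hf.frameDeriv b) hx, frameDeriv_clm L (hf.frameDeriv a) hx] at h
    rw [map_sub, h]
    exact Finset.sum_congr rfl fun d _ => by rw [h1 d x hx]
  apply Complex.ext
  · have := key Complex.reCLM
    simpa using this
  · have := key Complex.imCLM
    simpa using this

/-- The Jacobi identity for the tetrad. -/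
lemma bracketCoeff_jacobi (hx : x ∈ S.dom i) (a b d k : Fin 4) :
    S.frameDeriv i a (S.bracketCoeff i b d k) x + S.frameDeriv i b (S.bracketCoeff i d a k) x
      + S.frameDeriv i d (S.bracketCoeff i a b k) x
      + ∑ f, eta f f * (S.bracketCoeff i b d f x * S.bracketCoeff i a f k x
        + S.bracketCoeff i d a f x * S.bracketCoeff i b f k x
        + S.bracketCoeff i a b f x * S.bracketCoeff i d f k x) = 0 := by
  -- Inserting `[e_b, e_d] = ∑ η^{ff} c_{bdf} e_f` and using the Leibniz rule gives the derivative
  -- of the coefficient plus a quadratic term; in the former, pairing with `e_k` keeps only `f = k`.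
  have expand : ∀ a b d : Fin 4, g.inner x (VectorField.mlieBracket (𝓡 4) (S.frame i a)
      (VectorField.mlieBracket (𝓡 4) (S.frame i b) (S.frame i d)) x) (S.frame i k x)
      = S.frameDeriv i a (S.bracketCoeff i b d k) x
        + ∑ f, eta f f * (S.bracketCoeff i b d f x * S.bracketCoeff i a f k x) := by
    intro a b d
    have hs : ∀ f, S.SmoothOn i (fun y => eta f f * S.bracketCoeff i b d f y) := fun f =>
      (SmoothOn.const (eta f f)).mul_real (SmoothOn.bracketCoeff S i b d f)
    have h1 : ∀ y ∈ S.dom i, VectorField.mlieBracket (𝓡 4) (S.frame i b) (S.frame i d) y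
        = (((fun y => eta 0 0 * S.bracketCoeff i b d 0 y) • S.frame i 0
            + (fun y => eta 1 1 * S.bracketCoeff i b d 1 y) • S.frame i 1)
          + ((fun y => eta 2 2 * S.bracketCoeff i b d 2 y) • S.frame i 2
            + (fun y => eta 3 3 * S.bracketCoeff i b d 3 y) • S.frame i 3)) y := by
      intro y hy
      rw [mlieBracket_frame hy, Fin.sum_univ_four]
      simp only [Pi.add_apply, Pi.smul_apply']
      abel
    have hv : ∀ f, SmoothVectorAt ((fun y => eta f f * S.bracketCoeff i b d f y) • S.frame i f) x :=
      fun f => SmoothVectorAt.smul (hs f) (smoothVectorAt_frame hx f) hx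
    rw [mlieBracket_congr_right hx h1, mlieBracket_add ((hv 0).add (hv 1)) ((hv 2).add (hv 3)),
      mlieBracket_add (hv 0) (hv 1), mlieBracket_add (hv 2) (hv 3)]
    simp only [mlieBracket_smul (hs _) (smoothVectorAt_frame hx _) hx, map_add, map_smul,
      _root_.add_apply, _root_.smul_apply, S.frame_orthonormal i x hx, smul_eq_mul]
    have h2 : ∀ f, differential (fun y => eta f f * S.bracketCoeff i b d f y) x
        (S.frame i a x) = eta f f * S.frameDeriv i a (S.bracketCoeff i b d f) x :=
      fun f => frameDeriv_const_mul_real (eta f f) (SmoothOn.bracketCoeff S i b d f) hx a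
    have h3 : ∀ f, g.inner x (VectorField.mlieBracket (𝓡 4) (S.frame i a) (S.frame i f) x)
        (S.frame i k x) = S.bracketCoeff i a f k x := fun f => rfl
    simp only [h3, h2]
    rw [Fin.sum_univ_four]
    fin_cases k <;> simp [eta] <;> ring
  have h := mlieBracket_leibniz (smoothVectorAt_frame hx a) (smoothVectorAt_frame hx b)
    (smoothVectorAt_frame hx d)
  have h' := congrArg (fun v => g.inner x v (S.frame i k x)) h
  have hswap : g.inner x (VectorField.mlieBracket (𝓡 4)
      (VectorField.mlieBracket (𝓡 4) (S.frame i a) (S.frame i b)) (S.frame i d) x) (S.frame i k x)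
      = - g.inner x (VectorField.mlieBracket (𝓡 4) (S.frame i d)
      (VectorField.mlieBracket (𝓡 4) (S.frame i a) (S.frame i b)) x) (S.frame i k x) := by
    rw [VectorField.mlieBracket_swap_apply]
    simp
  simp only [map_add, _root_.add_apply] at h'
  rw [hswap, expand, expand, expand] at h'
  have hda : S.frameDeriv i b (S.bracketCoeff i d a k) x
      = - S.frameDeriv i b (S.bracketCoeff i a d k) x := by
    rw [← frameDeriv_neg]
    exact frameDeriv_congr hx (fun y _ => bracketCoeff_swap i a d k y) b
  rw [hda]
  simp only [bracketCoeff_swap i a d, Fin.sum_univ_four] at h' ⊢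
  linarith

end bracket

end SpinStructure

/-- The algebraic symmetries of a curvature tensor `R_{abcd}`. -/
structure IsCurvatureTensor (R : Fin 4 → Fin 4 → Fin 4 → Fin 4 → ℝ) : Prop where
  swap_left : ∀ a b c d, R b a c d = - R a b c d
  swap_right : ∀ a b c d, R a b d c = - R a b c d
  bianchi : ∀ a b c d, R a b c d + R b d c a + R d a c b = 0

/-- The classical octahedron argument: four instances of the cyclic identity combine so that
antisymmetry in each pair cancels everything but twice the claim. -/
lemma IsCurvatureTensor.pair_symm {R : Fin 4 → Fin 4 → Fin 4 → Fin 4 → ℝ}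
    (h : IsCurvatureTensor R) (a b c d : Fin 4) : R c d a b = R a b c d := by
  have h1 := h.bianchi a b c d
  have h2 := h.bianchi a b d c
  have h3 := h.bianchi a c b d
  have h4 := h.bianchi b c a d
  linarith [h.swap_left a b c d, h.swap_right a b c d, h.swap_left a c b d, h.swap_right a c b d,
    h.swap_left a d b c, h.swap_right a d b c, h.swap_left b c a d, h.swap_right b c a d,
    h.swap_left b d a c, h.swap_right b d a c, h.swap_left c d a b, h.swap_right c d a b,
    h.swap_left a b d c, h.swap_left a c d b, h.swap_left a d c b, h.swap_left b c d a,
    h.swap_left b d c a, h.swap_left c d b a]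

namespace SpinStructure

variable {M : Type*} [TopologicalSpace M] [ChartedSpace E4 M] [IsManifold (𝓡 4) ∞ M]
  {g : LorentzianMetric M} {ι : Type*} (S : SpinStructure g ι)

/-! ### The Levi-Civita connection and its curvature -/

section curvature

variable {S} {i : ι} {x : M}

/-- Metricity: the metric components are constant in an orthonormal tetrad, so `∇g = 0` is skewness
of the lowered connection. It comes from the skewness of `c_{abd}` in `a`, `b`. -/
lemma conn_antisymm (i : ι) (a b c : Fin 4) (x : M) :
    eta b b * S.conn i a b c x = - (eta c c * S.conn i a c b x) := by
  simp only [conn, ← mul_assoc, eta_self_mul_self, one_mul]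
  linear_combination (1 / 2 : ℝ) * bracketCoeff_swap i a c b x
    - (1 / 2 : ℝ) * bracketCoeff_swap i b c a x + (1 / 2 : ℝ) * bracketCoeff_swap i b a c x

/-- Vanishing torsion, `∇_{e_a} e_b - ∇_{e_b} e_a = [e_a, e_b]`. -/
lemma conn_torsion (i : ι) (a b c : Fin 4) (x : M) :
    S.conn i a c b x - S.conn i b c a x = eta c c * S.bracketCoeff i a b c x := by
  simp only [conn]
  linear_combination (eta c c * (1 / 2 : ℝ)) * (- bracketCoeff_swap i a b c x
    - bracketCoeff_swap i c b a x + bracketCoeff_swap i a c b x)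

lemma SmoothOn.conn (S : SpinStructure g ι) (i : ι) (a b c : Fin 4) :
    S.SmoothOn i (S.conn i a b c) :=
  (SmoothOn.const _).mul_real ((SmoothOn.const _).mul_real
    (((SmoothOn.bracketCoeff S i a c b).sub (SmoothOn.bracketCoeff S i c b a)).add
      (SmoothOn.bracketCoeff S i b a c)))

lemma SmoothOn.riemann (S : SpinStructure g ι) (i : ι) (a b c d : Fin 4) :
    S.SmoothOn i (S.riemann i a b c d) := by
  have h := fun a b c => SmoothOn.conn S i a b c
  exact ((((h b c d).frameDeriv a).sub ((h a c d).frameDeriv b)).add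
    (SmoothOn.sum fun f => ((h a c f).mul_real (h b f d)).sub ((h b c f).mul_real (h a f d)))).sub
    (SmoothOn.sum fun f => ((SmoothOn.const _).mul_real (SmoothOn.bracketCoeff S i a b f)).mul_real
      (h f c d))

lemma SmoothOn.ricci (S : SpinStructure g ι) (i : ι) (b d : Fin 4) :
    S.SmoothOn i (S.ricci i b d) :=
  SmoothOn.sum fun a => SmoothOn.riemann S i a b a d

lemma SmoothOn.scalarCurv (S : SpinStructure g ι) (i : ι) : S.SmoothOn i (S.scalarCurv i) :=
  SmoothOn.sum fun a => (SmoothOn.const _).mul_real (SmoothOn.ricci S i a a)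

lemma riemann_swap_left (i : ι) (a b c d : Fin 4) (x : M) :
    S.riemann i b a c d x = - S.riemann i a b c d x := by
  simp only [riemann, bracketCoeff_swap i a b, Fin.sum_univ_four]
  ring

/-- The connection takes values in the Lorentz algebra, which is preserved by differentiation, by
commutators and by linear combination; each of the three pieces of the curvature is treated
separately. -/
lemma riemann_swap_right (hx : x ∈ S.dom i) (a b c d : Fin 4) :
    eta c c * S.riemann i a b c d x = - (eta d d * S.riemann i a b d c x) := by
  have hd : ∀ a b c d, eta c c * S.frameDeriv i a (S.conn i b c d) x
      = - (eta d d * S.frameDeriv i a (S.conn i b d c) x) := by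
    intro a b c d
    rw [← frameDeriv_const_mul_real _ (SmoothOn.conn S i b c d) hx,
      ← frameDeriv_const_mul_real _ (SmoothOn.conn S i b d c) hx, ← frameDeriv_neg]
    exact frameDeriv_congr hx (fun y _ => conn_antisymm i b c d y) a
  have hq : ∀ a b f, eta c c * (S.conn i a c f x * S.conn i b f d x)
      = eta d d * (S.conn i b d f x * S.conn i a f c x) := by
    intro a b f
    have h1 := conn_antisymm (S := S) i a c f x
    have h2 := conn_antisymm (S := S) i b f d x
    linear_combination S.conn i b f d x * h1 - S.conn i a f c x * h2
  have h1 := hd a b c d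
  have h2 := hd b a c d
  have hsum : eta c c * ∑ f, (S.conn i a c f x * S.conn i b f d x
        - S.conn i b c f x * S.conn i a f d x)
      = - (eta d d * ∑ f, (S.conn i a d f x * S.conn i b f c x
        - S.conn i b d f x * S.conn i a f c x)) := by
    rw [Finset.mul_sum, Finset.mul_sum, ← Finset.sum_neg_distrib]
    refine Finset.sum_congr rfl fun f _ => ?_
    linear_combination hq a b f - hq b a f
  have hlast : eta c c * ∑ f, eta f f * S.bracketCoeff i a b f x * S.conn i f c d x
      = - (eta d d * ∑ f, eta f f * S.bracketCoeff i a b f x * S.conn i f d c x) := by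
    rw [Finset.mul_sum, Finset.mul_sum, ← Finset.sum_neg_distrib]
    refine Finset.sum_congr rfl fun f _ => ?_
    linear_combination eta f f * S.bracketCoeff i a b f x * conn_antisymm (S := S) i f c d x
  simp only [riemann]
  linear_combination h1 - h2 + hsum - hlast

/-- The first Bianchi identity. -/
lemma riemann_bianchi (hx : x ∈ S.dom i) (a b c d : Fin 4) :
    S.riemann i a b c d x + S.riemann i b d c a x + S.riemann i d a c b x = 0 := by
  -- In the cyclic sum the connection coefficients pair up into torsion differences. These are
  -- bracket coefficients, so the sum becomes the Jacobi identity of the tetrad.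
  have hd : ∀ a b d, S.frameDeriv i a (S.conn i b c d) x - S.frameDeriv i a (S.conn i d c b) x
      = eta c c * S.frameDeriv i a (S.bracketCoeff i b d c) x := by
    intro a b d
    rw [← frameDeriv_const_mul_real _ (SmoothOn.bracketCoeff S i b d c) hx,
      ← frameDeriv_sub (SmoothOn.conn S i b c d) (SmoothOn.conn S i d c b) hx]
    exact frameDeriv_congr hx (fun y _ => conn_torsion i b d c y) a
  have hJ := bracketCoeff_jacobi hx a b d c
  have hq : ∀ a b d f, S.conn i a c f x * (S.conn i b f d x - S.conn i d f b x)
      - eta f f * S.bracketCoeff i b d f x * S.conn i f c a x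
      = eta c c * (eta f f * (S.bracketCoeff i b d f x * S.bracketCoeff i a f c x)) := by
    intro a b d f
    rw [conn_torsion]
    linear_combination eta f f * S.bracketCoeff i b d f x * conn_torsion (S := S) i a f c x
  have hs : ∑ f, (S.conn i a c f x * (S.conn i b f d x - S.conn i d f b x)
      - eta f f * S.bracketCoeff i b d f x * S.conn i f c a x)
      + ∑ f, (S.conn i b c f x * (S.conn i d f a x - S.conn i a f d x)
      - eta f f * S.bracketCoeff i d a f x * S.conn i f c b x)
      + ∑ f, (S.conn i d c f x * (S.conn i a f b x - S.conn i b f a x)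
      - eta f f * S.bracketCoeff i a b f x * S.conn i f c d x)
      = eta c c * ∑ f, eta f f * (S.bracketCoeff i b d f x * S.bracketCoeff i a f c x
        + S.bracketCoeff i d a f x * S.bracketCoeff i b f c x
        + S.bracketCoeff i a b f x * S.bracketCoeff i d f c x) := by
    rw [Finset.mul_sum, ← Finset.sum_add_distrib, ← Finset.sum_add_distrib]
    refine Finset.sum_congr rfl fun f _ => ?_
    rw [hq, hq, hq]
    ring
  have h1 := hd a b d
  have h2 := hd b d a
  have h3 := hd d a b
  simp only [riemann, Fin.sum_univ_four] at hs hJ ⊢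
  linear_combination h1 + h2 + h3 + hs + eta c c * hJ

lemma isCurvatureTensor_riemann (hx : x ∈ S.dom i) :
    IsCurvatureTensor (fun a b c d => eta c c * S.riemann i a b c d x) where
  swap_left a b c d := by rw [riemann_swap_left i a b]; ring
  swap_right a b c d := by
    have := riemann_swap_right hx a b c d
    linarith
  bianchi a b c d := by
    linear_combination eta c c * riemann_bianchi hx a b c d

end curvature

end SpinStructure

/-! ### Algebra of the Infeld–van der Waerden symbols -/

/-- The Pauli matrices. -/
def pauli (a : Fin 4) (A A' : Fin 2) : ℂ :=
  (![!![1, 0; 0, 1], !![0, 1; 1, 0], !![0, -Complex.I; Complex.I, 0], !![1, 0; 0, -1]] a :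
    Matrix (Fin 2) (Fin 2) ℂ) A A'

/-- The normalisation factor `1 / √2` of the Infeld–van der Waerden symbols. -/
def invSqrtTwo : ℂ := ((Real.sqrt 2 : ℝ) : ℂ)⁻¹

lemma invSqrtTwo_mul_self : invSqrtTwo * invSqrtTwo = 1 / 2 := by
  rw [invSqrtTwo, ← mul_inv, ← Complex.ofReal_mul, Real.mul_self_sqrt (by norm_num)]
  norm_num

lemma star_invSqrtTwo : star invSqrtTwo = invSqrtTwo := by
  simp [invSqrtTwo, Complex.conj_ofReal]

lemma sigma_eq (a : Fin 4) (A A' : Fin 2) : sigma a A A' = invSqrtTwo * pauli a A A' := rfl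

lemma sigma_mul_sigma (a b : Fin 4) (A A' B B' : Fin 2) :
    sigma a A A' * sigma b B B' = 1 / 2 * (pauli a A A' * pauli b B B') := by
  rw [sigma_eq, sigma_eq, ← invSqrtTwo_mul_self]; ring

lemma star_sigma_mul_sigma (a b : Fin 4) (A A' B B' : Fin 2) :
    star (sigma a A A') * sigma b B B' = 1 / 2 * (star (pauli a A A') * pauli b B B') := by
  rw [sigma_eq, sigma_eq, star_mul', star_invSqrtTwo, ← invSqrtTwo_mul_self]; ring

lemma star_sigma_mul_star_sigma (a b : Fin 4) (A A' B B' : Fin 2) :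
    star (sigma a A A') * star (sigma b B B')
      = 1 / 2 * (star (pauli a A A') * star (pauli b B B')) := by
  rw [sigma_eq, sigma_eq, star_mul', star_mul', star_invSqrtTwo, ← invSqrtTwo_mul_self]; ring

lemma star_sigma (a : Fin 4) (A A' : Fin 2) : star (sigma a A A') = sigma a A' A := by
  rw [sigma_eq, sigma_eq, star_mul', star_invSqrtTwo]
  fin_cases a <;> fin_cases A <;> fin_cases A' <;> simp [pauli]

/-- The spinor `T_{AQ'B}{}^{Q'}` of a tensor `T_{ab}`. -/
def sdPart (T : Fin 4 → Fin 4 → ℂ) (A B : Fin 2) : ℂ :=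
  ∑ Q', ∑ U', eps Q' U' * ∑ a, ∑ b, sigma a A Q' * sigma b B U' * T a b

/-- The spinor `T_{QA'}{}^Q{}_{B'}` of a tensor `T_{ab}`. -/
def asdPart (T : Fin 4 → Fin 4 → ℂ) (A' B' : Fin 2) : ℂ :=
  ∑ Q, ∑ U, eps Q U * ∑ a, ∑ b, sigma a Q A' * sigma b U B' * T a b

section bivector

variable {T : Fin 4 → Fin 4 → ℂ}

lemma diag_eq_zero (hT : ∀ a b, T b a = - T a b) (a : Fin 4) : T a a = 0 := by
  have := hT a a
  linear_combination (1 / 2 : ℂ) * this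

/-- Explicit formulas in the six independent components `T 0 1, …, T 2 3`; they turn the spinor
identities below into polynomial identities that are checked component by component. -/
lemma sdPart_values (hT : ∀ a b, T b a = - T a b) :
    sdPart T 0 0 = T 0 1 - Complex.I * T 0 2 - T 1 3 + Complex.I * T 2 3 ∧
    sdPart T 0 1 = - T 0 3 - Complex.I * T 1 2 ∧
    sdPart T 1 0 = - T 0 3 - Complex.I * T 1 2 ∧
    sdPart T 1 1 = - T 0 1 - Complex.I * T 0 2 - T 1 3 - Complex.I * T 2 3 := by
  refine ⟨?_, ?_, ?_, ?_⟩ <;>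
  · simp [sdPart, sigma_mul_sigma, pauli, eps, Fin.sum_univ_four, diag_eq_zero hT, hT 0 1, hT 0 2,
      hT 0 3, hT 1 2, hT 1 3, hT 2 3]
    ring_nf
    try simp only [Complex.I_sq]
    try ring

lemma asdPart_values (hT : ∀ a b, T b a = - T a b) :
    asdPart T 0 0 = T 0 1 + Complex.I * T 0 2 - T 1 3 - Complex.I * T 2 3 ∧
    asdPart T 0 1 = - T 0 3 + Complex.I * T 1 2 ∧
    asdPart T 1 0 = - T 0 3 + Complex.I * T 1 2 ∧
    asdPart T 1 1 = - T 0 1 + Complex.I * T 0 2 - T 1 3 + Complex.I * T 2 3 := by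
  refine ⟨?_, ?_, ?_, ?_⟩ <;>
  · simp [asdPart, sigma_mul_sigma, pauli, eps, Fin.sum_univ_four, diag_eq_zero hT, hT 0 1, hT 0 2,
      hT 0 3, hT 1 2, hT 1 3, hT 2 3]
    ring_nf
    try simp only [Complex.I_sq]
    try ring

/-- The decomposition of a bivector into its self-dual and anti-self-dual parts. -/
lemma sum_sigma_sigma_bivector (hT : ∀ a b, T b a = - T a b) (A A' B B' : Fin 2) :
    ∑ a, ∑ b, sigma a A A' * sigma b B B' * T a b
      = 1 / 2 * (eps A' B' * sdPart T A B + eps A B * asdPart T A' B') := by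
  obtain ⟨s1, s2, s3, s4⟩ := sdPart_values hT
  obtain ⟨t1, t2, t3, t4⟩ := asdPart_values hT
  fin_cases A <;> fin_cases A' <;> fin_cases B <;> fin_cases B' <;>
  · simp [s1, s2, s3, s4, t1, t2, t3, t4, sigma_mul_sigma, pauli, eps, Fin.sum_univ_four,
      diag_eq_zero hT, hT 0 1, hT 0 2, hT 0 3, hT 1 2, hT 1 3, hT 2 3]
    try ring_nf
    try simp only [Complex.I_sq]
    try ring

/-- The lift of an infinitesimal Lorentz transformation `G^c{}_b` to spinors. -/
def spinLift (G : Fin 4 → Fin 4 → ℂ) (C B : Fin 2) : ℂ :=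
  (1 / 2) * ∑ Q', ∑ b, ∑ c, star (sigma c C Q') * sigma b B Q' * G c b

/-- The lift sees only the self-dual half of a Lorentz generator. As `sdPart` is symmetric, the lift
is trace-free, hence in `sl(2, ℂ)`. -/
lemma spinLift_eq_sdPart (hT : ∀ a b, T b a = - T a b) (C B : Fin 2) :
    spinLift (fun c b => eta c c * T c b) C B = - (1 / 2) * ∑ D, eps C D * sdPart T D B := by
  obtain ⟨s1, s2, s3, s4⟩ := sdPart_values hT
  fin_cases C <;> fin_cases B <;>
  · simp only [spinLift, star_sigma]
    simp [s1, s2, s3, s4, sigma_mul_sigma, pauli, eps, Fin.sum_univ_four, eta,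
      diag_eq_zero hT, hT 0 1, hT 0 2, hT 0 3, hT 1 2, hT 1 3, hT 2 3]
    try ring_nf
    try simp only [Complex.I_sq]
    try ring

end bivector

/-! ### The curvature spinors of an algebraic curvature tensor -/

section curvatureSpinors

variable (R : Fin 4 → Fin 4 → Fin 4 → Fin 4 → ℝ)

/-- The Ricci tensor of `R_{abcd}`. -/
def ricciOf (b d : Fin 4) : ℝ := ∑ a, eta a a * R a b a d

/-- The scalar curvature of `R_{abcd}`. -/
def scalarOf : ℝ := ∑ a, eta a a * ricciOf R a a

/-- The Schouten tensor of `R_{abcd}`. -/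
def schoutenOf (a b : Fin 4) : ℝ :=
  (1 / 2) * ricciOf R a b - (1 / 12) * scalarOf R * eta a b

/-- The Weyl tensor of `R_{abcd}`. -/
def weylOf (a b c d : Fin 4) : ℝ :=
  R a b c d - (eta b d * schoutenOf R a c - eta a d * schoutenOf R b c
    + schoutenOf R b d * eta a c - schoutenOf R a d * eta b c)

/-- The trace-free Ricci spinor of `R_{abcd}`. -/
def phiOf (A B A' B' : Fin 2) : ℂ :=
  ∑ a, ∑ b, sigma a A A' * sigma b B B' *
    ((-(1 / 2) * (ricciOf R a b - (1 / 4) * scalarOf R * eta a b) : ℝ) : ℂ)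

/-- The contraction of both pairs of `T_{abcd}` with the self-dual projector. -/
def sdSdPart (T : Fin 4 → Fin 4 → Fin 4 → Fin 4 → ℝ) (A B C D : Fin 2) : ℂ :=
  sdPart (fun a b => sdPart (fun c d => (T a b c d : ℂ)) C D) A B

/-- The contraction of the first pair of `T_{abcd}` with the anti-self-dual and of the second pair
with the self-dual projector. -/
def asdSdPart (T : Fin 4 → Fin 4 → Fin 4 → Fin 4 → ℝ) (A' B' C D : Fin 2) : ℂ :=
  asdPart (fun a b => sdPart (fun c d => (T a b c d : ℂ)) C D) A' B'

variable {R}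

lemma sdPart_neg (T : Fin 4 → Fin 4 → ℂ) (A B : Fin 2) :
    sdPart (fun a b => - T a b) A B = - sdPart T A B := by
  simp only [sdPart, mul_neg, Finset.sum_neg_distrib]

/-- In dimension four this is the only cyclic identity that does not follow from the pair
symmetries. With them it brings all components to a normal form with 20 independent ones. -/
lemma IsCurvatureTensor.bianchi' (h : IsCurvatureTensor R) :
    R 0 3 1 2 = R 0 2 1 3 - R 0 1 2 3 := by
  have h1 := h.bianchi 1 2 0 3
  linarith [h.pair_symm 1 2 0 3, h.swap_right 0 3 1 2, h.pair_symm 2 3 0 1, h.pair_symm 3 1 0 2,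
    h.swap_right 0 2 1 3]

lemma IsCurvatureTensor.self_left (h : IsCurvatureTensor R) (a c d : Fin 4) : R a a c d = 0 := by
  linarith [h.swap_left a a c d]

lemma IsCurvatureTensor.self_right (h : IsCurvatureTensor R) (a b c : Fin 4) : R a b c c = 0 := by
  linarith [h.swap_right a b c c]

lemma IsCurvatureTensor.ricciOf_values (h : IsCurvatureTensor R) :
    (ricciOf R 0 0 = - R 0 1 0 1 - R 0 2 0 2 - R 0 3 0 3 ∧
    ricciOf R 0 1 = - R 0 2 1 2 - R 0 3 1 3 ∧
    ricciOf R 0 2 = R 0 1 1 2 - R 0 3 2 3 ∧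
    ricciOf R 0 3 = R 0 1 1 3 + R 0 2 2 3) ∧
    (ricciOf R 1 1 = R 0 1 0 1 - R 1 2 1 2 - R 1 3 1 3 ∧
    ricciOf R 1 2 = R 0 1 0 2 - R 1 3 2 3 ∧
    ricciOf R 1 3 = R 0 1 0 3 + R 1 2 2 3) ∧
    (ricciOf R 2 2 = R 0 2 0 2 - R 1 2 1 2 - R 2 3 2 3 ∧
    ricciOf R 2 3 = R 0 2 0 3 - R 1 2 1 3) ∧
    ricciOf R 3 3 = R 0 3 0 3 - R 1 3 1 3 - R 2 3 2 3 := by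
  refine ⟨⟨?_, ?_, ?_, ?_⟩, ⟨?_, ?_, ?_⟩, ⟨?_, ?_⟩, ?_⟩ <;>
  · simp [ricciOf, Fin.sum_univ_four, eta, h.self_left, h.self_right, h.swap_left 0 1,
      h.swap_left 0 2, h.swap_left 0 3, h.swap_left 1 2, h.swap_left 1 3, h.swap_left 2 3,
      h.swap_right _ _ 0 1, h.swap_right _ _ 0 2, h.swap_right _ _ 0 3, h.swap_right _ _ 1 2,
      h.swap_right _ _ 1 3, h.swap_right _ _ 2 3]
    try ring

lemma IsCurvatureTensor.ricciOf_symm (h : IsCurvatureTensor R) (a b : Fin 4) :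
    ricciOf R b a = ricciOf R a b :=
  Finset.sum_congr rfl fun c _ => by rw [h.pair_symm]

lemma IsCurvatureTensor.scalarOf_value (h : IsCurvatureTensor R) :
    scalarOf R = - 2 * R 0 1 0 1 - 2 * R 0 2 0 2 - 2 * R 0 3 0 3 + 2 * R 1 2 1 2
      + 2 * R 1 3 1 3 + 2 * R 2 3 2 3 := by
  obtain ⟨⟨r00, -, -, -⟩, ⟨r11, -, -⟩, ⟨r22, -⟩, r33⟩ := h.ricciOf_values
  simp [scalarOf, Fin.sum_univ_four, eta, r00, r11, r22, r33]
  ring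

lemma IsCurvatureTensor.weylOf_swap_left (h : IsCurvatureTensor R) (a b c d : Fin 4) :
    weylOf R b a c d = - weylOf R a b c d := by
  simp only [weylOf, h.swap_left a b]
  ring

lemma IsCurvatureTensor.weylOf_swap_right (h : IsCurvatureTensor R) (a b c d : Fin 4) :
    weylOf R a b d c = - weylOf R a b c d := by
  simp only [weylOf, h.swap_right a b c]
  ring

lemma sdSdPart_values {T : Fin 4 → Fin 4 → Fin 4 → Fin 4 → ℝ}
    (h1 : ∀ a b c d, T b a c d = - T a b c d) (C D : Fin 2) :
    sdSdPart T 0 0 C D = sdPart (fun c d => (T 0 1 c d : ℂ)) C D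
        - Complex.I * sdPart (fun c d => (T 0 2 c d : ℂ)) C D
        - sdPart (fun c d => (T 1 3 c d : ℂ)) C D
        + Complex.I * sdPart (fun c d => (T 2 3 c d : ℂ)) C D ∧
    sdSdPart T 0 1 C D = - sdPart (fun c d => (T 0 3 c d : ℂ)) C D
        - Complex.I * sdPart (fun c d => (T 1 2 c d : ℂ)) C D ∧
    sdSdPart T 1 0 C D = - sdPart (fun c d => (T 0 3 c d : ℂ)) C D
        - Complex.I * sdPart (fun c d => (T 1 2 c d : ℂ)) C D ∧
    sdSdPart T 1 1 C D = - sdPart (fun c d => (T 0 1 c d : ℂ)) C D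
        - Complex.I * sdPart (fun c d => (T 0 2 c d : ℂ)) C D
        - sdPart (fun c d => (T 1 3 c d : ℂ)) C D
        - Complex.I * sdPart (fun c d => (T 2 3 c d : ℂ)) C D :=
  sdPart_values fun a b => by simp only [h1 a b, Complex.ofReal_neg, sdPart_neg]

lemma asdSdPart_values {T : Fin 4 → Fin 4 → Fin 4 → Fin 4 → ℝ}
    (h1 : ∀ a b c d, T b a c d = - T a b c d) (C D : Fin 2) :
    asdSdPart T 0 0 C D = sdPart (fun c d => (T 0 1 c d : ℂ)) C D
        + Complex.I * sdPart (fun c d => (T 0 2 c d : ℂ)) C D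
        - sdPart (fun c d => (T 1 3 c d : ℂ)) C D
        - Complex.I * sdPart (fun c d => (T 2 3 c d : ℂ)) C D ∧
    asdSdPart T 0 1 C D = - sdPart (fun c d => (T 0 3 c d : ℂ)) C D
        + Complex.I * sdPart (fun c d => (T 1 2 c d : ℂ)) C D ∧
    asdSdPart T 1 0 C D = - sdPart (fun c d => (T 0 3 c d : ℂ)) C D
        + Complex.I * sdPart (fun c d => (T 1 2 c d : ℂ)) C D ∧
    asdSdPart T 1 1 C D = - sdPart (fun c d => (T 0 1 c d : ℂ)) C D
        + Complex.I * sdPart (fun c d => (T 0 2 c d : ℂ)) C D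
        - sdPart (fun c d => (T 1 3 c d : ℂ)) C D
        + Complex.I * sdPart (fun c d => (T 2 3 c d : ℂ)) C D :=
  asdPart_values fun a b => by simp only [h1 a b, Complex.ofReal_neg, sdPart_neg]

lemma sdPart_ofReal_values {T : Fin 4 → Fin 4 → Fin 4 → Fin 4 → ℝ}
    (h2 : ∀ a b c d, T a b d c = - T a b c d) (a b : Fin 4) :
    sdPart (fun c d => (T a b c d : ℂ)) 0 0
      = T a b 0 1 - Complex.I * T a b 0 2 - T a b 1 3 + Complex.I * T a b 2 3 ∧
    sdPart (fun c d => (T a b c d : ℂ)) 0 1 = - T a b 0 3 - Complex.I * T a b 1 2 ∧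
    sdPart (fun c d => (T a b c d : ℂ)) 1 0 = - T a b 0 3 - Complex.I * T a b 1 2 ∧
    sdPart (fun c d => (T a b c d : ℂ)) 1 1
      = - T a b 0 1 - Complex.I * T a b 0 2 - T a b 1 3 - Complex.I * T a b 2 3 :=
  sdPart_values fun c d => by simp only [h2 a b c d, Complex.ofReal_neg]

lemma sdPart_symm {T : Fin 4 → Fin 4 → ℂ} (hT : ∀ a b, T b a = - T a b) (A B : Fin 2) :
    sdPart T A B = sdPart T B A := by
  obtain ⟨-, s2, s3, -⟩ := sdPart_values hT
  fin_cases A <;> fin_cases B <;> simp [s2, s3]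

/-- The self-dual part of the curvature. -/
lemma IsCurvatureTensor.sdSdPart_eq (h : IsCurvatureTensor R) (A B C D : Fin 2) :
    sdSdPart R A B C D = sdSdPart (weylOf R) A B C D
      + 4 * ((scalarOf R / 24 : ℝ) : ℂ) * (eps A C * eps B D + eps A D * eps B C) := by
  obtain ⟨⟨r00, r01, r02, r03⟩, ⟨r11, r12, r13⟩, ⟨r22, r23⟩, r33⟩ := h.ricciOf_values
  have hs := h.scalarOf_value
  have v := sdSdPart_values h.swap_left C D
  have w := sdSdPart_values h.weylOf_swap_left C D
  have v' := sdPart_ofReal_values h.swap_right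
  have w' := sdPart_ofReal_values h.weylOf_swap_right
  fin_cases A <;> fin_cases B <;> fin_cases C <;> fin_cases D <;>
  · simp only [Fin.zero_eta, Fin.mk_one, Fin.isValue] at v w ⊢
    simp only [v, w, v', w']
    simp [weylOf, schoutenOf, eta, eps, r00, r01, r02, r03, r11, r12, r13, r22, r23, r33, hs,
      h.ricciOf_symm 0 1, h.ricciOf_symm 0 2, h.ricciOf_symm 0 3, h.ricciOf_symm 1 2,
      h.ricciOf_symm 1 3, h.ricciOf_symm 2 3]
    ring_nf
    try simp only [Complex.I_sq]
    try ring

/-- The anti-self-dual part of the curvature is the trace-free Ricci spinor. -/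
lemma IsCurvatureTensor.asdSdPart_eq (h : IsCurvatureTensor R) (A B A' B' : Fin 2) :
    asdSdPart R A' B' A B = 4 * phiOf R A B A' B' := by
  obtain ⟨⟨r00, r01, r02, r03⟩, ⟨r11, r12, r13⟩, ⟨r22, r23⟩, r33⟩ := h.ricciOf_values
  have hs := h.scalarOf_value
  have v := asdSdPart_values h.swap_left A B
  have v' := sdPart_ofReal_values h.swap_right
  fin_cases A <;> fin_cases B <;> fin_cases A' <;> fin_cases B' <;>
  · simp only [Fin.zero_eta, Fin.mk_one, Fin.isValue] at v ⊢
    simp only [v, v']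
    simp [phiOf, sigma_mul_sigma, pauli, Fin.sum_univ_four, eta, r00, r01, r02, r03, r11, r12,
      r13, r22, r23, r33, hs,
      h.ricciOf_symm 0 1, h.ricciOf_symm 0 2, h.ricciOf_symm 0 3, h.ricciOf_symm 1 2,
      h.ricciOf_symm 1 3, h.ricciOf_symm 2 3, h.pair_symm 0 1 0 2, h.pair_symm 0 1 0 3,
      h.pair_symm 0 1 1 2, h.pair_symm 0 1 1 3, h.pair_symm 0 1 2 3, h.pair_symm 0 2 0 3,
      h.pair_symm 0 2 1 2, h.pair_symm 0 2 1 3, h.pair_symm 0 2 2 3, h.pair_symm 0 3 1 2,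
      h.pair_symm 0 3 1 3, h.pair_symm 0 3 2 3, h.pair_symm 1 2 1 3, h.pair_symm 1 2 2 3,
      h.pair_symm 1 3 2 3, h.bianchi']
    ring_nf
    try simp only [Complex.I_sq]
    try ring

/-- The Weyl spinor is totally symmetric. -/
lemma IsCurvatureTensor.sdSdPart_weylOf_symm (h : IsCurvatureTensor R) (A B C D : Fin 2) :
    sdSdPart (weylOf R) A B C D = sdSdPart (weylOf R) A C B D := by
  obtain ⟨⟨r00, r01, r02, r03⟩, ⟨r11, r12, r13⟩, ⟨r22, r23⟩, r33⟩ := h.ricciOf_values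
  have hs := h.scalarOf_value
  have w := fun C D => sdSdPart_values h.weylOf_swap_left C D
  have w' := sdPart_ofReal_values h.weylOf_swap_right
  -- Antisymmetry in a pair of spinor indices has one independent component, so comparing `01` with
  -- `10` suffices. The difference vanishes because the Weyl tensor is trace-free and obeys the
  -- cyclic identity.
  have key : ∀ A D, sdSdPart (weylOf R) A 0 1 D = sdSdPart (weylOf R) A 1 0 D := by
    intro A D
    fin_cases A <;> fin_cases D <;>
    · simp only [Fin.zero_eta, Fin.mk_one, Fin.isValue, w, w']
      simp [weylOf, schoutenOf, eta, r00, r01, r02, r03, r11, r12, r13, r22, r23, r33, hs,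
        h.ricciOf_symm 0 1, h.ricciOf_symm 0 2, h.ricciOf_symm 0 3, h.ricciOf_symm 1 2,
        h.ricciOf_symm 1 3, h.ricciOf_symm 2 3, h.pair_symm 0 1 0 2, h.pair_symm 0 1 0 3,
        h.pair_symm 0 1 1 2, h.pair_symm 0 1 1 3, h.pair_symm 0 1 2 3, h.pair_symm 0 2 0 3,
        h.pair_symm 0 2 1 2, h.pair_symm 0 2 1 3, h.pair_symm 0 2 2 3, h.pair_symm 0 3 1 2,
        h.pair_symm 0 3 1 3, h.pair_symm 0 3 2 3, h.pair_symm 1 2 1 3, h.pair_symm 1 2 2 3,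
        h.pair_symm 1 3 2 3, h.bianchi']
      ring_nf
      try simp only [Complex.I_sq]
      try ring
  have key' : ∀ B C : Fin 2, B = C ∨ (B = 0 ∧ C = 1) ∨ (B = 1 ∧ C = 0) := by decide
  rcases key' B C with rfl | ⟨rfl, rfl⟩ | ⟨rfl, rfl⟩
  · rfl
  · exact key A D
  · exact (key A D).symm

lemma IsCurvatureTensor.sdSdPart_symm_left (h : IsCurvatureTensor R) (A B C D : Fin 2) :
    sdSdPart (weylOf R) A B C D = sdSdPart (weylOf R) B A C D :=
  sdPart_symm (fun a b => by simp only [h.weylOf_swap_left a b, Complex.ofReal_neg, sdPart_neg]) A B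

lemma IsCurvatureTensor.sdSdPart_symm_right (h : IsCurvatureTensor R) (A B C D : Fin 2) :
    sdSdPart (weylOf R) A B C D = sdSdPart (weylOf R) A B D C := by
  have : ∀ a b, sdPart (fun c d => (weylOf R a b c d : ℂ)) C D
      = sdPart (fun c d => (weylOf R a b c d : ℂ)) D C := fun a b =>
    sdPart_symm (fun c d => by simp only [h.weylOf_swap_right a b c, Complex.ofReal_neg]) C D
  simp only [sdSdPart, this]

end curvatureSpinors

lemma asdPart_symm {T : Fin 4 → Fin 4 → ℂ} (hT : ∀ a b, T b a = - T a b) (A B : Fin 2) :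
    asdPart T A B = asdPart T B A := by
  obtain ⟨-, s2, s3, -⟩ := asdPart_values hT
  fin_cases A <;> fin_cases B <;> simp [s2, s3]

section

variable {R : Fin 4 → Fin 4 → Fin 4 → Fin 4 → ℝ}

/-- The symmetry is inherited from the mixed part of the curvature: antisymmetry in a tensor pair
makes the corresponding spinor pair symmetric. -/
lemma IsCurvatureTensor.phiOf_symm_left (h : IsCurvatureTensor R) (A B A' B' : Fin 2) :
    phiOf R A B A' B' = phiOf R B A A' B' := by
  have h1 : ∀ a b, sdPart (fun c d => (R a b c d : ℂ)) A B
      = sdPart (fun c d => (R a b c d : ℂ)) B A := fun a b =>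
    sdPart_symm (fun c d => by simp only [h.swap_right a b c, Complex.ofReal_neg]) A B
  have h2 := h.asdSdPart_eq A B A' B'
  have h3 := h.asdSdPart_eq B A A' B'
  have h4 : asdSdPart R A' B' A B = asdSdPart R A' B' B A := by simp only [asdSdPart, h1]
  linear_combination (1 / 4 : ℂ) * (h3 - h2 + h4)

lemma IsCurvatureTensor.phiOf_symm_right (h : IsCurvatureTensor R) (A B A' B' : Fin 2) :
    phiOf R A B A' B' = phiOf R A B B' A' := by
  have h2 := h.asdSdPart_eq A B A' B'
  have h3 := h.asdSdPart_eq A B B' A'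
  have h4 : asdSdPart R A' B' A B = asdSdPart R B' A' A B :=
    asdPart_symm (fun a b => by simp only [h.swap_left a b, Complex.ofReal_neg, sdPart_neg]) A' B'
  linear_combination (1 / 4 : ℂ) * (h3 - h2 + h4)

lemma star_phiOf (A B A' B' : Fin 2) : star (phiOf R A B A' B') = phiOf R A' B' A B := by
  simp only [phiOf, star_sum, star_mul', star_sigma]
  simp

/-- The curvature of the spin connection in terms of the curvature spinors. -/
lemma IsCurvatureTensor.sum_sigma_spinLift (h : IsCurvatureTensor R) (A A' B B' E D : Fin 2) :
    ∑ a, ∑ b, sigma a A A' * sigma b B B' * spinLift (fun c d => eta c c * R a b c d) E D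
      = - ∑ C, eps E C * (eps A' B' * (1 / 4 * sdSdPart (weylOf R) A B C D)
          + eps A B * phiOf R C D A' B'
          + ((scalarOf R / 24 : ℝ) : ℂ) * eps A' B' * (eps A C * eps B D + eps A D * eps B C)) := by
  have hl : ∀ a b, spinLift (fun c d => eta c c * R a b c d) E D
      = - (1 / 2) * ∑ C, eps E C * sdPart (fun c d => (R a b c d : ℂ)) C D := fun a b =>
    spinLift_eq_sdPart (T := fun c d => (R a b c d : ℂ))
      (fun c d => by simp only [h.swap_right a b c, Complex.ofReal_neg]) E D
  have hb : ∀ C, ∑ a, ∑ b, sigma a A A' * sigma b B B' * sdPart (fun c d => (R a b c d : ℂ)) C D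
      = 1 / 2 * (eps A' B' * sdSdPart R A B C D + eps A B * asdSdPart R A' B' C D) := fun C =>
    sum_sigma_sigma_bivector (T := fun a b => sdPart (fun c d => (R a b c d : ℂ)) C D)
      (fun a b => by simp only [h.swap_left a b, Complex.ofReal_neg, sdPart_neg]) A A' B B'
  have hsum : ∑ a, ∑ b, sigma a A A' * sigma b B B' * spinLift (fun c d => eta c c * R a b c d) E D
      = - (1 / 2) * ∑ C, eps E C *
        ∑ a, ∑ b, sigma a A A' * sigma b B B' * sdPart (fun c d => (R a b c d : ℂ)) C D := by
    simp only [hl, Fin.sum_univ_two, Finset.mul_sum, ← Finset.sum_add_distrib]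
    refine Finset.sum_congr rfl fun a _ => Finset.sum_congr rfl fun b _ => ?_
    ring
  rw [hsum]
  simp only [hb, h.asdSdPart_eq, h.sdSdPart_eq, Fin.sum_univ_two]
  ring

end

/-! ### The lift of Lorentz generators to spinors as a Lie algebra map -/

section connection

variable {T : Fin 4 → Fin 4 → ℂ}

lemma spinLift_trace (hT : ∀ a b, T b a = - T a b) :
    spinLift (fun c b => eta c c * T c b) 1 1 = - spinLift (fun c b => eta c c * T c b) 0 0 := by
  rw [spinLift_eq_sdPart hT, spinLift_eq_sdPart hT]
  simp only [eps, Fin.sum_univ_two]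
  rw [sdPart_symm hT 0 1]
  simp

/-- The lift to spinors is a homomorphism of Lie algebras. -/
lemma spinLift_comm {U : Fin 4 → Fin 4 → ℂ} (hT : ∀ a b, T b a = - T a b)
    (hU : ∀ a b, U b a = - U a b) (C B : Fin 2) :
    spinLift (fun c b => ∑ f, (eta c c * T c f * (eta f f * U f b)
        - eta c c * U c f * (eta f f * T f b))) C B
      = ∑ E, (spinLift (fun c b => eta c c * T c b) C E * spinLift (fun c b => eta c c * U c b) E B
        - spinLift (fun c b => eta c c * U c b) C E * spinLift (fun c b => eta c c * T c b) E B) := by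
  obtain ⟨s1, s2, s3, s4⟩ := sdPart_values hT
  obtain ⟨t1, t2, t3, t4⟩ := sdPart_values hU
  -- `V` is the commutator of the two generators with its index lowered; it is again antisymmetric,
  -- so `spinLift_eq_sdPart` applies to it as well.
  set V : Fin 4 → Fin 4 → ℂ := fun c b => ∑ f, eta f f * (T c f * U f b - U c f * T f b) with hVdef
  have hV : ∀ a b, V b a = - V a b := by
    intro a b
    simp only [hVdef, ← Finset.sum_neg_distrib]
    refine Finset.sum_congr rfl fun f _ => ?_
    rw [hT a f, hT f b, hU a f, hU f b]
    ring
  obtain ⟨v1, v2, v3, v4⟩ := sdPart_values hV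
  have h1 : (fun c b => ∑ f, ((eta c c : ℂ) * T c f * (eta f f * U f b)
        - eta c c * U c f * (eta f f * T f b))) = fun c b => (eta c c : ℂ) * V c b := by
    funext c b
    simp only [hVdef, Finset.mul_sum]
    exact Finset.sum_congr rfl fun f _ => by ring
  rw [h1]
  simp only [spinLift_eq_sdPart hT, spinLift_eq_sdPart hU, spinLift_eq_sdPart hV]
  have hv : ∀ a b, V a b = T a 0 * U 0 b - U a 0 * T 0 b - (T a 1 * U 1 b - U a 1 * T 1 b)
      - (T a 2 * U 2 b - U a 2 * T 2 b) - (T a 3 * U 3 b - U a 3 * T 3 b) := by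
    intro a b
    simp [hVdef, Fin.sum_univ_four, eta]
    ring
  fin_cases C <;> fin_cases B <;>
  · simp [eps, s1, s2, s3, s4, t1, t2, t3, t4, v1, v2, v3, v4, hv, diag_eq_zero hT,
      diag_eq_zero hU, hT 0 1, hT 0 2, hT 0 3, hT 1 2, hT 1 3, hT 2 3, hU 0 1, hU 0 2, hU 0 3,
      hU 1 2, hU 1 3, hU 2 3]
    ring_nf
    try simp only [Complex.I_sq]
    try ring

/-- The Infeld–van der Waerden symbols are covariantly constant. -/
lemma sigma_parallel (hT : ∀ a b, T b a = - T a b) (hreal : ∀ a b, star (T a b) = T a b)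
    (c : Fin 4) (B B' : Fin 2) :
    ∑ C, spinLift (fun c b => eta c c * T c b) C B * sigma c C B'
      + ∑ C', star (spinLift (fun c b => eta c c * T c b) C' B') * sigma c B C'
      = ∑ b, eta c c * T c b * sigma b B B' := by
  obtain ⟨s1, s2, s3, s4⟩ := sdPart_values hT
  simp only [spinLift_eq_sdPart hT, sigma_eq]
  have hr : ∀ a b, (starRingEnd ℂ) (T a b) = T a b := hreal
  fin_cases c <;> fin_cases B <;> fin_cases B' <;>
  · simp [eps, s1, s2, s3, s4, eta, pauli, diag_eq_zero hT, hr, Fin.sum_univ_four,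
      hT 0 1, hT 0 2, hT 0 3, hT 1 2, hT 1 3, hT 2 3]
    ring_nf
    try simp only [Complex.I_sq]
    try ring

end connection

section spinLiftLinear

lemma spinLift_add (G H : Fin 4 → Fin 4 → ℂ) (C B : Fin 2) :
    spinLift (fun c b => G c b + H c b) C B = spinLift G C B + spinLift H C B := by
  simp only [spinLift, mul_add, Finset.sum_add_distrib]

lemma spinLift_mul (k : ℂ) (G : Fin 4 → Fin 4 → ℂ) (C B : Fin 2) :
    spinLift (fun c b => k * G c b) C B = k * spinLift G C B := by
  simp only [spinLift, Finset.mul_sum]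
  refine Finset.sum_congr rfl fun _ _ => Finset.sum_congr rfl fun _ _ =>
    Finset.sum_congr rfl fun _ _ => ?_
  ring

lemma spinLift_sub (G H : Fin 4 → Fin 4 → ℂ) (C B : Fin 2) :
    spinLift (fun c b => G c b - H c b) C B = spinLift G C B - spinLift H C B := by
  simp only [spinLift, mul_sub, Finset.sum_sub_distrib]

lemma spinLift_sum (G : Fin 4 → Fin 4 → Fin 4 → ℂ) (C B : Fin 2) :
    spinLift (fun c b => ∑ f, G f c b) C B = ∑ f, spinLift (G f) C B := by
  simp only [Fin.sum_univ_four, spinLift_add]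

end spinLiftLinear

namespace SpinStructure

variable {M : Type*} [TopologicalSpace M] [ChartedSpace E4 M] [IsManifold (𝓡 4) ∞ M]
  {g : LorentzianMetric M} {ι : Type*} (S : SpinStructure g ι)

/-! ### The spin connection and its curvature -/

/-- The curvature tensor `R_{abcd}`. -/
def lowRiemann (i : ι) (x : M) (a b c d : Fin 4) : ℝ := eta c c * S.riemann i a b c d x

section spinCurvature

variable {S} {i : ι} {x : M}

lemma riemann_eq (i : ι) (x : M) (a b c d : Fin 4) :
    S.riemann i a b c d x = eta c c * S.lowRiemann i x a b c d := by
  rw [lowRiemann, ← mul_assoc, eta_self_mul_self, one_mul]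

lemma isCurvatureTensor_lowRiemann (hx : x ∈ S.dom i) : IsCurvatureTensor (S.lowRiemann i x) :=
  isCurvatureTensor_riemann hx

lemma ricci_eq (i : ι) (x : M) (b d : Fin 4) :
    S.ricci i b d x = ricciOf (S.lowRiemann i x) b d := by
  simp only [ricci, ricciOf, riemann_eq]

lemma scalarCurv_eq (i : ι) (x : M) : S.scalarCurv i x = scalarOf (S.lowRiemann i x) := by
  simp only [scalarCurv, scalarOf, ricci_eq]

lemma weyl_eq (i : ι) (x : M) (a b c d : Fin 4) :
    S.weyl i a b c d x = weylOf (S.lowRiemann i x) a b c d := by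
  simp only [weyl, weylOf, schouten, schoutenOf, ricci_eq, scalarCurv_eq, lowRiemann]

lemma Lam_eq (i : ι) (x : M) (B B' : Fin 0 → Fin 2) :
    S.Lam i x B B' = ((scalarOf (S.lowRiemann i x) / 24 : ℝ) : ℂ) := by
  simp only [Lam, scalarCurv_eq]

lemma Phi_eq (i : ι) (x : M) (B B' : Fin 2 → Fin 2) :
    S.Phi i x B B' = phiOf (S.lowRiemann i x) (B 0) (B 1) (B' 0) (B' 1) := by
  simp only [Phi, phiOf, scalarCurv_eq, ricci_eq]

lemma Psi_eq (i : ι) (x : M) (B : Fin 4 → Fin 2) (B' : Fin 0 → Fin 2) :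
    S.Psi i x B B'
      = 1 / 4 * sdSdPart (weylOf (S.lowRiemann i x)) (B 0) (B 1) (B 2) (B 3) := by
  simp only [Psi, sdSdPart, sdPart, weyl_eq]
  congr 1
  refine Finset.sum_congr rfl fun Q _ => Finset.sum_congr rfl fun U _ => ?_
  simp only [Finset.mul_sum]
  have h1 : ∀ f : Fin 2 → Fin 2 → Fin 4 → Fin 4 → ℂ,
      ∑ P, ∑ V, ∑ a, ∑ b, f P V a b = ∑ a, ∑ b, ∑ P, ∑ V, f P V a b := by
    intro f
    simp only [Fin.sum_univ_two, Finset.sum_add_distrib]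
  rw [h1]
  refine Finset.sum_congr rfl fun a _ => Finset.sum_congr rfl fun b _ =>
    Finset.sum_congr rfl fun P _ => Finset.sum_congr rfl fun V _ =>
    Finset.sum_congr rfl fun c _ => Finset.sum_congr rfl fun d _ => ?_
  ring

/-- The connection with all indices down. -/
def lowConn (S : SpinStructure g ι) (i : ι) (x : M) (a c b : Fin 4) : ℂ :=
  ((eta c c * S.conn i a c b x : ℝ) : ℂ)

lemma lowConn_antisymm (i : ι) (x : M) (a b c : Fin 4) :
    S.lowConn i x a c b = - S.lowConn i x a b c := by
  rw [lowConn, lowConn, conn_antisymm i a b c]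
  push_cast
  ring

lemma conn_eq (i : ι) (x : M) (a c b : Fin 4) :
    (S.conn i a c b x : ℂ) = eta c c * S.lowConn i x a c b := by
  rw [lowConn, ← Complex.ofReal_mul, ← mul_assoc, eta_self_mul_self, one_mul]

lemma spinConn_eq (i : ι) (a : Fin 4) (C B : Fin 2) (x : M) :
    S.spinConn i a C B x = spinLift (fun c b => eta c c * S.lowConn i x a c b) C B := by
  simp only [spinConn, spinLift, conn_eq]

lemma spinConn_eq_spinLift (i : ι) (a : Fin 4) (C B : Fin 2) (x : M) :
    S.spinConn i a C B x = spinLift (fun c b => (S.conn i a c b x : ℂ)) C B := rfl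

/-- This makes `ε_{AB}` covariantly constant. It is used wherever a contraction with `ε` passes
through a derivative. -/
lemma spinConn_trace (i : ι) (a : Fin 4) (x : M) :
    S.spinConn i a 1 1 x = - S.spinConn i a 0 0 x := by
  rw [spinConn_eq, spinConn_eq]
  exact spinLift_trace fun b c => lowConn_antisymm i x a b c

/-- Covariant constancy of `σ`: the spin connection on a pair `BB'` and the Levi-Civita connection
on a vector index agree. -/
lemma sigma_conn (i : ι) (x : M) (a c : Fin 4) (B B' : Fin 2) :
    ∑ C, S.spinConn i a C B x * sigma c C B' + ∑ C', star (S.spinConn i a C' B' x) * sigma c B C'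
      = ∑ b, (S.conn i a c b x : ℂ) * sigma b B B' := by
  have h := sigma_parallel (T := S.lowConn i x a) (fun b c => lowConn_antisymm i x a b c)
    (fun b c => by simp [lowConn]) c B B'
  simpa only [← conn_eq, ← spinConn_eq_spinLift] using h

lemma SmoothOn.spinConn (S : SpinStructure g ι) (i : ι) (a : Fin 4) (C B : Fin 2) :
    S.SmoothOn i (S.spinConn i a C B) :=
  (SmoothOn.const _).mul (SmoothOn.sum fun _ => SmoothOn.sum fun b => SmoothOn.sum fun c =>
    (SmoothOn.const _).mul (SmoothOn.conn S i a c b).ofReal)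

lemma frameDeriv_spinConn (hx : x ∈ S.dom i) (a b : Fin 4) (C B : Fin 2) :
    S.frameDeriv i a (S.spinConn i b C B) x
      = spinLift (fun c d => ((S.frameDeriv i a (S.conn i b c d) x : ℝ) : ℂ)) C B := by
  have h := fun c d => SmoothOn.conn S i b c d
  have hs : ∀ (Q : Fin 2) (c d : Fin 4), S.SmoothOn i
      (fun y => star (sigma c C Q) * sigma d B Q * (S.conn i b c d y : ℂ)) := fun Q c d =>
    (SmoothOn.const _).mul (h c d).ofReal
  simp only [spinLift]
  change S.frameDeriv i a (fun y => (1 / 2) * ∑ Q, ∑ d, ∑ c,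
    star (sigma c C Q) * sigma d B Q * (S.conn i b c d y : ℂ)) x = _
  rw [frameDeriv_const_mul _ (SmoothOn.sum fun Q => SmoothOn.sum fun d => SmoothOn.sum fun c =>
    hs Q c d) hx, frameDeriv_sum _ (fun Q => SmoothOn.sum fun d => SmoothOn.sum fun c =>
    hs Q c d) hx]
  congr 1
  refine Finset.sum_congr rfl fun Q _ => ?_
  rw [frameDeriv_sum _ (fun d => SmoothOn.sum fun c => hs Q c d) hx]
  refine Finset.sum_congr rfl fun d _ => ?_
  rw [frameDeriv_sum _ (fun c => hs Q c d) hx]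
  refine Finset.sum_congr rfl fun c _ => ?_
  rw [frameDeriv_const_mul _ (h c d).ofReal hx, frameDeriv_ofReal (h c d) hx]

/-- The curvature `F_{ab}{}^C{}_B` of the spin connection. -/
def spinCurv (S : SpinStructure g ι) (i : ι) (x : M) (a b : Fin 4) (C B : Fin 2) : ℂ :=
  spinLift (fun c d => eta c c * S.lowRiemann i x a b c d) C B

lemma spinCurv_eq (hx : x ∈ S.dom i) (a b : Fin 4) (C B : Fin 2) :
    S.frameDeriv i a (S.spinConn i b C B) x - S.frameDeriv i b (S.spinConn i a C B) x
      + ∑ E, (S.spinConn i a C E x * S.spinConn i b E B x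
        - S.spinConn i b C E x * S.spinConn i a E B x)
      - ∑ f, ((eta f f * S.bracketCoeff i a b f x : ℝ) : ℂ) * S.spinConn i f C B x
      = S.spinCurv i x a b C B := by
  have h1 := spinLift_comm (T := S.lowConn i x a) (U := S.lowConn i x b)
    (fun c d => lowConn_antisymm i x a c d) (fun c d => lowConn_antisymm i x b c d) C B
  simp only [← conn_eq, ← spinConn_eq_spinLift] at h1
  rw [← h1, frameDeriv_spinConn hx, frameDeriv_spinConn hx]
  simp only [spinConn_eq_spinLift _ _ C B, ← spinLift_mul]
  rw [← spinLift_sum, ← spinLift_sub, ← spinLift_add, ← spinLift_sub, spinCurv]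
  congr 1
  funext c d
  rw [← Complex.ofReal_mul, ← riemann_eq, riemann]
  push_cast
  ring

end spinCurvature

end SpinStructure

namespace SpinStructure

variable {M : Type*} [TopologicalSpace M] [ChartedSpace E4 M] [IsManifold (𝓡 4) ∞ M]
  {g : LorentzianMetric M} {ι : Type*} (S : SpinStructure g ι)

/-! ### Second covariant derivatives and commutators -/

/-- The covariant derivative `∇_a T` along a vector of the tetrad. -/
def covAlong {p q : ℕ} (a : Fin 4) (T : S.Field p q) : S.Field p q := fun i x B B' =>
  S.frameDeriv i a (fun y => T i y B B') x
    - ∑ k, ∑ C, S.spinConn i a C (B k) x * T i x (Function.update B k C) B'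
    - ∑ k, ∑ C', star (S.spinConn i a C' (B' k) x) * T i x B (Function.update B' k C')

/-- Smoothness of the components of a family in the spin frame number `i`. -/
def SmoothField {p q : ℕ} (T : S.Field p q) (i : ι) : Prop :=
  ∀ B B', S.SmoothOn i (fun x => T i x B B')

section secondDerivative

variable {S} {i : ι} {x : M} {p q : ℕ} {T : S.Field p q}

lemma covDeriv_cons (T : S.Field p q) (i : ι) (x : M) (A A' : Fin 2) (B : Fin p → Fin 2)
    (B' : Fin q → Fin 2) :
    S.covDeriv T i x (Fin.cons A B) (Fin.cons A' B')
      = ∑ a, sigma a A A' * S.covAlong a T i x B B' := rfl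

lemma SmoothField.covAlong (hT : S.SmoothField T i) (a : Fin 4) :
    S.SmoothField (S.covAlong a T) i := fun B B' =>
  (((hT B B').frameDeriv a).sub (SmoothOn.sum fun k => SmoothOn.sum fun C =>
    (SmoothOn.spinConn S i a C (B k)).mul (hT _ _))).sub (SmoothOn.sum fun k => SmoothOn.sum fun C =>
    (SmoothOn.spinConn S i a C (B' k)).star.mul (hT _ _))

lemma SmoothField.covDeriv (hT : S.SmoothField T i) : S.SmoothField (S.covDeriv T) i :=
  fun B B' => SmoothOn.sum fun a => (SmoothOn.const (sigma a (B 0) (B' 0))).mul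
    (hT.covAlong a (Fin.tail B) (Fin.tail B'))

/-- As `σ` is parallel, the spin connection acting on the new pair `BB'` can be moved to the tetrad
index `b`, where it becomes `Γ_a{}^c{}_b`. -/
lemma covAlong_covDeriv (hT : S.SmoothField T i) (hx : x ∈ S.dom i) (a : Fin 4) (B B' : Fin 2)
    (C : Fin p → Fin 2) (C' : Fin q → Fin 2) :
    S.covAlong a (S.covDeriv T) i x (Fin.cons B C) (Fin.cons B' C')
      = ∑ b, sigma b B B' * (S.covAlong a (S.covAlong b T) i x C C'
          - ∑ c, (S.conn i a c b x : ℂ) * S.covAlong c T i x C C') := by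
  have hd : S.frameDeriv i a (fun y => S.covDeriv T i y (Fin.cons B C) (Fin.cons B' C')) x
      = ∑ b, sigma b B B' * S.frameDeriv i a (fun y => S.covAlong b T i y C C') x := by
    simp only [covDeriv_cons]
    rw [frameDeriv_sum _ (fun b => (SmoothOn.const _).mul (hT.covAlong b C C')) hx]
    exact Finset.sum_congr rfl fun b _ => frameDeriv_const_mul _ (hT.covAlong b C C') hx a
  have hc := fun c => sigma_conn (S := S) i x a c B B'
  rw [covAlong, hd]
  simp only [Fin.sum_univ_succ (n := p), Fin.sum_univ_succ (n := q), Fin.cons_zero, Fin.cons_succ,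
    Fin.update_cons_zero, ← Fin.cons_update, covDeriv_cons]
  have e1 : ∀ b, S.covAlong a (S.covAlong b T) i x C C'
      = S.frameDeriv i a (fun y => S.covAlong b T i y C C') x
    - ∑ k, ∑ E, S.spinConn i a E (C k) x * S.covAlong b T i x (Function.update C k E) C'
    - ∑ k, ∑ E, star (S.spinConn i a E (C' k) x) *
        S.covAlong b T i x C (Function.update C' k E) := fun b => rfl
  simp only [e1]
  have e2 : ∀ (K : Type) [Fintype K] (u : K → Fin 2 → ℂ) (v : Fin 4 → K → Fin 2 → ℂ),
      ∑ k, ∑ E, u k E * ∑ b, sigma b B B' * v b k E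
        = ∑ b, sigma b B B' * ∑ k, ∑ E, u k E * v b k E := by
    intro K _ u v
    simp only [Fin.sum_univ_four, Fin.sum_univ_two, Finset.mul_sum, ← Finset.sum_add_distrib]
    exact Finset.sum_congr rfl fun k _ => by ring
  rw [e2 (Fin p) (fun k E => S.spinConn i a E (C k) x)
      (fun b k E => S.covAlong b T i x (Function.update C k E) C'),
    e2 (Fin q) (fun k E => star (S.spinConn i a E (C' k) x))
      (fun b k E => S.covAlong b T i x C (Function.update C' k E))]
  simp only [mul_sub, Finset.sum_sub_distrib]
  have e3 : ∑ b, sigma b B B' * ∑ c, (S.conn i a c b x : ℂ) * S.covAlong c T i x C C'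
      = ∑ E, S.spinConn i a E B x * ∑ b, sigma b E B' * S.covAlong b T i x C C'
        + ∑ E, star (S.spinConn i a E B' x) * ∑ b, sigma b B E * S.covAlong b T i x C C' := by
    have e4 : ∑ b, sigma b B B' * ∑ c, (S.conn i a c b x : ℂ) * S.covAlong c T i x C C'
        = ∑ c, (∑ b, (S.conn i a c b x : ℂ) * sigma b B B') * S.covAlong c T i x C C' := by
      simp only [Finset.mul_sum, Finset.sum_mul]
      rw [Finset.sum_comm]
      exact Finset.sum_congr rfl fun c _ => Finset.sum_congr rfl fun b _ => by ring
    rw [e4]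
    simp only [← hc, Fin.sum_univ_four, Fin.sum_univ_two]
    ring
  rw [e3]
  ring

/-- The second covariant derivative in terms of derivatives along the tetrad. -/
lemma covDeriv_covDeriv (hT : S.SmoothField T i) (hx : x ∈ S.dom i) (A A' B B' : Fin 2)
    (C : Fin p → Fin 2) (C' : Fin q → Fin 2) :
    S.covDeriv (S.covDeriv T) i x (Fin.cons A (Fin.cons B C)) (Fin.cons A' (Fin.cons B' C'))
      = ∑ a, ∑ b, sigma a A A' * sigma b B B' * (S.covAlong a (S.covAlong b T) i x C C'
          - ∑ c, (S.conn i a c b x : ℂ) * S.covAlong c T i x C C') := by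
  rw [covDeriv_cons]
  simp only [covAlong_covDeriv hT hx, Finset.mul_sum]
  exact Finset.sum_congr rfl fun a _ => Finset.sum_congr rfl fun b _ => by ring

/-- The spinor form of the curvature operator: if `[∇_a, ∇_b] T` acts as `-F_{ab}` up to torsion, then
so does the commutator of the spinor derivatives. -/
lemma covDeriv_comm (hT : S.SmoothField T i) (hx : x ∈ S.dom i) (A A' B B' : Fin 2)
    (C : Fin p → Fin 2) (C' : Fin q → Fin 2) (F : Fin 4 → Fin 4 → ℂ)
    (hF : ∀ a b, S.covAlong a (S.covAlong b T) i x C C' - S.covAlong b (S.covAlong a T) i x C C'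
      - ∑ c, ((eta c c * S.bracketCoeff i a b c x : ℝ) : ℂ) * S.covAlong c T i x C C' = - F a b) :
    S.covDeriv (S.covDeriv T) i x (Fin.cons A (Fin.cons B C)) (Fin.cons A' (Fin.cons B' C'))
      - S.covDeriv (S.covDeriv T) i x (Fin.cons B (Fin.cons A C)) (Fin.cons B' (Fin.cons A' C'))
      = - ∑ a, ∑ b, sigma a A A' * sigma b B B' * F a b := by
  rw [covDeriv_covDeriv hT hx, covDeriv_covDeriv hT hx]
  rw [Finset.sum_comm (f := fun a b => sigma a B B' * sigma b A A' * _)]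
  rw [← Finset.sum_sub_distrib, ← Finset.sum_neg_distrib]
  refine Finset.sum_congr rfl fun a _ => ?_
  rw [← Finset.sum_sub_distrib, ← Finset.sum_neg_distrib]
  refine Finset.sum_congr rfl fun b _ => ?_
  -- Vanishing torsion: the first-order terms of the two second derivatives differ by the derivative
  -- along `[e_a, e_b]`.
  have h1 : ∑ c, ((eta c c * S.bracketCoeff i a b c x : ℝ) : ℂ) * S.covAlong c T i x C C'
      = ∑ c, (S.conn i a c b x : ℂ) * S.covAlong c T i x C C'
        - ∑ c, (S.conn i b c a x : ℂ) * S.covAlong c T i x C C' := by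
    rw [← Finset.sum_sub_distrib]
    refine Finset.sum_congr rfl fun c _ => ?_
    rw [← conn_torsion]
    push_cast
    ring
  have h2 := hF a b
  rw [h1] at h2
  linear_combination (sigma a A A' * sigma b B B') * h2

end secondDerivative

section commutators

variable {S} {i : ι} {x : M}

lemma update_pair_zero {α : Type*} (C D E : α) : Function.update ![C, D] 0 E = ![E, D] := by
  funext k
  fin_cases k <;> rfl

lemma update_pair_one {α : Type*} (C D E : α) : Function.update ![C, D] 1 E = ![C, E] := by
  funext k
  fin_cases k <;> rfl

lemma update_singleton {α : Type*} (C E : α) : Function.update ![C] 0 E = ![E] := by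
  funext k
  fin_cases k
  rfl

lemma covAlong_two_zero (T : S.Field 2 0) (a : Fin 4) (C D : Fin 2) :
    S.covAlong a T i x ![C, D] ![]
      = S.frameDeriv i a (fun y => T i y ![C, D] ![]) x
        - ∑ E, S.spinConn i a E C x * T i x ![E, D] ![]
        - ∑ E, S.spinConn i a E D x * T i x ![C, E] ![] := by
  simp [covAlong, Fin.sum_univ_two, update_pair_zero, update_pair_one]
  ring

lemma covAlong_one_one (T : S.Field 1 1) (a : Fin 4) (C C' : Fin 2) :
    S.covAlong a T i x ![C] ![C']
      = S.frameDeriv i a (fun y => T i y ![C] ![C']) x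
        - ∑ E, S.spinConn i a E C x * T i x ![E] ![C']
        - ∑ E, star (S.spinConn i a E C' x) * T i x ![C] ![E] := by
  simp [covAlong, Fin.sum_univ_two, update_singleton]

/-- `f` is smooth near `x`, with the derivative `d` along `e_a`. -/
def HasD (S : SpinStructure g ι) (i : ι) (x : M) (a : Fin 4) (f : M → ℂ) (d : ℂ) : Prop :=
  S.SmoothOn i f ∧ S.frameDeriv i a f x = d

lemma SmoothOn.hasD {f : M → ℂ} (hf : S.SmoothOn i f) (x : M) (a : Fin 4) :
    S.HasD i x a f (S.frameDeriv i a f x) := ⟨hf, rfl⟩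

section HasD

variable {a : Fin 4} {f h : M → ℂ} {d e : ℂ}

lemma HasD.add (hf : S.HasD i x a f d) (hh : S.HasD i x a h e) (hx : x ∈ S.dom i) :
    S.HasD i x a (fun y => f y + h y) (d + e) :=
  ⟨hf.1.add hh.1, by rw [frameDeriv_add hf.1 hh.1 hx, hf.2, hh.2]⟩

lemma HasD.sub (hf : S.HasD i x a f d) (hh : S.HasD i x a h e) (hx : x ∈ S.dom i) :
    S.HasD i x a (fun y => f y - h y) (d - e) :=
  ⟨hf.1.sub hh.1, by rw [frameDeriv_sub hf.1 hh.1 hx, hf.2, hh.2]⟩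

lemma HasD.mul (hf : S.HasD i x a f d) (hh : S.HasD i x a h e) (hx : x ∈ S.dom i) :
    S.HasD i x a (fun y => f y * h y) (d * h x + f x * e) :=
  ⟨hf.1.mul hh.1, by rw [frameDeriv_mul hf.1 hh.1 hx, hf.2, hh.2]⟩

lemma HasD.const_mul (c : ℂ) (hf : S.HasD i x a f d) (hx : x ∈ S.dom i) :
    S.HasD i x a (fun y => c * f y) (c * d) :=
  ⟨(SmoothOn.const c).mul hf.1, by rw [frameDeriv_const_mul c hf.1 hx, hf.2]⟩

lemma HasD.star (hf : S.HasD i x a f d) (hx : x ∈ S.dom i) :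
    S.HasD i x a (fun y => star (f y)) (star d) :=
  ⟨hf.1.star, by rw [frameDeriv_star hf.1 hx, hf.2]⟩

lemma HasD.sum {K : Type*} {s : Finset K} {f : K → M → ℂ} {d : K → ℂ}
    (hf : ∀ k, S.HasD i x a (f k) (d k)) (hx : x ∈ S.dom i) :
    S.HasD i x a (fun y => ∑ k ∈ s, f k y) (∑ k ∈ s, d k) :=
  ⟨SmoothOn.sum fun k => (hf k).1, by
    rw [frameDeriv_sum _ (fun k => (hf k).1) hx]
    exact Finset.sum_congr rfl fun k _ => (hf k).2⟩

lemma HasD.congr (hf : S.HasD i x a f d) (hfh : ∀ y ∈ S.dom i, h y = f y) (hx : x ∈ S.dom i) :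
    S.HasD i x a h d :=
  ⟨hf.1.congr hfh, by rw [frameDeriv_congr hx hfh, hf.2]⟩

end HasD

/-- The curvature operator on spinors `T_{CD}`. -/
lemma covAlong_comm_two_zero {T : S.Field 2 0} (hT : S.SmoothField T i) (hx : x ∈ S.dom i)
    (a b : Fin 4) (C D : Fin 2) :
    S.covAlong a (S.covAlong b T) i x ![C, D] ![] - S.covAlong b (S.covAlong a T) i x ![C, D] ![]
      - ∑ c, ((eta c c * S.bracketCoeff i a b c x : ℝ) : ℂ) * S.covAlong c T i x ![C, D] ![]
      = - (∑ E, S.spinCurv i x a b E C * T i x ![E, D] ![]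
        + ∑ E, S.spinCurv i x a b E D * T i x ![C, E] ![]) := by
  have hγ := fun a E B => SmoothOn.spinConn S i a E B
  -- The right-hand side is left to unification: the product rules for `HasD` compute it.
  have hd : ∀ a b, S.frameDeriv i a (fun y => S.covAlong b T i y ![C, D] ![]) x = _ := fun a b =>
    (((((hT ![C, D] ![]).frameDeriv b).hasD x a).sub
      (HasD.sum (s := Finset.univ) (fun E => ((hγ b E C).hasD x a).mul
        ((hT ![E, D] ![]).hasD x a) hx) hx) hx).sub
      (HasD.sum (s := Finset.univ) (fun E => ((hγ b E D).hasD x a).mul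
        ((hT ![C, E] ![]).hasD x a) hx) hx) hx).congr
      (fun y _ => covAlong_two_zero T b C D) hx |>.2
  have hc := frameDeriv_comm (hT ![C, D] ![]) hx a b
  simp only [covAlong_two_zero (S.covAlong _ T), hd]
  simp only [← spinCurv_eq hx, covAlong_two_zero, Fin.sum_univ_two]
  simp only [Fin.sum_univ_four] at hc ⊢
  linear_combination hc

/-- The curvature operator on spinors `T_{CC'}`. -/
lemma covAlong_comm_one_one {T : S.Field 1 1} (hT : S.SmoothField T i) (hx : x ∈ S.dom i)
    (a b : Fin 4) (C C' : Fin 2) :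
    S.covAlong a (S.covAlong b T) i x ![C] ![C'] - S.covAlong b (S.covAlong a T) i x ![C] ![C']
      - ∑ c, ((eta c c * S.bracketCoeff i a b c x : ℝ) : ℂ) * S.covAlong c T i x ![C] ![C']
      = - (∑ E, S.spinCurv i x a b E C * T i x ![E] ![C']
        + ∑ E, star (S.spinCurv i x a b E C') * T i x ![C] ![E]) := by
  have hγ := fun a E B => SmoothOn.spinConn S i a E B
  have hd : ∀ a b, S.frameDeriv i a (fun y => S.covAlong b T i y ![C] ![C']) x = _ := fun a b =>
    (((((hT ![C] ![C']).frameDeriv b).hasD x a).sub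
      (HasD.sum (s := Finset.univ) (fun E => ((hγ b E C).hasD x a).mul
        ((hT ![E] ![C']).hasD x a) hx) hx) hx).sub
      (HasD.sum (s := Finset.univ) (fun E => (((hγ b E C').hasD x a).star hx).mul
        ((hT ![C] ![E]).hasD x a) hx) hx) hx).congr
      (fun y _ => covAlong_one_one T b C C') hx |>.2
  have hc := frameDeriv_comm (hT ![C] ![C']) hx a b
  have hr : ∀ r : ℝ, star (r : ℂ) = r := fun r => Complex.conj_ofReal r
  simp only [covAlong_one_one (S.covAlong _ T), hd]
  simp only [← spinCurv_eq hx, covAlong_one_one, Fin.sum_univ_two]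
  simp only [Fin.sum_univ_four, star_add, star_sub, star_mul', hr] at hc ⊢
  linear_combination hc

end commutators

end SpinStructure

/-! ### Algebraic consequences of the integrability conditions -/

lemma eps_values : eps 0 0 = 0 ∧ eps 0 1 = 1 ∧ eps 1 0 = -1 ∧ eps 1 1 = 0 := by
  simp [eps]

/-- The curvature operator `F_{AA'BB'}{}^E{}_D` built from the curvature spinors. -/
def curvOp (ψ : Fin 2 → Fin 2 → Fin 2 → Fin 2 → ℂ) (φ : Fin 2 → Fin 2 → Fin 2 → Fin 2 → ℂ)
    (Λ : ℂ) (A A' B B' E D : Fin 2) : ℂ :=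
  - ∑ C, eps E C * (eps A' B' * ψ A B C D + eps A B * φ C D A' B'
    + Λ * eps A' B' * (eps A C * eps B D + eps A D * eps B C))

/-- The conjugate curvature operator. -/
def curvOpConj (ψ : Fin 2 → Fin 2 → Fin 2 → Fin 2 → ℂ) (φ : Fin 2 → Fin 2 → Fin 2 → Fin 2 → ℂ)
    (Λ : ℂ) (A A' B B' E D : Fin 2) : ℂ :=
  - ∑ C, eps E C * (eps A B * star (ψ A' B' C D) + eps A' B' * φ A B C D
    + Λ * eps A B * (eps A' C * eps B' D + eps A' D * eps B' C))

section killing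

variable {κ : Fin 2 → Fin 2 → ℂ} {V ψ φ : Fin 2 → Fin 2 → Fin 2 → Fin 2 → ℂ} {Λ : ℂ}

variable (κ V ψ φ Λ) in
/-- The pointwise data of a Killing spinor `κ` with auxiliary vector `ξ`, where `V = ∇ ξ`, subject to
the integrability condition that comes from the commutator of covariant derivatives of `κ`. -/
structure IsKillingData : Prop where
  κ_symm : ∀ A B, κ A B = κ B A
  ψ_left : ∀ A B C D, ψ A B C D = ψ B A C D
  ψ_mid : ∀ A B C D, ψ A B C D = ψ A C B D
  ψ_right : ∀ A B C D, ψ A B C D = ψ A B D C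
  φ_left : ∀ A B C D, φ A B C D = φ B A C D
  φ_right : ∀ A B C D, φ A B C D = φ A B D C
  integrability : ∀ A A' B B' C D,
    - (1 / 3) * (eps B C * V A A' D B' + eps B D * V A A' C B')
      + 1 / 3 * (eps A C * V B B' D A' + eps A D * V B B' C A')
      + (∑ E, curvOp ψ φ Λ A A' B B' E C * κ E D + ∑ E, curvOp ψ φ Λ A A' B B' E D * κ C E) = 0

namespace IsKillingData

/-- The trace of the integrability condition over `A`, `B` is symmetric in the primed indices; there
only `φ` survives of the curvature. It misses the divergence of `ξ`, which the full trace shows to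
vanish. -/
lemma killing_eq (h : IsKillingData κ V ψ φ Λ) (C D C' D' : Fin 2) :
    V C C' D D' + V D D' C C' + 3 * ((∑ A, ∑ E, eps A E * κ D E * φ C A C' D')
      + ∑ A, ∑ E, eps A E * κ C E * φ D A C' D') = 0 := by
  obtain ⟨e1, e2, e3, e4⟩ := eps_values
  have q1 := h.κ_symm 1 0
  have p1 := h.φ_left 1 0
  have p2 := fun A B => h.φ_right A B 1 0
  have r1 := h.ψ_left 1 0
  have r2 := fun A => h.ψ_mid A 1 0
  have r3 := fun A B => h.ψ_right A B 1 0
  have hE := h.integrability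
  -- The first bracket is the contraction with `ε^{AB}`, the last one the full contraction with
  -- `ε^{A'B'} ε^{AC} ε^{BD}`. The resulting identity is a polynomial one only in components, hence
  -- `norm := skip` and the case split.
  linear_combination (norm := skip) (3 / 2) * (hE 0 C' 1 D' C D - hE 1 C' 0 D' C D)
    - (1 / 4) * eps C D * eps C' D' * (hE 0 0 0 1 1 1 - hE 0 1 0 0 1 1 - hE 0 0 1 1 1 0
      + hE 0 1 1 0 1 0 - hE 1 0 0 1 0 1 + hE 1 1 0 0 0 1 + hE 1 0 1 1 0 0 - hE 1 1 1 0 0 0)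
  fin_cases C <;> fin_cases D <;> fin_cases C' <;> fin_cases D' <;>
  · simp only [Fin.zero_eta, Fin.mk_one, Fin.isValue, curvOp, Fin.sum_univ_two, e1, e2, e3, e4, q1,
      p1, p2, r1, r2, r3]
    ring

/-- The left side is `□κ` with `∇∇κ` replaced by `∇ξ`, that is, a multiple of the self-dual curl of
`ξ`. The same curl is what remains of `∇ξ` when the integrability condition is contracted over `A'`,
`B'` and over one commutator index with one index of `κ`, then symmetrised. -/
lemma box_eq (h : IsKillingData κ V ψ φ Λ) (B C : Fin 2) :
    ∑ A, ∑ G, ∑ A', ∑ G', eps A G * eps A' G' *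
        (- (1 / 3) * (eps G B * V A A' C G' + eps G C * V A A' B G'))
      = - 4 * Λ * κ B C + ∑ A, ∑ E, ∑ D, ∑ F, eps A E * eps D F * κ E F * ψ B C A D := by
  obtain ⟨e1, e2, e3, e4⟩ := eps_values
  have q1 := h.κ_symm 1 0
  have p1 := h.φ_left 1 0
  have p2 := fun A B => h.φ_right A B 1 0
  have r1 := h.ψ_left 1 0
  have r2 := fun A => h.ψ_mid A 1 0
  have r3 := fun A B => h.ψ_right A B 1 0
  have hE := h.integrability
  linear_combination (norm := skip) - (1 / 4) * (hE 0 0 B 1 1 C - hE 0 1 B 0 1 C - hE 1 0 B 1 0 C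
    + hE 1 1 B 0 0 C + hE 0 0 C 1 1 B - hE 0 1 C 0 1 B - hE 1 0 C 1 0 B + hE 1 1 C 0 0 B)
  fin_cases B <;> fin_cases C <;>
  · simp only [Fin.zero_eta, Fin.mk_one, Fin.isValue, curvOp, Fin.sum_univ_two, e1, e2, e3, e4, q1,
      p1, p2, r1, r2, r3]
    ring

/-- After contraction over the primed indices every term in `∇ξ` and `Λ` carries an `ε` with
unprimed indices, and the `φ` terms drop out; total symmetrisation leaves `κψ` alone. The six
differences in the combination are the six choices of two indices for the commutator. -/
lemma kappaPsi_eq (h : IsKillingData κ V ψ φ Λ) (D A B C : Fin 2) :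
    (∑ F, ∑ G, eps F G * κ D G * ψ A B C F) + (∑ F, ∑ G, eps F G * κ A G * ψ D B C F)
      + (∑ F, ∑ G, eps F G * κ B G * ψ D A C F) + (∑ F, ∑ G, eps F G * κ C G * ψ D A B F) = 0 := by
  obtain ⟨e1, e2, e3, e4⟩ := eps_values
  have q1 := h.κ_symm 1 0
  have p1 := h.φ_left 1 0
  have p2 := fun A B => h.φ_right A B 1 0
  have r1 := h.ψ_left 1 0
  have r2 := fun A => h.ψ_mid A 1 0
  have r3 := fun A B => h.ψ_right A B 1 0
  have hE := h.integrability
  linear_combination (norm := skip) (1 / 6) * (hE A 0 B 1 C D - hE A 1 B 0 C D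
    + hE A 0 C 1 B D - hE A 1 C 0 B D + hE A 0 D 1 B C - hE A 1 D 0 B C
    + hE B 0 C 1 A D - hE B 1 C 0 A D + hE B 0 D 1 A C - hE B 1 D 0 A C
    + hE C 0 D 1 A B - hE C 1 D 0 A B)
  fin_cases D <;> fin_cases A <;> fin_cases B <;> fin_cases C <;>
  · simp only [Fin.zero_eta, Fin.mk_one, Fin.isValue, curvOp, Fin.sum_univ_two, e1, e2, e3, e4, q1,
      p1, p2, r1, r2, r3]
    ring

end IsKillingData

end killing

/-! ### Algebra of the wave equation for `ξ` and of the conformal Killing vector -/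

section

variable {κ ξ L d : Fin 2 → Fin 2 → ℂ} {V ψ φ Y Z : Fin 2 → Fin 2 → Fin 2 → Fin 2 → ℂ} {Λ Ξ s : ℂ}
  {W N : Fin 2 → Fin 2 → Fin 2 → Fin 2 → Fin 2 → Fin 2 → ℂ}

/-- The derivative of a Killing spinor in terms of the auxiliary vector. -/
def killingDeriv (ξ : Fin 2 → Fin 2 → ℂ) (A A' B C : Fin 2) : ℂ :=
  - (1 / 3) * (eps A B * ξ C A' + eps A C * ξ B A')

/-- The wave equation of the auxiliary vector, from the derivative `W = ∇ ∇ ξ` of the first order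
equation, the commutator of covariant derivatives on `ξ`, and the definition of the Cotton spinor in
terms of `N = ∇ Φ` and `L = ∇ Λ`. -/
lemma box_aux_eq (hκ : ∀ A B, κ A B = κ B A)
    (hψ₁ : ∀ A B C D, ψ A B C D = ψ B A C D)
    (hψ₂ : ∀ A B C D, ψ A B C D = ψ A C B D) (hψ₃ : ∀ A B C D, ψ A B C D = ψ A B D C)
    (hφ₁ : ∀ A B C D, φ A B C D = φ B A C D) (hφ₂ : ∀ A B C D, φ A B C D = φ A B D C)
    (hN₁ : ∀ A A' B C B' C', N A A' B C B' C' = N A A' C B B' C')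
    (hN₂ : ∀ A A' B C B' C', N A A' B C B' C' = N A A' B C C' B')
    (hY₁ : ∀ A B C C', Y A B C C' = Y B A C C') (hY₂ : ∀ A B C C', Y A B C C' = Y A C B C')
    (hS : ∀ A A' B B' C C', W A A' B B' C C' + W A A' C C' B B'
      + 3 * ((∑ D, ∑ G, eps D G * (killingDeriv ξ A A' B G * φ C D B' C'
          + κ B G * N A A' C D B' C'))
        + ∑ D, ∑ G, eps D G * (killingDeriv ξ A A' C G * φ B D B' C'
          + κ C G * N A A' B D B' C')) = 0)
    (hC : ∀ A A' B B' C C', W A A' B B' C C' - W B B' A A' C C'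
      + (∑ E, curvOp ψ φ Λ A A' B B' E C * ξ E C'
        + ∑ E, curvOpConj ψ φ Λ A A' B B' E C' * ξ C E) = 0)
    (hY : ∀ A B C C', - Y A B C C' + (∑ A', ∑ D', eps A' D' * N A A' B C C' D')
      + eps B C * L A C' + (∑ A', ∑ D', eps A' D' * N B A' A C C' D') + eps A C * L B C' = 0)
    (A A' : Fin 2) :
    ∑ B, ∑ C, ∑ B', ∑ C', eps B C * eps B' C' * W B B' C C' A A'
      = - 6 * ξ A A' * Λ
        - 2 * (∑ B, ∑ D, ∑ B', ∑ D', eps B D * eps B' D' * ξ D D' * φ A B A' B')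
        - (3 / 2) * (∑ B, ∑ D, ∑ C, ∑ E, eps B D * eps C E * κ D E * Y A B C A')
        - 12 * ∑ B, ∑ D, eps B D * κ A B * L D A' := by
  obtain ⟨e1, e2, e3, e4⟩ := eps_values
  have q1 := hκ 1 0
  have p1 := hφ₁ 1 0
  have p2 := fun A B => hφ₂ A B 1 0
  have r1 := hψ₁ 1 0
  have r2 := fun A => hψ₂ A 1 0
  have r3 := fun A B => hψ₃ A B 1 0
  have n1 := fun A A' => hN₁ A A' 1 0
  have n2 := fun A A' B C => hN₂ A A' B C 1 0
  have y1 := hY₁ 1 0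
  have y2 := fun A => hY₂ A 1 0
  -- With `b`, `c` the vector indices of `hS`: its contraction over the derivative and `b`; half the
  -- gradient of its trace, which is `∇_a (∇^b ξ_b)` because the `κφ` term has no trace; the
  -- commutator exchanging `∇^b` and `∇_a` on `ξ_b`; and two contractions of the Cotton equation
  -- with `κ^{BC}`. Since antisymmetric spinor pairs are pure trace, all `κ∇φ` terms reduce to
  -- `κ^{BC} ∇_A φ_{BC}` and `κ^{BC} ∇_B φ_{AC}`; the weights `3` and `-9/2` cancel both.
  linear_combination (norm := skip)
    (hS 0 0 1 1 A A' - hS 0 1 1 0 A A' - hS 1 0 0 1 A A' + hS 1 1 0 0 A A')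
    - (1 / 2) * (hS A A' 0 0 1 1 - hS A A' 0 1 1 0 - hS A A' 1 0 0 1 + hS A A' 1 1 0 0)
    - (hC 0 0 A A' 1 1 - hC 0 1 A A' 1 0 - hC 1 0 A A' 0 1 + hC 1 1 A A' 0 0)
    + 3 * (κ 1 1 * hY A 0 0 A' - κ 1 0 * hY A 0 1 A' - κ 0 1 * hY A 1 0 A' + κ 0 0 * hY A 1 1 A')
    - (9 / 2) * (κ 1 1 * hY 0 0 A A' - κ 1 0 * hY 0 1 A A' - κ 0 1 * hY 1 0 A A'
      + κ 0 0 * hY 1 1 A A')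
  fin_cases A <;> fin_cases A' <;>
  · simp only [Fin.zero_eta, Fin.mk_one, Fin.isValue, curvOp, curvOpConj, killingDeriv,
      Fin.sum_univ_two, e1, e2, e3, e4, q1, p1, p2, r1, r2, r3, n1, n2, y1, y2]
    ring

/-- The derivative `∇_{AA'} X_{BB'}` of `X = Ξ ξ - 3 κ ∇ Ξ`, where `V = ∇ ξ`, `d = ∇ Ξ` and
`Z = ∇ ∇ Ξ`. -/
def confKillingDeriv (κ ξ d : Fin 2 → Fin 2 → ℂ) (V Z : Fin 2 → Fin 2 → Fin 2 → Fin 2 → ℂ) (Ξ : ℂ)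
    (A A' B B' : Fin 2) : ℂ :=
  d A A' * ξ B B' + Ξ * V A A' B B' - 3 * ∑ Q, ∑ C, eps Q C *
    (killingDeriv ξ A A' B Q * d C B' + κ B Q * Z A A' C B')

/-- The trace `∇^{AA'} X_{AA'}`. -/
def spinorTrace (T : Fin 2 → Fin 2 → Fin 2 → Fin 2 → ℂ) : ℂ :=
  ∑ A, ∑ B, ∑ A', ∑ B', eps A B * eps A' B' * T A A' B B'

/-- By `killing_eq`, `Ξ` times the symmetrised `∇ξ` cancels the `φ` part of `κ ∇∇Ξ`. The `Λ` and `s`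
parts are antisymmetric under exchange of the pairs, and the factor `3` in `X` makes the terms in
`d` and `ξ` pure trace after symmetrisation. -/
lemma IsKillingData.confKilling_eq (h : IsKillingData κ V ψ φ Λ)
    (hZ : ∀ A A' B B', Z A A' B B' = Ξ * φ B A B' A' - Ξ * Λ * eps B A * eps B' A'
      + s * eps B A * eps B' A') (A A' B B' : Fin 2) :
    confKillingDeriv κ ξ d V Z Ξ A A' B B' + confKillingDeriv κ ξ d V Z Ξ B B' A A'
      = 1 / 2 * spinorTrace (confKillingDeriv κ ξ d V Z Ξ) * (eps A B * eps A' B') := by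
  obtain ⟨e1, e2, e3, e4⟩ := eps_values
  have q1 := h.κ_symm 1 0
  have p1 := h.φ_left 1 0
  have p2 := fun A B => h.φ_right A B 1 0
  have hE := h.killing_eq
  linear_combination (norm := skip) Ξ * hE A B A' B' - (1 / 4) * Ξ * eps A B * eps A' B' *
    (hE 0 1 0 1 - hE 0 1 1 0 - hE 1 0 0 1 + hE 1 0 1 0)
  fin_cases A <;> fin_cases A' <;> fin_cases B <;> fin_cases B' <;>
  · simp only [Fin.zero_eta, Fin.mk_one, Fin.isValue, confKillingDeriv, killingDeriv, spinorTrace, hZ,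
      Fin.sum_univ_two, e1, e2, e3, e4, q1, p1, p2]
    ring

/-- The term with two gradients drops out because `d_{AA'} d_B{}^{A'}` is antisymmetric and `κ`
symmetric. The two sides then differ by a multiple of `Ξ² ∇^a ξ_a`; the trace of `killing_eq` is
twice this divergence, whence `1/8`. -/
lemma IsKillingData.confKilling_grad_eq (h : IsKillingData κ V ψ φ Λ)
    (hZ : ∀ A A' B B', Z A A' B B' = Ξ * φ B A B' A' - Ξ * Λ * eps B A * eps B' A'
      + s * eps B A * eps B' A') :
    ∑ A, ∑ B, ∑ A', ∑ B', eps A B * eps A' B' *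
        ((Ξ * ξ A A' - 3 * ∑ Q, ∑ C, eps Q C * κ A Q * d C A') * d B B')
      = 1 / 4 * Ξ * spinorTrace (confKillingDeriv κ ξ d V Z Ξ) := by
  obtain ⟨e1, e2, e3, e4⟩ := eps_values
  have q1 := h.κ_symm 1 0
  have p1 := h.φ_left 1 0
  have p2 := fun A B => h.φ_right A B 1 0
  have hE := h.killing_eq
  linear_combination (norm := skip) - (1 / 8) * Ξ * Ξ *
    (hE 0 1 0 1 - hE 0 1 1 0 - hE 1 0 0 1 + hE 1 0 1 0)
  simp only [confKillingDeriv, killingDeriv, spinorTrace, hZ,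
    Fin.sum_univ_two, e1, e2, e3, e4, q1, p1, p2]
  ring

end

/-! ### Explicit symmetrisation -/

/-- A permutation is determined by the image `p` of `0` and a permutation of the rest; this allows
symmetrisations to be expanded by recursion. -/
lemma sum_perm_fin_succ {n : ℕ} {α : Type*} (f : (Fin (n + 1) → α) → ℂ) (B : Fin (n + 1) → α) :
    ∑ τ : Equiv.Perm (Fin (n + 1)), f (fun k => B (τ k))
      = ∑ p, ∑ τ : Equiv.Perm (Fin n),
          f (Fin.cons (B p) (fun k => (fun l : Fin n => B (Equiv.swap 0 p l.succ)) (τ k))) := by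
  rw [← Equiv.sum_comp Equiv.Perm.decomposeFin.symm, Fintype.sum_prod_type]
  refine Finset.sum_congr rfl fun p _ => Finset.sum_congr rfl fun τ _ => congrArg f ?_
  funext k
  refine Fin.cases ?_ (fun k => ?_) k
  · simp
  · simp

lemma sum_perm_fin_two {α : Type*} (f : (Fin 2 → α) → ℂ) (A B : α) :
    ∑ τ : Equiv.Perm (Fin 2), f (fun k => ![A, B] (τ k)) = f ![A, B] + f ![B, A] := by
  refine (sum_perm_fin_succ f ![A, B]).trans ((Fin.sum_univ_two _).trans ?_)
  simp only [Fintype.sum_unique]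
  congr 2
  all_goals
    funext k
    fin_cases k <;> rfl

lemma sum_perm_fin_three {α : Type*} (f : (Fin 3 → α) → ℂ) (A B C : α) :
    ∑ τ : Equiv.Perm (Fin 3), f (fun k => ![A, B, C] (τ k))
      = f ![A, B, C] + f ![A, C, B] + f ![B, A, C] + f ![B, C, A] + f ![C, B, A] + f ![C, A, B] := by
  have h : ∀ p : Fin 3, ∑ τ : Equiv.Perm (Fin 2),
      f (Fin.cons (![A, B, C] p) (fun k => ![A, B, C] (Equiv.swap 0 p (τ k).succ)))
      = f ![![A, B, C] p, ![A, B, C] (Equiv.swap 0 p 1), ![A, B, C] (Equiv.swap 0 p 2)]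
        + f ![![A, B, C] p, ![A, B, C] (Equiv.swap 0 p 2), ![A, B, C] (Equiv.swap 0 p 1)] := by
    intro p
    have e : ![![A, B, C] (Equiv.swap 0 p 1), ![A, B, C] (Equiv.swap 0 p 2)]
        = fun l : Fin 2 => ![A, B, C] (Equiv.swap 0 p l.succ) := by
      funext l
      fin_cases l <;> rfl
    refine Eq.trans ?_ (sum_perm_fin_two (fun v => f (Fin.cons (![A, B, C] p) v))
      (![A, B, C] (Equiv.swap 0 p 1)) (![A, B, C] (Equiv.swap 0 p 2)))
    rw [e]
  refine (sum_perm_fin_succ f ![A, B, C]).trans ((Fin.sum_univ_three _).trans ?_)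
  simp only [h, ← add_assoc]
  rfl

/-- Given symmetry in the last three slots, only the entry in the first slot matters, and each
choice occurs `3! = 6` times. -/
lemma sum_perm_fin_four {α : Type*} (f : (Fin 4 → α) → ℂ) (A B C D : α)
    (h₁ : ∀ A B C D, f ![A, B, C, D] = f ![A, C, B, D])
    (h₂ : ∀ A B C D, f ![A, B, C, D] = f ![A, B, D, C]) :
    ∑ τ : Equiv.Perm (Fin 4), f (fun k => ![A, B, C, D] (τ k))
      = 6 * (f ![A, B, C, D] + f ![B, A, C, D] + f ![C, A, B, D] + f ![D, A, B, C]) := by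
  have h₃ : ∀ A B C D, ∑ τ : Equiv.Perm (Fin 3), f (Fin.cons A (fun k => ![B, C, D] (τ k)))
      = 6 * f ![A, B, C, D] := fun A B C D => by
    rw [sum_perm_fin_three (fun v => f (Fin.cons A v))]
    change f ![A, B, C, D] + f ![A, B, D, C] + f ![A, C, B, D] + f ![A, C, D, B] + f ![A, D, C, B]
      + f ![A, D, B, C] = _
    rw [h₂ A C D B, h₁ A C B D, h₂ A B D C, h₁ A D C B, h₂ A C D B, h₁ A C B D, h₁ A D B C,
      h₂ A B D C]
    ring
  have h : ∀ p : Fin 4, ∑ τ : Equiv.Perm (Fin 3),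
      f (Fin.cons (![A, B, C, D] p) (fun k => ![A, B, C, D] (Equiv.swap 0 p (τ k).succ)))
      = 6 * f ![![A, B, C, D] p, ![A, B, C, D] (Equiv.swap 0 p 1), ![A, B, C, D] (Equiv.swap 0 p 2),
          ![A, B, C, D] (Equiv.swap 0 p 3)] := by
    intro p
    have e : ![![A, B, C, D] (Equiv.swap 0 p 1), ![A, B, C, D] (Equiv.swap 0 p 2),
        ![A, B, C, D] (Equiv.swap 0 p 3)]
        = fun l : Fin 3 => ![A, B, C, D] (Equiv.swap 0 p l.succ) := by
      funext l
      fin_cases l <;> rfl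
    rw [← h₃, e]
  refine (sum_perm_fin_succ f ![A, B, C, D]).trans ((Fin.sum_univ_four _).trans ?_)
  simp only [h]
  change 6 * f ![A, B, C, D] + 6 * f ![B, A, C, D] + 6 * f ![C, B, A, D] + 6 * f ![D, B, C, A] = _
  rw [h₁ C B A D, h₂ D B C A, h₁ D B A C]
  ring

namespace SpinStructure

variable {M : Type*} [TopologicalSpace M] [ChartedSpace E4 M] [IsManifold (𝓡 4) ∞ M]
  {g : LorentzianMetric M} {ι : Type*} {S : SpinStructure g ι} {i : ι} {x : M}

/-! ### Covariant derivatives of a Killing spinor -/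

lemma IsSpinorField.smoothField {p q : ℕ} {T : S.Field p q} (hT : S.IsSpinorField T) (i : ι) :
    S.SmoothField T i := hT.smooth i

lemma covDeriv_symm {κ : S.Field 2 0}
    (hκ : ∀ x ∈ S.dom i, ∀ A B, κ i x ![A, B] ![] = κ i x ![B, A] ![]) (hx : x ∈ S.dom i)
    (A A' B C : Fin 2) :
    S.covDeriv κ i x ![A, B, C] ![A'] = S.covDeriv κ i x ![A, C, B] ![A'] := by
  refine (covDeriv_cons κ i x A A' ![B, C] ![]).trans (Eq.trans ?_
    (covDeriv_cons κ i x A A' ![C, B] ![]).symm)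
  refine Finset.sum_congr rfl fun a _ => ?_
  rw [covAlong_two_zero, covAlong_two_zero, frameDeriv_congr hx (fun y hy => hκ y hy B C)]
  simp only [fun E => hκ x hx E C, fun E => hκ x hx B E]
  ring

lemma aux_eq (κ : S.Field 2 0) (i : ι) (x : M) (A A' : Fin 2) :
    S.aux κ i x ![A] ![A']
      = S.covDeriv κ i x ![1, A, 0] ![A'] - S.covDeriv κ i x ![0, A, 1] ![A'] := by
  obtain ⟨e1, e2, e3, e4⟩ := eps_values
  simp only [aux, Fin.sum_univ_two, e1, e2, e3, e4, Matrix.cons_val_zero]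
  ring

/-- A spinor symmetric in `B`, `C` is its totally symmetric part, here zero, plus a trace part.
Contracting `ε_{AB} ξ_C + ε_{AC} ξ_B` yields three copies of `ξ`, which explains the factor `1/3`.
-/
lemma IsKillingSpinor.covDeriv_eq {κ : S.Field 2 0} (hκ : S.IsKillingSpinor κ) (hx : x ∈ S.dom i)
    (A A' B C : Fin 2) :
    S.covDeriv κ i x ![A, B, C] ![A']
      = killingDeriv (fun A A' => S.aux κ i x ![A] ![A']) A A' B C := by
  obtain ⟨e1, e2, e3, e4⟩ := eps_values
  have hH := hκ.H_eq i x hx ![A, B, C] ![A']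
  have hs := fun A => covDeriv_symm (hκ.symm i) hx A A' 1 0
  rw [H, symmetrize, sum_perm_fin_three (fun v => S.covDeriv κ i x v ![A'])] at hH
  simp only [Nat.factorial] at hH
  simp only [killingDeriv, aux_eq]
  revert hH
  fin_cases A <;> fin_cases B <;> fin_cases C <;>
  · simp only [Fin.zero_eta, Fin.mk_one, Fin.isValue, e1, e2, e3, e4, hs]
    intro hH
    norm_num at hH
    linear_combination (1 / 6) * hH

lemma update_triple_zero {α : Type*} (B C D E : α) :
    Function.update ![B, C, D] 0 E = ![E, C, D] := by
  funext k
  fin_cases k <;> rfl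

lemma update_triple_one {α : Type*} (B C D E : α) :
    Function.update ![B, C, D] 1 E = ![B, E, D] := by
  funext k
  fin_cases k <;> rfl

lemma update_triple_two {α : Type*} (B C D E : α) :
    Function.update ![B, C, D] 2 E = ![B, C, E] := by
  funext k
  fin_cases k <;> rfl

lemma covAlong_three_one (T : S.Field 3 1) (a : Fin 4) (B C D B' : Fin 2) :
    S.covAlong a T i x ![B, C, D] ![B']
      = S.frameDeriv i a (fun y => T i y ![B, C, D] ![B']) x
        - ∑ E, S.spinConn i a E B x * T i x ![E, C, D] ![B']
        - ∑ E, S.spinConn i a E C x * T i x ![B, E, D] ![B']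
        - ∑ E, S.spinConn i a E D x * T i x ![B, C, E] ![B']
        - ∑ E, star (S.spinConn i a E B' x) * T i x ![B, C, D] ![E] := by
  simp only [covAlong, Fin.sum_univ_three, Fin.sum_univ_one, Matrix.cons_val_zero,
    Matrix.cons_val_one, Matrix.cons_val, update_triple_zero, update_triple_one, update_triple_two,
    update_singleton]
  ring

lemma SmoothField.aux {κ : S.Field 2 0} (hκ : S.SmoothField κ i) :
    S.SmoothField (S.aux κ) i := fun _ _ =>
  SmoothOn.sum fun B => SmoothOn.sum fun C => (SmoothOn.const (eps B C)).mul (hκ.covDeriv _ _)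

/-- The derivative of `∇_{BB'} κ_{CD} = - (1/3) (ε_{BC} ξ_{DB'} + ε_{BD} ξ_{CB'})`. -/
lemma IsKillingSpinor.covDeriv_covDeriv_eq {κ : S.Field 2 0} (hκ : S.IsKillingSpinor κ)
    (hx : x ∈ S.dom i) (A A' B B' C D : Fin 2) :
    S.covDeriv (S.covDeriv κ) i x ![A, B, C, D] ![A', B']
      = - (1 / 3) * (eps B C * S.covDeriv (S.aux κ) i x ![A, D] ![A', B']
        + eps B D * S.covDeriv (S.aux κ) i x ![A, C] ![A', B']) := by
  obtain ⟨e1, e2, e3, e4⟩ := eps_values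
  have hs := (hκ.isSpinorField.smoothField i).aux
  have key : ∀ a, S.covAlong a (S.covDeriv κ) i x ![B, C, D] ![B']
      = - (1 / 3) * (eps B C * S.covAlong a (S.aux κ) i x ![D] ![B']
        + eps B D * S.covAlong a (S.aux κ) i x ![C] ![B']) := by
    intro a
    have hd := ((((hs ![D] ![B']).hasD x a).const_mul (eps B C) hx).add
      (((hs ![C] ![B']).hasD x a).const_mul (eps B D) hx) hx).const_mul (- (1 / 3)) hx
    have hd' := (hd.congr (fun y hy => hκ.covDeriv_eq hy B B' C D) hx).2
    rw [covAlong_three_one, hd', covAlong_one_one, covAlong_one_one]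
    simp only [hκ.covDeriv_eq hx, killingDeriv, Fin.sum_univ_two]
    -- Trace-freeness absorbs the connection terms acting on the indices of `ε`.
    have ht := spinConn_trace (S := S) i a x
    fin_cases B <;> fin_cases C <;> fin_cases D <;>
    · simp only [Fin.zero_eta, Fin.mk_one, Fin.isValue, e1, e2, e3, e4, ht]
      ring
  refine (covDeriv_cons (S.covDeriv κ) i x A A' ![B, C, D] ![B']).trans ?_
  simp only [key]
  have h1 := fun D => covDeriv_cons (S.aux κ) i x A A' ![D] ![B']
  change _ = - (1 / 3) * (eps B C * S.covDeriv (S.aux κ) i x (Fin.cons A ![D]) (Fin.cons A' ![B'])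
    + eps B D * S.covDeriv (S.aux κ) i x (Fin.cons A ![C]) (Fin.cons A' ![B']))
  simp only [h1, Fin.sum_univ_four]
  ring

end SpinStructure

lemma star_eps (A B : Fin 2) : star (eps A B) = eps A B := by
  fin_cases A <;> fin_cases B <;> simp [eps]

namespace SpinStructure

variable {M : Type*} [TopologicalSpace M] [ChartedSpace E4 M] [IsManifold (𝓡 4) ∞ M]
  {g : LorentzianMetric M} {ι : Type*} {S : SpinStructure g ι} {i : ι} {x : M}

/-! ### The curvature operator in terms of the curvature spinors -/

section curvature

variable (S i x)

/-- The components of the Weyl spinor at a point. -/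
def psiAt (A B C D : Fin 2) : ℂ := S.Psi i x ![A, B, C, D] ![]

/-- The components of the Ricci spinor at a point. -/
def phiAt (A B A' B' : Fin 2) : ℂ := S.Phi i x ![A, B] ![A', B']

/-- The scalar `Λ` at a point. -/
def lamAt : ℂ := S.Lam i x ![] ![]

variable {S i x}

lemma phiAt_symm_left (hx : x ∈ S.dom i) (A B A' B' : Fin 2) :
    S.phiAt i x A B A' B' = S.phiAt i x B A A' B' := by
  rw [phiAt, phiAt, Phi_eq, Phi_eq]
  exact (isCurvatureTensor_lowRiemann hx).phiOf_symm_left A B A' B'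

lemma phiAt_symm_right (hx : x ∈ S.dom i) (A B A' B' : Fin 2) :
    S.phiAt i x A B A' B' = S.phiAt i x A B B' A' := by
  rw [phiAt, phiAt, Phi_eq, Phi_eq]
  exact (isCurvatureTensor_lowRiemann hx).phiOf_symm_right A B A' B'

lemma star_phiAt (A B A' B' : Fin 2) : star (S.phiAt i x A B A' B') = S.phiAt i x A' B' A B := by
  rw [phiAt, phiAt, Phi_eq, Phi_eq]
  exact star_phiOf A B A' B'

lemma psiAt_symm_left (hx : x ∈ S.dom i) (A B C D : Fin 2) :
    S.psiAt i x A B C D = S.psiAt i x B A C D := by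
  rw [psiAt, psiAt, Psi_eq, Psi_eq]
  exact congrArg _ ((isCurvatureTensor_lowRiemann hx).sdSdPart_symm_left A B C D)

lemma psiAt_symm_mid (hx : x ∈ S.dom i) (A B C D : Fin 2) :
    S.psiAt i x A B C D = S.psiAt i x A C B D := by
  rw [psiAt, psiAt, Psi_eq, Psi_eq]
  exact congrArg _ ((isCurvatureTensor_lowRiemann hx).sdSdPart_weylOf_symm A B C D)

lemma psiAt_symm_right (hx : x ∈ S.dom i) (A B C D : Fin 2) :
    S.psiAt i x A B C D = S.psiAt i x A B D C := by
  rw [psiAt, psiAt, Psi_eq, Psi_eq]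
  exact congrArg _ ((isCurvatureTensor_lowRiemann hx).sdSdPart_symm_right A B C D)

lemma sum_sigma_spinCurv (hx : x ∈ S.dom i) (A A' B B' E D : Fin 2) :
    ∑ a, ∑ b, sigma a A A' * sigma b B B' * S.spinCurv i x a b E D
      = curvOp (S.psiAt i x) (S.phiAt i x) (S.lamAt i x) A A' B B' E D := by
  simp only [spinCurv, curvOp, psiAt, phiAt, lamAt, Psi_eq, Phi_eq, Lam_eq]
  exact (isCurvatureTensor_lowRiemann hx).sum_sigma_spinLift A A' B B' E D

/-- The complex conjugate of `sum_sigma_spinCurv` with primed and unprimed indices exchanged: `σ`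
and `Φ` are Hermitian, `Λ` and `ε` real. -/
lemma sum_sigma_star_spinCurv (hx : x ∈ S.dom i) (A A' B B' E D : Fin 2) :
    ∑ a, ∑ b, sigma a A A' * sigma b B B' * star (S.spinCurv i x a b E D)
      = curvOpConj (S.psiAt i x) (S.phiAt i x) (S.lamAt i x) A A' B B' E D := by
  have hr : star (S.lamAt i x) = S.lamAt i x := Complex.conj_ofReal _
  have h := congrArg star (sum_sigma_spinCurv hx A' A B' B E D)
  simp only [curvOp, star_sum, star_mul', star_neg, star_add, star_sigma, star_eps, star_phiAt, hr]
    at h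
  exact h

/-- The commutator of covariant derivatives on a spinor `T_{CD}`. -/
lemma covDeriv_comm_two_zero {T : S.Field 2 0} (hT : S.SmoothField T i) (hx : x ∈ S.dom i)
    (A A' B B' C D : Fin 2) :
    S.covDeriv (S.covDeriv T) i x ![A, B, C, D] ![A', B']
      - S.covDeriv (S.covDeriv T) i x ![B, A, C, D] ![B', A']
      + (∑ E, curvOp (S.psiAt i x) (S.phiAt i x) (S.lamAt i x) A A' B B' E C * T i x ![E, D] ![]
        + ∑ E, curvOp (S.psiAt i x) (S.phiAt i x) (S.lamAt i x) A A' B B' E D * T i x ![C, E] ![])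
      = 0 := by
  have h := covDeriv_comm hT hx A A' B B' ![C, D] ![] _
    (fun a b => covAlong_comm_two_zero hT hx a b C D)
  simp only [← sum_sigma_spinCurv hx]
  change S.covDeriv (S.covDeriv T) i x ![A, B, C, D] ![A', B']
      - S.covDeriv (S.covDeriv T) i x ![B, A, C, D] ![B', A'] = _ at h
  rw [h]
  simp only [Fin.sum_univ_four, Fin.sum_univ_two]
  ring

/-- The commutator of covariant derivatives on a spinor `T_{CC'}`. -/
lemma covDeriv_comm_one_one {T : S.Field 1 1} (hT : S.SmoothField T i) (hx : x ∈ S.dom i)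
    (A A' B B' C C' : Fin 2) :
    S.covDeriv (S.covDeriv T) i x ![A, B, C] ![A', B', C']
      - S.covDeriv (S.covDeriv T) i x ![B, A, C] ![B', A', C']
      + (∑ E, curvOp (S.psiAt i x) (S.phiAt i x) (S.lamAt i x) A A' B B' E C * T i x ![E] ![C']
        + ∑ E, curvOpConj (S.psiAt i x) (S.phiAt i x) (S.lamAt i x) A A' B B' E C'
            * T i x ![C] ![E]) = 0 := by
  have h := covDeriv_comm hT hx A A' B B' ![C] ![C'] _
    (fun a b => covAlong_comm_one_one hT hx a b C C')
  simp only [← sum_sigma_spinCurv hx, ← sum_sigma_star_spinCurv hx]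
  change S.covDeriv (S.covDeriv T) i x ![A, B, C] ![A', B', C']
      - S.covDeriv (S.covDeriv T) i x ![B, A, C] ![B', A', C'] = _ at h
  rw [h]
  simp only [Fin.sum_univ_four, Fin.sum_univ_two]
  ring

end curvature

/-! ### First consequences of the Killing spinor equation -/

section killing

variable {κ : S.Field 2 0}

/-- The passage from analysis to algebra: in the Ricci identity for `κ` both second derivatives are
replaced by `∇ξ`. -/
lemma IsKillingSpinor.isKillingData (hκ : S.IsKillingSpinor κ) (hx : x ∈ S.dom i) :
    IsKillingData (fun A B => κ i x ![A, B] ![])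
      (fun A A' B B' => S.covDeriv (S.aux κ) i x ![A, B] ![A', B'])
      (S.psiAt i x) (S.phiAt i x) (S.lamAt i x) where
  κ_symm := hκ.symm i x hx
  ψ_left := psiAt_symm_left hx
  ψ_mid := psiAt_symm_mid hx
  ψ_right := psiAt_symm_right hx
  φ_left := phiAt_symm_left hx
  φ_right := phiAt_symm_right hx
  integrability A A' B B' C D := by
    have h := covDeriv_comm_two_zero (hκ.isSpinorField.smoothField i) hx A A' B B' C D
    rw [hκ.covDeriv_covDeriv_eq hx, hκ.covDeriv_covDeriv_eq hx] at h
    linear_combination h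

/-- `∇_{CC'} ξ_{DD'} + ∇_{DD'} ξ_{CC'} + 6 κ_{(D}{}^A Φ_{C)AC'D'} = 0`. -/
lemma IsKillingSpinor.covDeriv_aux_symm (hκ : S.IsKillingSpinor κ) (hx : x ∈ S.dom i)
    (C D C' D' : Fin 2) :
    S.covDeriv (S.aux κ) i x ![C, D] ![C', D'] + S.covDeriv (S.aux κ) i x ![D, C] ![D', C']
      + 6 * S.symmetrize (S.kappaPhi κ) i x ![D, C] ![C', D'] = 0 := by
  have h := (hκ.isKillingData hx).killing_eq C D C' D'
  rw [symmetrize, sum_perm_fin_two (fun v => S.kappaPhi κ i x v ![C', D'])]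
  simp only [kappaPhi, Matrix.cons_val_zero, Matrix.cons_val_one, Nat.factorial]
  simp only [phiAt] at h
  push_cast
  linear_combination h

/-- `κ_{(D}{}^F Ψ_{ABC)F} = 0`. -/
lemma IsKillingSpinor.vanishes_symmetrize_kappaPsi (hκ : S.IsKillingSpinor κ) :
    S.Vanishes (S.symmetrize (S.kappaPsi κ)) := by
  intro i x hx B B'
  have hB : B = ![B 0, B 1, B 2, B 3] := by
    funext k
    fin_cases k <;> rfl
  have hK : ∀ D A B C, S.kappaPsi κ i x ![D, A, B, C] B'
      = ∑ F, ∑ G, eps F G * κ i x ![D, G] ![] * S.psiAt i x A B C F := fun _ _ _ _ => rfl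
  -- The last three slots all belong to the symmetric `Ψ`, so the 24 permutations reduce to four
  -- terms.
  have hS := sum_perm_fin_four (fun v => S.kappaPsi κ i x v B') (B 0) (B 1) (B 2) (B 3)
    (fun D A B C => by simp only [hK, psiAt_symm_left hx A B])
    (fun D A B C => by simp only [hK, psiAt_symm_mid hx A B])
  rw [symmetrize, hB, hS]
  have h := (hκ.isKillingData hx).kappaPsi_eq (B 0) (B 1) (B 2) (B 3)
  simp only [hK]
  rw [h, mul_zero, mul_zero]

/-- `□ κ_{BC} = - 4 Λ κ_{BC} + κ^{AD} Ψ_{BCAD}`. -/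
lemma IsKillingSpinor.box_eq (hκ : S.IsKillingSpinor κ) (hx : x ∈ S.dom i) (B C : Fin 2) :
    S.box κ i x ![B, C] ![]
      = - 4 * S.Lam i x ![] ![] * κ i x ![B, C] ![]
        + ∑ A, ∑ E, ∑ D, ∑ F, eps A E * eps D F * κ i x ![E, F] ![]
            * S.Psi i x ![B, C, A, D] ![] := by
  refine Eq.trans ?_ ((hκ.isKillingData hx).box_eq B C)
  simp only [box]
  exact Finset.sum_congr rfl fun A _ => Finset.sum_congr rfl fun G _ => Finset.sum_congr rfl
    fun A' _ => Finset.sum_congr rfl fun G' _ => congrArg _ (hκ.covDeriv_covDeriv_eq hx A A' G G' B C)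

end killing

end SpinStructure

namespace SpinStructure

variable {M : Type*} [TopologicalSpace M] [ChartedSpace E4 M] [IsManifold (𝓡 4) ∞ M]
  {g : LorentzianMetric M} {ι : Type*} {S : SpinStructure g ι} {i : ι} {x : M}

/-! ### The wave equation of the auxiliary vector -/

lemma SmoothField.Phi (S : SpinStructure g ι) (i : ι) : S.SmoothField S.Phi i := fun B B' =>
  SmoothOn.sum fun a => SmoothOn.sum fun b =>
    (SmoothOn.const (sigma a (B 0) (B' 0) * sigma b (B 1) (B' 1))).mul
      (((SmoothOn.const (- (1 / 2) : ℝ)).mul_real ((SmoothOn.ricci S i a b).sub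
        (((SmoothOn.const (1 / 4 : ℝ)).mul_real (SmoothOn.scalarCurv S i)).mul_real
          (SmoothOn.const (eta a b))))).ofReal)

lemma covAlong_two_two (T : S.Field 2 2) (a : Fin 4) (B C B' C' : Fin 2) :
    S.covAlong a T i x ![B, C] ![B', C']
      = S.frameDeriv i a (fun y => T i y ![B, C] ![B', C']) x
        - ∑ E, S.spinConn i a E B x * T i x ![E, C] ![B', C']
        - ∑ E, S.spinConn i a E C x * T i x ![B, E] ![B', C']
        - ∑ E, star (S.spinConn i a E B' x) * T i x ![B, C] ![E, C']
        - ∑ E, star (S.spinConn i a E C' x) * T i x ![B, C] ![B', E] := by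
  have h1 : ∀ f : Fin 2 → ℂ, ∑ k, f k = f 0 + f 1 := Fin.sum_univ_two
  simp only [covAlong, h1, Matrix.cons_val_zero, Matrix.cons_val_one, update_pair_zero,
    update_pair_one]
  ring

lemma covDeriv_symm_unprimed {T : S.Field 2 2}
    (hT : ∀ x ∈ S.dom i, ∀ A B A' B', T i x ![A, B] ![A', B'] = T i x ![B, A] ![A', B'])
    (hx : x ∈ S.dom i) (A A' B C B' C' : Fin 2) :
    S.covDeriv T i x ![A, B, C] ![A', B', C'] = S.covDeriv T i x ![A, C, B] ![A', B', C'] := by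
  refine (covDeriv_cons T i x A A' ![B, C] ![B', C']).trans (Eq.trans ?_
    (covDeriv_cons T i x A A' ![C, B] ![B', C']).symm)
  refine Finset.sum_congr rfl fun a _ => ?_
  rw [covAlong_two_two, covAlong_two_two, frameDeriv_congr hx (fun y hy => hT y hy B C B' C')]
  simp only [fun E B' C' => hT x hx E C B' C', fun E B' C' => hT x hx B E B' C']
  ring

lemma covDeriv_symm_primed {T : S.Field 2 2}
    (hT : ∀ x ∈ S.dom i, ∀ A B A' B', T i x ![A, B] ![A', B'] = T i x ![A, B] ![B', A'])
    (hx : x ∈ S.dom i) (A A' B C B' C' : Fin 2) :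
    S.covDeriv T i x ![A, B, C] ![A', B', C'] = S.covDeriv T i x ![A, B, C] ![A', C', B'] := by
  refine (covDeriv_cons T i x A A' ![B, C] ![B', C']).trans (Eq.trans ?_
    (covDeriv_cons T i x A A' ![B, C] ![C', B']).symm)
  refine Finset.sum_congr rfl fun a _ => ?_
  rw [covAlong_two_two, covAlong_two_two, frameDeriv_congr hx (fun y hy => hT y hy B C B' C')]
  simp only [fun E B C => hT x hx B C E C', fun E B C => hT x hx B C B' E]
  ring

section wave

variable {κ : S.Field 2 0}

/-- The derivative of `∇_{BB'} ξ_{CC'} + ∇_{CC'} ξ_{BB'} + 6 κ_{(B}{}^D Φ_{C)DB'C'} = 0` along a vector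
of the tetrad. -/
lemma IsKillingSpinor.covAlong_covDeriv_aux_symm (hκ : S.IsKillingSpinor κ) (hx : x ∈ S.dom i)
    (a : Fin 4) (B C B' C' : Fin 2) :
    S.covAlong a (S.covDeriv (S.aux κ)) i x ![B, C] ![B', C']
      + S.covAlong a (S.covDeriv (S.aux κ)) i x ![C, B] ![C', B']
      + 3 * ((∑ D, ∑ G, eps D G * (S.covAlong a κ i x ![B, G] ![] * S.Phi i x ![C, D] ![B', C']
          + κ i x ![B, G] ![] * S.covAlong a S.Phi i x ![C, D] ![B', C']))
        + ∑ D, ∑ G, eps D G * (S.covAlong a κ i x ![C, G] ![] * S.Phi i x ![B, D] ![B', C']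
          + κ i x ![C, G] ![] * S.covAlong a S.Phi i x ![B, D] ![B', C'])) = 0 := by
  obtain ⟨e1, e2, e3, e4⟩ := eps_values
  have hs := hκ.isSpinorField.smoothField i
  have hv := hs.aux.covDeriv
  have hφ := SmoothField.Phi S i
  have hE : ∀ y ∈ S.dom i, ∀ B C B' C', S.covDeriv (S.aux κ) i y ![B, C] ![B', C']
      + S.covDeriv (S.aux κ) i y ![C, B] ![C', B']
      + 3 * ((κ i y ![C, 1] ![] * S.Phi i y ![B, 0] ![B', C']
          - κ i y ![C, 0] ![] * S.Phi i y ![B, 1] ![B', C'])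
        + (κ i y ![B, 1] ![] * S.Phi i y ![C, 0] ![B', C']
          - κ i y ![B, 0] ![] * S.Phi i y ![C, 1] ![B', C'])) = 0 := by
    intro y hy B C B' C'
    have h := (hκ.isKillingData hy).killing_eq B C B' C'
    simp only [Fin.sum_univ_two, e1, e2, e3, e4, phiAt] at h
    linear_combination h
  have hk := fun B G => (hs ![B, G] ![]).hasD x a
  have hp := fun B G => (hφ ![B, G] ![B', C']).hasD x a
  have hd := ((((hv ![B, C] ![B', C']).hasD x a).add ((hv ![C, B] ![C', B']).hasD x a) hx).add
    (((((hk C 1).mul (hp B 0) hx).sub ((hk C 0).mul (hp B 1) hx) hx).add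
      (((hk B 1).mul (hp C 0) hx).sub ((hk B 0).mul (hp C 1) hx) hx) hx).const_mul 3 hx) hx).2
  rw [frameDeriv_congr hx (fun y hy => hE y hy B C B' C'), frameDeriv_const] at hd
  have ht := spinConn_trace (S := S) i a x
  -- Every connection term multiplies the undifferentiated identity with one index replaced, and so
  -- vanishes.
  have h1 := fun E => hE x hx E C B' C'
  have h2 := fun E => hE x hx B E B' C'
  have h3 := fun E => hE x hx B C E C'
  have h4 := fun E => hE x hx B C B' E
  simp only [covAlong_two_two, covAlong_two_zero, Fin.sum_univ_two, e1, e2, e3, e4, ht]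
  linear_combination - hd - S.spinConn i a 0 B x * h1 0 - S.spinConn i a 1 B x * h1 1
    - S.spinConn i a 0 C x * h2 0 - S.spinConn i a 1 C x * h2 1
    - star (S.spinConn i a 0 B' x) * h3 0 - star (S.spinConn i a 1 B' x) * h3 1
    - star (S.spinConn i a 0 C' x) * h4 0 - star (S.spinConn i a 1 C' x) * h4 1

lemma IsKillingSpinor.covDeriv_covDeriv_aux_symm (hκ : S.IsKillingSpinor κ) (hx : x ∈ S.dom i)
    (A A' B B' C C' : Fin 2) :
    S.covDeriv (S.covDeriv (S.aux κ)) i x ![A, B, C] ![A', B', C']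
      + S.covDeriv (S.covDeriv (S.aux κ)) i x ![A, C, B] ![A', C', B']
      + 3 * ((∑ D, ∑ G, eps D G * (killingDeriv (fun A A' => S.aux κ i x ![A] ![A']) A A' B G
            * S.phiAt i x C D B' C'
          + κ i x ![B, G] ![] * S.covDeriv S.Phi i x ![A, C, D] ![A', B', C']))
        + ∑ D, ∑ G, eps D G * (killingDeriv (fun A A' => S.aux κ i x ![A] ![A']) A A' C G
            * S.phiAt i x B D B' C'
          + κ i x ![C, G] ![] * S.covDeriv S.Phi i x ![A, B, D] ![A', B', C'])) = 0 := by
  obtain ⟨e1, e2, e3, e4⟩ := eps_values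
  have h := fun a => hκ.covAlong_covDeriv_aux_symm hx a B C B' C'
  have hv := fun B C B' C' => covDeriv_cons (S.covDeriv (S.aux κ)) i x A A' ![B, C] ![B', C']
  have hp := fun B C => covDeriv_cons S.Phi i x A A' ![B, C] ![B', C']
  have hk := fun B C => (hκ.covDeriv_eq hx A A' B C).symm.trans
    (covDeriv_cons κ i x A A' ![B, C] ![])
  change S.covDeriv (S.covDeriv (S.aux κ)) i x (Fin.cons A ![B, C]) (Fin.cons A' ![B', C'])
      + S.covDeriv (S.covDeriv (S.aux κ)) i x (Fin.cons A ![C, B]) (Fin.cons A' ![C', B'])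
      + 3 * ((∑ D, ∑ G, eps D G * (_ * _
          + κ i x ![B, G] ![] * S.covDeriv S.Phi i x (Fin.cons A ![C, D]) (Fin.cons A' ![B', C'])))
        + ∑ D, ∑ G, eps D G * (_ * _
          + κ i x ![C, G] ![] * S.covDeriv S.Phi i x (Fin.cons A ![B, D])
              (Fin.cons A' ![B', C']))) = 0
  simp only [hv, hp, hk, phiAt]
  simp only [Fin.sum_univ_two, Fin.sum_univ_four, e1, e2, e3, e4] at h ⊢
  linear_combination sigma 0 A A' * h 0 + sigma 1 A A' * h 1 + sigma 2 A A' * h 2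
    + sigma 3 A A' * h 3

/-- The wave equation of the auxiliary vector of a Killing spinor. -/
lemma IsKillingSpinor.box_aux_eq {Ξ s : M → ℝ} {Y : S.Field 3 1} (hCFE : S.IsCFESolution Ξ s Y)
    (hκ : S.IsKillingSpinor κ) (hx : x ∈ S.dom i) (A A' : Fin 2) :
    S.box (S.aux κ) i x ![A] ![A']
      = - 6 * S.aux κ i x ![A] ![A'] * S.Lam i x ![] ![]
        - 2 * (∑ B, ∑ D, ∑ B', ∑ D', eps B D * eps B' D'
            * S.aux κ i x ![D] ![D'] * S.Phi i x ![A, B] ![A', B'])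
        - (3 / 2) * (∑ B, ∑ D, ∑ C, ∑ E, eps B D * eps C E
            * κ i x ![D, E] ![] * Y i x ![A, B, C] ![A'])
        - 12 * ∑ B, ∑ D, eps B D * κ i x ![A, B] ![] * S.covDeriv S.Lam i x ![D] ![A'] :=
  SpinorCFE.box_aux_eq (κ := fun A B => κ i x ![A, B] ![]) (ξ := fun A A' => S.aux κ i x ![A] ![A'])
    (L := fun A A' => S.covDeriv S.Lam i x ![A] ![A'])
    (ψ := S.psiAt i x) (φ := S.phiAt i x) (Λ := S.lamAt i x)
    (Y := fun A B C C' => Y i x ![A, B, C] ![C'])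
    (W := fun A A' B B' C C' =>
      S.covDeriv (S.covDeriv (S.aux κ)) i x ![A, B, C] ![A', B', C'])
    (N := fun A A' B C B' C' => S.covDeriv S.Phi i x ![A, B, C] ![A', B', C'])
    (hκ.symm i x hx) (psiAt_symm_left hx) (psiAt_symm_mid hx) (psiAt_symm_right hx)
    (phiAt_symm_left hx) (phiAt_symm_right hx)
    (fun A A' B C B' C' => covDeriv_symm_unprimed (fun _ hy => phiAt_symm_left hy) hx A A' B C B' C')
    (fun A A' B C B' C' => covDeriv_symm_primed (fun _ hy => phiAt_symm_right hy) hx A A' B C B' C')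
    (fun A B C C' => by
      rw [← hCFE.cotton_symm i x hx (Equiv.swap 0 1) ![A, B, C] ![C']]
      congr 1
      funext k
      fin_cases k <;> rfl)
    (fun A B C C' => by
      rw [← hCFE.cotton_symm i x hx (Equiv.swap 1 2) ![A, B, C] ![C']]
      congr 1
      funext k
      fin_cases k <;> rfl)
    (hκ.covDeriv_covDeriv_aux_symm hx)
    (covDeriv_comm_one_one (hκ.isSpinorField.smoothField i).aux hx)
    (fun A B C C' => hCFE.Δ_eq i x hx ![A, B, C] ![C']) A A'

end wave

end SpinStructure

/-! ### Vectors and spinors -/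

/-- The symbols form an orthonormal basis of the 2 × 2 matrices for the Hermitian inner product.
This is completeness; orthonormality comes next, and together they make vectors and spinors
`T_{AA'}` interchangeable. -/
lemma sum_sigma_star_sigma (A A' B B' : Fin 2) :
    ∑ a, sigma a A A' * star (sigma a B B') = if A = B ∧ A' = B' then 1 else 0 := by
  have h : ∀ a, sigma a A A' * star (sigma a B B') = star (sigma a B B') * sigma a A A' :=
    fun a => mul_comm _ _
  simp only [h, star_sigma_mul_sigma]
  fin_cases A <;> fin_cases A' <;> fin_cases B <;> fin_cases B' <;>
  · simp [pauli, Fin.sum_univ_four]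
    try norm_num

lemma sum_star_sigma_sigma (a b : Fin 4) :
    ∑ A, ∑ A', star (sigma a A A') * sigma b A A' = if a = b then 1 else 0 := by
  simp only [star_sigma_mul_sigma]
  fin_cases a <;> fin_cases b <;>
  · simp [pauli]
    try norm_num

lemma sum_star_sigma_star_sigma_eps (a b : Fin 4) :
    ∑ A, ∑ A', ∑ B, ∑ B', star (sigma a A A') * star (sigma b B B') * (eps A B * eps A' B')
      = eta a b := by
  simp only [star_sigma_mul_star_sigma]
  fin_cases a <;> fin_cases b <;>
  · simp [pauli, eps, eta]
    try norm_num

lemma sum_eta_star_sigma_star_sigma (A A' B B' : Fin 2) :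
    ∑ a, (eta a a : ℂ) * (star (sigma a A A') * star (sigma a B B')) = eps A B * eps A' B' := by
  simp only [star_sigma_mul_star_sigma]
  fin_cases A <;> fin_cases A' <;> fin_cases B <;> fin_cases B' <;>
  · simp [pauli, eps, eta, Fin.sum_univ_four]
    try norm_num

namespace SpinStructure

variable {M : Type*} [TopologicalSpace M] [ChartedSpace E4 M] [IsManifold (𝓡 4) ∞ M]
  {g : LorentzianMetric M} {ι : Type*} {S : SpinStructure g ι} {i : ι} {x : M}

lemma sum_sigma_toCovector (T : S.Field 1 1) (i : ι) (x : M) (A A' : Fin 2) :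
    ∑ a, sigma a A A' * S.toCovector T i x a = T i x ![A] ![A'] := by
  have h : ∑ a, sigma a A A' * S.toCovector T i x a
      = ∑ B, ∑ B', (∑ a, sigma a A A' * star (sigma a B B')) * T i x ![B] ![B'] := by
    simp only [toCovector, Fin.sum_univ_four, Fin.sum_univ_two]
    ring
  rw [h]
  simp only [sum_sigma_star_sigma, ite_mul, one_mul, zero_mul]
  fin_cases A <;> fin_cases A' <;> simp

lemma sum_star_sigma_mul_sum (v : Fin 4 → ℂ) (b : Fin 4) :
    ∑ B, ∑ B', star (sigma b B B') * ∑ c, sigma c B B' * v c = v b := by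
  have h : ∑ B, ∑ B', star (sigma b B B') * ∑ c, sigma c B B' * v c
      = ∑ c, (∑ B, ∑ B', star (sigma b B B') * sigma c B B') * v c := by
    simp only [Fin.sum_univ_four, Fin.sum_univ_two]
    ring
  rw [h]
  simp only [sum_star_sigma_sigma, ite_mul, one_mul, zero_mul]
  simp

lemma SmoothField.toCovector {T : S.Field 1 1} (hT : S.SmoothField T i) (a : Fin 4) :
    S.SmoothOn i (fun x => S.toCovector T i x a) :=
  SmoothOn.sum fun A => SmoothOn.sum fun A' => (SmoothOn.const (star (sigma a A A'))).mul
    (hT ![A] ![A'])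

/-- Again because `σ` is parallel: spinor and tensor derivatives correspond. -/
lemma covAlong_eq_covDerivCovector {T : S.Field 1 1} (hT : S.SmoothField T i) (hx : x ∈ S.dom i)
    (a : Fin 4) (B B' : Fin 2) :
    S.covAlong a T i x ![B] ![B']
      = ∑ b, sigma b B B' * S.covDerivCovector (S.toCovector T) i x a b := by
  have hd := (HasD.sum (s := Finset.univ) (fun b =>
    ((hT.toCovector b).hasD x a).const_mul (sigma b B B') hx) hx).congr
      (fun y _ => (sum_sigma_toCovector T i y B B').symm) hx |>.2
  have hc := fun c => sigma_conn (S := S) i x a c B B'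
  rw [covAlong_one_one, hd]
  simp only [covDerivCovector, ← sum_sigma_toCovector T i x]
  simp only [Fin.sum_univ_four, Fin.sum_univ_two] at hc ⊢
  linear_combination - S.toCovector T i x 0 * hc 0 - S.toCovector T i x 1 * hc 1
    - S.toCovector T i x 2 * hc 2 - S.toCovector T i x 3 * hc 3

lemma covDerivCovector_toCovector {T : S.Field 1 1} (hT : S.SmoothField T i) (hx : x ∈ S.dom i)
    (a b : Fin 4) :
    S.covDerivCovector (S.toCovector T) i x a b
      = ∑ A, ∑ A', ∑ B, ∑ B', star (sigma a A A') * star (sigma b B B')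
          * S.covDeriv T i x ![A, B] ![A', B'] := by
  have h : ∀ A A' B B', S.covDeriv T i x ![A, B] ![A', B']
      = ∑ c, sigma c A A' * ∑ d, sigma d B B' * S.covDerivCovector (S.toCovector T) i x c d := by
    intro A A' B B'
    refine (covDeriv_cons T i x A A' ![B] ![B']).trans ?_
    simp only [covAlong_eq_covDerivCovector hT hx]
  have h2 : ∀ (w : Fin 4 → Fin 4 → ℂ) (A A' : Fin 2),
      ∑ B, ∑ B', star (sigma a A A') * star (sigma b B B')
          * ∑ c, sigma c A A' * ∑ d, sigma d B B' * w c d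
        = star (sigma a A A') * ∑ c, sigma c A A' * w c b := by
    intro w A A'
    have e : ∀ c, w c b = ∑ B, ∑ B', star (sigma b B B') * ∑ d, sigma d B B' * w c d :=
      fun c => (sum_star_sigma_mul_sum (w c) b).symm
    simp only [e]
    simp only [Fin.sum_univ_two, Fin.sum_univ_four]
    ring
  simp only [h, h2]
  exact (sum_star_sigma_mul_sum (fun c => S.covDerivCovector (S.toCovector T) i x c b) a).symm

lemma divergence_toCovector {T : S.Field 1 1} (hT : S.SmoothField T i) (hx : x ∈ S.dom i) :
    S.divergence (S.toCovector T) i x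
      = spinorTrace (fun A A' B B' => S.covDeriv T i x ![A, B] ![A', B']) := by
  simp only [divergence, covDerivCovector_toCovector hT hx, spinorTrace,
    ← sum_eta_star_sigma_star_sigma]
  simp only [Fin.sum_univ_two, Fin.sum_univ_four]
  ring

lemma sum_eta_toCovector (T U : S.Field 1 1) (i : ι) (x : M) :
    ∑ a, (eta a a : ℂ) * S.toCovector T i x a * S.toCovector U i x a
      = ∑ A, ∑ B, ∑ A', ∑ B', eps A B * eps A' B' * (T i x ![A] ![A'] * U i x ![B] ![B']) := by
  simp only [toCovector, ← sum_eta_star_sigma_star_sigma]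
  simp only [Fin.sum_univ_two, Fin.sum_univ_four]
  ring

end SpinStructure

namespace SpinStructure

variable {M : Type*} [TopologicalSpace M] [ChartedSpace E4 M] [IsManifold (𝓡 4) ∞ M]
  {g : LorentzianMetric M} {ι : Type*} {S : SpinStructure g ι} {i : ι} {x : M}

/-! ### The conformal Killing vector -/

lemma covAlong_ofFun {f : M → ℝ} (hf : S.SmoothOn i f) (hx : x ∈ S.dom i) (a : Fin 4)
    (B B' : Fin 0 → Fin 2) :
    S.covAlong a (S.ofFun f) i x B B' = ((S.frameDeriv i a f x : ℝ) : ℂ) := by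
  simp only [covAlong, Finset.univ_eq_empty, Finset.sum_empty, sub_zero, ofFun]
  exact frameDeriv_ofReal hf hx a

lemma SmoothField.ofFun {f : M → ℝ} (hf : S.SmoothOn i f) : S.SmoothField (S.ofFun f) i :=
  fun _ _ => hf.ofReal

lemma covDeriv_ofFun {f : M → ℝ} (hf : S.SmoothOn i f) (hx : x ∈ S.dom i) (A A' : Fin 2) :
    S.covDeriv (S.ofFun f) i x ![A] ![A']
      = ∑ a, sigma a A A' * ((S.frameDeriv i a f x : ℝ) : ℂ) := by
  refine (covDeriv_cons (S.ofFun f) i x A A' ![] ![]).trans ?_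
  exact Finset.sum_congr rfl fun a _ => by rw [covAlong_ofFun hf hx]

lemma toCovector_covDeriv_ofFun {f : M → ℝ} (hf : S.SmoothOn i f) (hx : x ∈ S.dom i) (a : Fin 4) :
    S.toCovector (S.covDeriv (S.ofFun f)) i x a = ((S.frameDeriv i a f x : ℝ) : ℂ) := by
  simp only [toCovector, covDeriv_ofFun hf hx]
  exact sum_star_sigma_mul_sum (fun a => ((S.frameDeriv i a f x : ℝ) : ℂ)) a

section confKilling

variable {κ : S.Field 2 0} {Ξ s : M → ℝ}

lemma confKilling_apply (Ξ : M → ℝ) (κ : S.Field 2 0) (i : ι) (x : M) (A A' : Fin 2) :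
    S.confKilling Ξ κ i x ![A] ![A'] = (Ξ x : ℂ) * S.aux κ i x ![A] ![A']
      - 3 * (κ i x ![A, 0] ![] * S.covDeriv (S.ofFun Ξ) i x ![1] ![A']
        - κ i x ![A, 1] ![] * S.covDeriv (S.ofFun Ξ) i x ![0] ![A']) := by
  obtain ⟨e1, e2, e3, e4⟩ := eps_values
  simp only [confKilling, Fin.sum_univ_two, e1, e2, e3, e4, Matrix.cons_val_zero]
  ring

lemma SmoothField.confKilling (hκ : S.SmoothField κ i) (hΞ : S.SmoothOn i Ξ) :
    S.SmoothField (S.confKilling Ξ κ) i := fun B B' =>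
  (hΞ.ofReal.mul (hκ.aux B B')).sub ((SmoothOn.const 3).mul (SmoothOn.sum fun Q =>
    SmoothOn.sum fun C => ((SmoothOn.const (eps Q C)).mul (hκ ![B 0, Q] ![])).mul
      ((SmoothField.ofFun hΞ).covDeriv ![C] B')))

/-- The Leibniz rule across the contraction over `Q`: the connection terms on the contracted pair
cancel by `spinConn_trace`. -/
lemma covAlong_confKilling (hκ : S.SmoothField κ i) (hΞ : S.SmoothOn i Ξ) (hx : x ∈ S.dom i)
    (a : Fin 4) (B B' : Fin 2) :
    S.covAlong a (S.confKilling Ξ κ) i x ![B] ![B']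
      = ((S.frameDeriv i a Ξ x : ℝ) : ℂ) * S.aux κ i x ![B] ![B']
        + (Ξ x : ℂ) * S.covAlong a (S.aux κ) i x ![B] ![B']
        - 3 * ((S.covAlong a κ i x ![B, 0] ![] * S.covDeriv (S.ofFun Ξ) i x ![1] ![B']
            + κ i x ![B, 0] ![] * S.covAlong a (S.covDeriv (S.ofFun Ξ)) i x ![1] ![B'])
          - (S.covAlong a κ i x ![B, 1] ![] * S.covDeriv (S.ofFun Ξ) i x ![0] ![B']
            + κ i x ![B, 1] ![] * S.covAlong a (S.covDeriv (S.ofFun Ξ)) i x ![0] ![B'])) := by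
  have hf : S.HasD i x a (fun y => (Ξ y : ℂ)) _ := ⟨hΞ.ofReal, frameDeriv_ofReal hΞ hx a⟩
  have hk := fun Q => (hκ ![B, Q] ![]).hasD x a
  have hg := fun C => ((SmoothField.ofFun hΞ).covDeriv ![C] ![B']).hasD x a
  have hd := (((hf.mul ((hκ.aux ![B] ![B']).hasD x a) hx).sub
    ((((hk 0).mul (hg 1) hx).sub ((hk 1).mul (hg 0) hx) hx).const_mul 3 hx) hx).congr
      (fun y _ => confKilling_apply Ξ κ i y B B') hx).2
  have ht := spinConn_trace (S := S) i a x
  rw [covAlong_one_one, hd]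
  simp only [confKilling_apply, covAlong_one_one, covAlong_two_zero, Fin.sum_univ_two, ht]
  ring

lemma IsKillingSpinor.covDeriv_confKilling (hκ : S.IsKillingSpinor κ) (hΞ : S.SmoothOn i Ξ)
    (hx : x ∈ S.dom i) (A A' B B' : Fin 2) :
    S.covDeriv (S.confKilling Ξ κ) i x ![A, B] ![A', B']
      = confKillingDeriv (fun A B => κ i x ![A, B] ![]) (fun A A' => S.aux κ i x ![A] ![A'])
          (fun A A' => S.covDeriv (S.ofFun Ξ) i x ![A] ![A'])
          (fun A A' B B' => S.covDeriv (S.aux κ) i x ![A, B] ![A', B'])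
          (fun A A' B B' => S.covDeriv (S.covDeriv (S.ofFun Ξ)) i x ![A, B] ![A', B'])
          (Ξ x) A A' B B' := by
  obtain ⟨e1, e2, e3, e4⟩ := eps_values
  have h := fun a => covAlong_confKilling (hκ.isSpinorField.smoothField i) hΞ hx a B B'
  have hk := fun B C => (hκ.covDeriv_eq hx A A' B C).symm.trans
    (covDeriv_cons κ i x A A' ![B, C] ![])
  have hv : S.covDeriv (S.aux κ) i x ![A, B] ![A', B']
      = ∑ a, sigma a A A' * S.covAlong a (S.aux κ) i x ![B] ![B'] :=
    covDeriv_cons (S.aux κ) i x A A' ![B] ![B']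
  have hz : ∀ C, S.covDeriv (S.covDeriv (S.ofFun Ξ)) i x ![A, C] ![A', B']
      = ∑ a, sigma a A A' * S.covAlong a (S.covDeriv (S.ofFun Ξ)) i x ![C] ![B'] :=
    fun C => covDeriv_cons (S.covDeriv (S.ofFun Ξ)) i x A A' ![C] ![B']
  refine (covDeriv_cons (S.confKilling Ξ κ) i x A A' ![B] ![B']).trans ?_
  simp only [h, confKillingDeriv, hk, hv, hz, Fin.sum_univ_two, e1, e2, e3, e4]
  rw [covDeriv_ofFun hΞ hx A A']
  simp only [Fin.sum_univ_four]
  ring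

/-- The indices of the curvature terms come out reversed because in `Z₂` the outer derivative
carries the second pair `BB'`. -/
lemma IsCFESolution.covDeriv_covDeriv_ofFun {Y : S.Field 3 1} (hCFE : S.IsCFESolution Ξ s Y)
    (hx : x ∈ S.dom i) (A A' B B' : Fin 2) :
    S.covDeriv (S.covDeriv (S.ofFun Ξ)) i x ![A, B] ![A', B']
      = Ξ x * S.phiAt i x B A B' A' - Ξ x * S.lamAt i x * eps B A * eps B' A'
        + s x * eps B A * eps B' A' := by
  have h := hCFE.Z₂_eq i x hx ![B, A] ![B', A']
  simp only [Z₂, Matrix.cons_val_zero, Matrix.cons_val_one] at h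
  rw [phiAt, lamAt]
  linear_combination h

lemma IsCFESolution.smoothOn {Y : S.Field 3 1} (hCFE : S.IsCFESolution Ξ s Y) (i : ι) :
    S.SmoothOn i Ξ := hCFE.smooth_Ξ.contMDiffOn

/-- `∇_a X_b + ∇_b X_a = ½ (∇_c X^c) g_{ab}`. -/
lemma IsKillingSpinor.conformalKilling {Y : S.Field 3 1} (hCFE : S.IsCFESolution Ξ s Y)
    (hκ : S.IsKillingSpinor κ) (hx : x ∈ S.dom i) (a b : Fin 4) :
    S.covDerivCovector (S.toCovector (S.confKilling Ξ κ)) i x a b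
        + S.covDerivCovector (S.toCovector (S.confKilling Ξ κ)) i x b a
      = (1 / 2) * S.divergence (S.toCovector (S.confKilling Ξ κ)) i x * (eta a b : ℂ) := by
  have hs := (hκ.isSpinorField.smoothField i).confKilling (hCFE.smoothOn i)
  have h := (hκ.isKillingData hx).confKilling_eq (ξ := fun A A' => S.aux κ i x ![A] ![A'])
    (d := fun A A' => S.covDeriv (S.ofFun Ξ) i x ![A] ![A']) (hCFE.covDeriv_covDeriv_ofFun hx)
  have hT := funext fun A => funext fun A' => funext fun B => funext fun B' =>
    hκ.covDeriv_confKilling (hCFE.smoothOn i) hx A A' B B'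
  rw [← hT] at h
  rw [divergence_toCovector hs hx, covDerivCovector_toCovector hs hx,
    covDerivCovector_toCovector hs hx, ← sum_star_sigma_star_sigma_eps]
  -- Renaming the summation indices gives both sums the same weights, so that the pointwise spinor
  -- identity applies under the sum.
  have e : ∑ A, ∑ A', ∑ B, ∑ B', star (sigma b A A') * star (sigma a B B')
        * S.covDeriv (S.confKilling Ξ κ) i x ![A, B] ![A', B']
      = ∑ A, ∑ A', ∑ B, ∑ B', star (sigma a A A') * star (sigma b B B')
        * S.covDeriv (S.confKilling Ξ κ) i x ![B, A] ![B', A'] := by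
    simp only [Fin.sum_univ_two]
    ring
  rw [e]
  simp only [← Finset.sum_add_distrib, ← mul_add, h, Finset.mul_sum]
  refine Finset.sum_congr rfl fun _ _ => Finset.sum_congr rfl fun _ _ =>
    Finset.sum_congr rfl fun _ _ => Finset.sum_congr rfl fun _ _ => ?_
  ring

/-- `X^a ∇_a Ξ = ¼ Ξ ∇_a X^a`. -/
lemma IsKillingSpinor.confKilling_grad {Y : S.Field 3 1} (hCFE : S.IsCFESolution Ξ s Y)
    (hκ : S.IsKillingSpinor κ) (hx : x ∈ S.dom i) :
    ∑ a, (eta a a : ℂ) * S.toCovector (S.confKilling Ξ κ) i x a * ((S.frameDeriv i a Ξ x : ℝ) : ℂ)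
      = (1 / 4) * (Ξ x : ℂ) * S.divergence (S.toCovector (S.confKilling Ξ κ)) i x := by
  have hs := (hκ.isSpinorField.smoothField i).confKilling (hCFE.smoothOn i)
  have h := (hκ.isKillingData hx).confKilling_grad_eq (ξ := fun A A' => S.aux κ i x ![A] ![A'])
    (d := fun A A' => S.covDeriv (S.ofFun Ξ) i x ![A] ![A']) (hCFE.covDeriv_covDeriv_ofFun hx)
  simp only [← toCovector_covDeriv_ofFun (hCFE.smoothOn i) hx, sum_eta_toCovector]
  rw [divergence_toCovector hs hx]
  simp only [hκ.covDeriv_confKilling (hCFE.smoothOn i) hx]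
  exact h

end confKilling

end SpinStructure

end SpinorCFE

end

/-! ### The main theorem -/

theorem mainTheorem4 {M : Type*} [TopologicalSpace M] [ChartedSpace SpinorCFE.E4 M]
    [IsManifold (𝓡 4) ∞ M] (g : SpinorCFE.LorentzianMetric M) {ι : Type*}
    (S : SpinorCFE.SpinStructure g ι) (Ξ s : M → ℝ) (Y : S.Field 3 1) (κ : S.Field 2 0)
    (hCFE : S.IsCFESolution Ξ s Y) (hκ : S.IsKillingSpinor κ) :
    let ξ : S.Field 1 1 := S.aux κ
    let X : ι → M → Fin 4 → ℂ := S.toCovector (S.confKilling Ξ κ)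
    -- `∇_{CC'} ξ_{DD'} + ∇_{DD'} ξ_{CC'} + 6 κ_{(D}{}^A Φ_{C)AC'D'} = 0`
    (∀ i, ∀ x ∈ S.dom i, ∀ C D C' D' : Fin 2,
      S.covDeriv ξ i x ![C, D] ![C', D'] + S.covDeriv ξ i x ![D, C] ![D', C']
        + 6 * S.symmetrize (S.kappaPhi κ) i x ![D, C] ![C', D'] = 0) ∧
    -- `κ_{(D}{}^F Ψ_{ABC)F} = 0`
    S.Vanishes (S.symmetrize (S.kappaPsi κ)) ∧
    -- `∇_a X_b + ∇_b X_a = ½ ∇^c X_c g_{ab}`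
    (∀ i, ∀ x ∈ S.dom i, ∀ a b : Fin 4,
      S.covDerivCovector X i x a b + S.covDerivCovector X i x b a
        = (1 / 2) * S.divergence X i x * (SpinorCFE.eta a b : ℂ)) ∧
    -- `X^a ∇_a Ξ = ¼ Ξ ∇_a X^a`
    (∀ i, ∀ x ∈ S.dom i,
      ∑ a, (SpinorCFE.eta a a : ℂ) * X i x a * ((S.frameDeriv i a Ξ x : ℝ) : ℂ)
        = (1 / 4) * (Ξ x : ℂ) * S.divergence X i x) ∧
    -- `□ κ_{BC} = -4 Λ κ_{BC} + κ^{AD} Ψ_{BCAD}`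
    (∀ i, ∀ x ∈ S.dom i, ∀ B C : Fin 2,
      S.box κ i x ![B, C] ![]
        = -4 * S.Lam i x ![] ![] * κ i x ![B, C] ![]
          + ∑ A, ∑ E, ∑ D, ∑ F, SpinorCFE.eps A E * SpinorCFE.eps D F * κ i x ![E, F] ![]
              * S.Psi i x ![B, C, A, D] ![]) ∧
    -- `□ ξ_{AA'} = -6 ξ_{AA'} Λ - 2 ξ^{BB'} Φ_{ABA'B'} - (3/2) κ^{BC} Y_{ABCA'}`
    -- `  - 12 κ_{AB} ∇^B{}_{A'} Λ`
    (∀ i, ∀ x ∈ S.dom i, ∀ A A' : Fin 2,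
      S.box ξ i x ![A] ![A']
        = -6 * ξ i x ![A] ![A'] * S.Lam i x ![] ![]
          - 2 * (∑ B, ∑ D, ∑ B', ∑ D', SpinorCFE.eps B D * SpinorCFE.eps B' D'
              * ξ i x ![D] ![D'] * S.Phi i x ![A, B] ![A', B'])
          - (3 / 2) * (∑ B, ∑ D, ∑ C, ∑ E, SpinorCFE.eps B D * SpinorCFE.eps C E
              * κ i x ![D, E] ![] * Y i x ![A, B, C] ![A'])
          - 12 * ∑ B, ∑ D, SpinorCFE.eps B D * κ i x ![A, B] ![]
              * S.covDeriv S.Lam i x ![D] ![A']) := by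
  exact ⟨fun i x hx C D C' D' => hκ.covDeriv_aux_symm hx C D C' D',
    hκ.vanishes_symmetrize_kappaPsi,
    fun i x hx a b => hκ.conformalKilling hCFE hx a b,
    fun i x hx => hκ.confKilling_grad hCFE hx,
    fun i x hx B C => hκ.box_eq hx B C,
    fun i x hx A A' => SpinorCFE.SpinStructure.IsKillingSpinor.box_aux_eq hCFE hκ hx A A'⟩
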